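/- **Setting.** Let $m,n,s\ge 0$ and let $r_1,\dots,r_n\ge 0$ be integers (the Poincaré ranks of $n$ finite poles; $s$ is the rank at $\infty$). For times $t=(t_1,t_2,\dots)$ put $P_r(t,\varepsilon)=\sum_{l=1}^r t_l\varepsilon^l$ and $$\mathcal M^{(r)}_{k,j}(t)=\sum_{|\alpha|=k,\;\sum_l l\alpha_l=j}\frac{k!}{\alpha_1!\cdots\alpha_r!}\prod_{l=1}^r t_l^{\alpha_l},\qquad \mathcal M^{(r)}=\bigl(\mathcal M^{(r)}_{k,j}\bigr)_{1\le k,j\le r}.$$ The phase space consists of tuples of $m\times m$ complex matrices $A^{(i)}_k$ ($1\le i\le n$, $0\le k\le r_i$) and $A^{(\infty)}_k$ ($1\le k\le s$), with the Poisson bracket $$\{(A_k)_{ab},(A_l)_{cd}\}=\delta_{bc}(A_{k+l})_{ad}-\delta_{ad}(A_{k+l})_{cb}$$ for matrices at the same pole ($A_{k+l}:=0$ if $k+l$ exceeds the rank of the pole) and $0$ for matrices at different poles. A Casimir is a holomorphic function on the phase space that Poisson commutes with all holomorphic functions. Given distinct $u_1,\dots,u_n\in\mathbb C$ and times $t^{(i)}_k$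 $(1\le k\le r_i)$, $t^{(\infty)}_k$ $(1\le k\le s)$, with $t_1\neq 0$ at each pole of positive rank, consider the connection $$A(\lambda)=\sum_{i=1}^n\sum_{k=0}^{r_i}\frac{B^{(i)}_k}{(\lambda-u_i)^{k+1}}-\sum_{k=1}^{s}\lambda^{k-1}B^{(\infty)}_k,\qquad B_k=\sum_{j\ge k}\mathcal M_{k,j}(t)A_j ,$$ (with the rank and the times of the respective pole), and the spectral invariants $S^{(i)}_k=\frac12\cdot\frac1{2\pi \mathrm i}\oint_{\Gamma_{u_i}}(\lambda-u_i)^k\,\mathrm{Tr}\,A(\lambda)^2\,d\lambda$, where $\Gamma_{u_i}$ is a small circle around $u_i$. **Confluent Hamiltonians** are families of functions $H^{(i)}_0$ (for the time $u_i$) and $H^{(i)}_k$ (for $t^{(i)}_k$, $1\le k\le r_i$) on the phase space, defined recursively. If all finite poles are simple, $H^{(i)}_0=\frac12\operatorname{res}_{\lambda=u_i}\mathrm{Tr}\,A^2$. Otherwise a pole $u=u_i$ of rank $r=r_i\ge1$ arises by confluence from a pole $u$ of rank $r-1$ and a simple pole $v=u+P_r(t^{(i)},\varepsilon)$ with residue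 $C$, where, as $\varepsilon\to0$, there are asymptotic expansions $C\sim\sum_{j\ge -r}W^{[j]}\varepsilon^j$ and $A^{(i)}_k\sim-\sum_{l=1}^{r-k}W^{[-k-l]}\varepsilon^{-l}+\sum_{l\ge0}A^{[k,l]}\varepsilon^l$ $(0\le k\le r-1)$, the coefficients at the other poles expand in nonnegative powers of $\varepsilon$, and the connection tends to the given one. If $H'^{(j)}_k,H'_v$ are confluent Hamiltonians before the confluence, then the confluent Hamiltonians are holomorphic functions that are the limits as $\varepsilon\to0$, for all such confluences and after the addition of Casimirs that may depend on $\varepsilon$ but not on the confluence, of $H'^{(i)}_k+\varepsilon^kH'_v$ for $H^{(i)}_k$, $0\le k<r$, of $\varepsilon^{r}H'_v$ for $H^{(i)}_r$, and of $H'^{(j)}_k$ for $H^{(j)}_k$, $j\ne i$. **Isomonodromic Hamiltonians.** A holomorphic function $H$ on the phase space is an isomonodromic Hamiltonian for a time $\tau\in\{u_i,t^{(i)}_1,\dots,t^{(i)}_{r_i}\}$ if, with $\Omega=\int\frac{\partial A}{\partial\tau}d\lambda$ (explicit derivative at fixed phase space coordinates; $\Omega\to0$ as $\lambda\to\infty$),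 the evolution $\frac{dA}{d\tau}=\frac{\partial A}{\partial\tau}+\{H,A\}$ satisfies $\frac{dA}{d\tau}-\frac{\partial\Omega}{\partial\lambda}+[A,\Omega]=0$. **Theorem.** For every $i$, with $r=r_i$, the matrix $\mathcal M^{(r)}(t^{(i)})$ is invertible, and the functions $$H_{u_i}=\tfrac12\operatorname*{res}_{\lambda=u_i}\mathrm{Tr}\,A(\lambda)^2,\qquad (H^{(i)}_1,\dots,H^{(i)}_{r})^T=\bigl(\mathcal M^{(r)}\bigr)^{-1}(S^{(i)}_1,\dots,S^{(i)}_{r})^T$$ (for all $i$) form a family of confluent Hamiltonians, and every family of confluent Hamiltonians differs from it by Casimirs. Moreover $H_{u_i}$ and $H^{(i)}_k$ are isomonodromic Hamiltonians for the times $u_i$ and $t^{(i)}_k$, and every isomonodromic Hamiltonian for one of these times differs from the given one by a Casimir. -/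

import Mathlib

open Filter Topology Asymptotics

/-- `𝓜^{(r)}_{k,j}(t) = ∑_{|α| = k, w(α) = j} k!/(α₁!⋯α_r!) ∏ t_l^{α_l}`, where `|α| = ∑ α_l` and
`w(α) = ∑ l α_l`.  A sequence of times is indexed by `ℕ`; only `t 1, …, t r` are used, and the
index `l : Fin r` stands for the number `l + 1`. -/
def monom (r : ℕ) (t : ℕ → ℂ) (k j : ℕ) : ℂ :=
  ∑ α ∈ (Finset.piAntidiag (Finset.univ : Finset (Fin r)) k).filter
      (fun α => ∑ l : Fin r, ((l : ℕ) + 1) * α l = j),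
    (Nat.multinomial Finset.univ α : ℂ) * ∏ l : Fin r, t ((l : ℕ) + 1) ^ α l

/-- The `r × r` matrix `𝓜^{(r)} = (𝓜^{(r)}_{k,j})`, `1 ≤ k, j ≤ r`. -/
def monomMatrix (r : ℕ) (t : ℕ → ℂ) : Matrix (Fin r) (Fin r) ℂ :=
  Matrix.of fun k j => monom r t ((k : ℕ) + 1) ((j : ℕ) + 1)

/-- `P_r(t, ε) = ∑_{l=1}^r t_l ε^l`. -/
def confPoly (r : ℕ) (t : ℕ → ℂ) (ε : ℂ) : ℂ := ∑ l ∈ Finset.Icc 1 r, t l * ε ^ l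

/-- Index set of the coordinates: an entry `(a, b)` of one of the matrices `A^{(i)}_k`,
`0 ≤ k ≤ ρ i`, attached to the finite poles, or of one of the matrices `A^{(∞)}_{k+1}`, `k < s`. -/
abbrev CoordIdx (m : ℕ) {n : ℕ} (ρ : Fin n → ℕ) (s : ℕ) : Type :=
  (((i : Fin n) × Fin (ρ i + 1)) ⊕ Fin s) × Fin m × Fin m

/-- The phase space: the product over the poles of the duals of the Takiff algebras of `𝔤𝔩_m`, of
degree `ρ i` at the `i`-th finite pole and of degree `s` at infinity (where the coefficient of index
`0`, which does not enter the connection, is omitted). -/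
abbrev PhaseSpace (m : ℕ) {n : ℕ} (ρ : Fin n → ℕ) (s : ℕ) : Type := CoordIdx m ρ s → ℂ

section PhaseSpace

variable {m n s : ℕ} {ρ : Fin n → ℕ}

/-- The matrix `A^{(i)}_k`, with `A^{(i)}_k = 0` for `k > ρ i`. -/
def coeffA (X : PhaseSpace m ρ s) (i : Fin n) (k : ℕ) : Matrix (Fin m) (Fin m) ℂ :=
  if h : k < ρ i + 1 then Matrix.of fun a b => X (Sum.inl ⟨i, ⟨k, h⟩⟩, a, b) else 0

/-- The matrix `A^{(∞)}_{k+1}`, with `A^{(∞)}_{k+1} = 0` for `k ≥ s`. -/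
def coeffInf (X : PhaseSpace m ρ s) (k : ℕ) : Matrix (Fin m) (Fin m) ℂ :=
  if h : k < s then Matrix.of fun a b => X (Sum.inr ⟨k, h⟩, a, b) else 0

/-- The brackets of the coordinate functions (Kirillov–Kostant–Souriau bracket):
`{(A_k)_{ab}, (A_l)_{cd}} = δ_{bc} (A_{k+l})_{ad} - δ_{ad} (A_{k+l})_{cb}` at the same pole, and `0`
for coordinates at different poles. -/
def poissonTensor (X : PhaseSpace m ρ s) : CoordIdx m ρ s → CoordIdx m ρ s → ℂ
  | (Sum.inl ⟨i, k⟩, a, b), (Sum.inl ⟨j, l⟩, c, d) =>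
      if i = j then
        (if b = c then coeffA X i ((k : ℕ) + l) a d else 0)
          - (if a = d then coeffA X i ((k : ℕ) + l) c b else 0)
      else 0
  | (Sum.inr k, a, b), (Sum.inr l, c, d) =>
      (if b = c then coeffInf X ((k : ℕ) + l + 1) a d else 0)
        - (if a = d then coeffInf X ((k : ℕ) + l + 1) c b else 0)
  | (Sum.inl _, _, _), (Sum.inr _, _, _) => 0
  | (Sum.inr _, _, _), (Sum.inl _, _, _) => 0

/-- The Poisson bracket `{f, g}` on the phase space. -/
noncomputable def poisson (f g : PhaseSpace m ρ s → ℂ) (X : PhaseSpace m ρ s) : ℂ :=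
  ∑ x : CoordIdx m ρ s, ∑ y : CoordIdx m ρ s,
    poissonTensor X x y * fderiv ℂ f X (Pi.single x 1) * fderiv ℂ g X (Pi.single y 1)

/-- A holomorphic function that Poisson commutes with every holomorphic function. -/
def IsCasimir (f : PhaseSpace m ρ s → ℂ) : Prop :=
  Differentiable ℂ f ∧
    ∀ g : PhaseSpace m ρ s → ℂ, Differentiable ℂ g → ∀ X, poisson f g X = 0

end PhaseSpace

/-- The deformation parameters of a connection with `n` finite poles: the positions `u_i`, the
times `t^{(i)}_k` of the finite poles and the times `t^{(∞)}_k` (those with `k ≥ 1` and `k` at most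
the Poincaré rank are used). -/
structure Times (n : ℕ) where
  pos : Fin n → ℂ
  time : Fin n → ℕ → ℂ
  timeInf : ℕ → ℂ

/-- Admissible parameters: the finite poles are distinct, and `t_1 ≠ 0` at every pole of positive
Poincaré rank. -/
def Times.Admissible {n : ℕ} (p : Times n) (ρ : Fin n → ℕ) (s : ℕ) : Prop :=
  Function.Injective p.pos ∧ (∀ i, 1 ≤ ρ i → p.time i 1 ≠ 0) ∧ (1 ≤ s → p.timeInf 1 ≠ 0)

/-- Add `z` to one of the parameters of the `i`-th pole: to `u_i` if `k = 0`, to `t^{(i)}_k` if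
`k ≥ 1`. -/
def Times.shift {n : ℕ} (p : Times n) (i : Fin n) (k : ℕ) (z : ℂ) : Times n where
  pos := if k = 0 then Function.update p.pos i (p.pos i + z) else p.pos
  time := if k = 0 then p.time
    else Function.update p.time i (Function.update (p.time i) k (p.time i k + z))
  timeInf := p.timeInf

section Connection

variable {m n s : ℕ} {ρ : Fin n → ℕ}

/-- `B^{(i)}_k = ∑_{j=k}^{ρ i} 𝓜^{(ρ i)}_{k,j}(t^{(i)}) A^{(i)}_j`. -/
noncomputable def coeffB (p : Times n) (X : PhaseSpace m ρ s) (i : Fin n) (k : ℕ) :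
    Matrix (Fin m) (Fin m) ℂ :=
  ∑ j ∈ Finset.Icc k (ρ i), monom (ρ i) (p.time i) k j • coeffA X i j

/-- `B^{(∞)}_k = ∑_{j=k}^{s} 𝓜^{(s)}_{k,j}(t^{(∞)}) A^{(∞)}_j`, for `k ≥ 1`. -/
noncomputable def coeffBInf (p : Times n) (X : PhaseSpace m ρ s) (k : ℕ) :
    Matrix (Fin m) (Fin m) ℂ :=
  ∑ j ∈ Finset.Icc k s, monom s p.timeInf k j • coeffInf X (j - 1)

/-- The connection matrix
`A(z) = ∑_i ∑_{k=0}^{ρ i} B^{(i)}_k / (z - u_i)^{k+1} - ∑_{k=1}^s z^{k-1} B^{(∞)}_k`. -/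
noncomputable def connection (p : Times n) (X : PhaseSpace m ρ s) (z : ℂ) :
    Matrix (Fin m) (Fin m) ℂ :=
  (∑ i : Fin n, ∑ k ∈ Finset.range (ρ i + 1), ((z - p.pos i) ^ (k + 1))⁻¹ • coeffB p X i k)
    - ∑ k ∈ Finset.Icc 1 s, z ^ (k - 1) • coeffBInf p X k

/-- The residue of `f` at `u`: the value of `(2πi)⁻¹ ∮ f` over all sufficiently small circles
around `u`. -/
noncomputable def residueAt (f : ℂ → ℂ) (u : ℂ) : ℂ :=
  limUnder (𝓝[>] (0 : ℝ)) fun R => (2 * (Real.pi : ℂ) * Complex.I)⁻¹ * ∮ z in C(u, R), f z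

/-- The spectral invariant `S^{(u_i)}_k = ½ ∮ (z - u_i)^k Tr A(z)² dz`, the integral over a small
contour around `u_i` being normalised by `(2πi)⁻¹`. -/
noncomputable def spectralInvariant (p : Times n) (i : Fin n) (k : ℕ) (X : PhaseSpace m ρ s) : ℂ :=
  (1 / 2) * residueAt
    (fun z => (z - p.pos i) ^ k * Matrix.trace (connection p X z * connection p X z)) (p.pos i)

/-- The functions `H_{u_i} = ½ res Tr A²` (index `0`) and
`(H_1, …, H_r)ᵀ = (𝓜^{(r)})⁻¹ (S_1, …, S_r)ᵀ`, `r = ρ i` (indices `1, …, r`). -/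
noncomputable def spectralHamiltonian (p : Times n) (i : Fin n) :
    ℕ → PhaseSpace m ρ s → ℂ
  | 0 => fun X => spectralInvariant p i 0 X
  | k + 1 => fun X =>
      if h : k < ρ i then
        ((monomMatrix (ρ i) (p.time i))⁻¹).mulVec
          (fun l : Fin (ρ i) => spectralInvariant p i ((l : ℕ) + 1) X) ⟨k, h⟩
      else 0

/-- The entry `(a, b)` of the derivative of `A(z)` with respect to the parameter `(i, k)` on which it
depends explicitly, the phase space coordinates being fixed. -/
noncomputable def explicitDeriv (p : Times n) (i : Fin n) (k : ℕ) (X : PhaseSpace m ρ s) (z : ℂ)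
    (a b : Fin m) : ℂ :=
  deriv (fun w => connection (p.shift i k w) X z a b) 0

/-- `H` is an isomonodromic Hamiltonian for the time `u_i` (`k = 0`) or `t^{(i)}_k` (`k ≥ 1`), at
the parameters `p`: with `Ω = ∫ ∂A/∂t dz` (explicit derivative), normalised by `Ω → 0` as `z → ∞`,
the Hamiltonian evolution `dA/dt = ∂A/∂t + {H, A}` satisfies the zero curvature equation
`dA/dt - ∂Ω/∂z + [A, Ω] = 0`. -/
def IsIsomonodromicHamiltonian (p : Times n) (i : Fin n) (k : ℕ) (H : PhaseSpace m ρ s → ℂ) :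
    Prop :=
  Differentiable ℂ H ∧
  ∃ Ω : PhaseSpace m ρ s → ℂ → Matrix (Fin m) (Fin m) ℂ,
    (∀ X a b, Tendsto (fun z => Ω X z a b) (cocompact ℂ) (𝓝 0)) ∧
    ∀ X z, (∀ j, z ≠ p.pos j) → ∀ a b,
      HasDerivAt (fun w => Ω X w a b) (explicitDeriv p i k X z a b) z ∧
      (explicitDeriv p i k X z a b + poisson H (fun Y => connection p Y z a b) X)
          - deriv (fun w => Ω X w a b) z
          + (connection p X z * Ω X z - Ω X z * connection p X z) a b = 0

end Connection

/-- The asymptotic expansion `f(ε) ~ ∑_{j ≥ -d} c_j ε^j` as `ε → 0`. -/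
def HasAsympExpansion {m : ℕ} (f : ℂ → Matrix (Fin m) (Fin m) ℂ) (d : ℕ)
    (c : ℤ → Matrix (Fin m) (Fin m) ℂ) : Prop :=
  ∀ N : ℕ, ∀ a b : Fin m,
    (fun ε : ℂ => f ε a b - ∑ j ∈ Finset.Ico (-(d : ℤ)) (N : ℤ), ε ^ j * c j a b)
      =O[𝓝[≠] (0 : ℂ)] (fun ε : ℂ => ε ^ N)

/-- Poincaré ranks before a confluence that produces the ranks `ρ` by letting a simple pole (put at
index `0`) collide with the `i`-th pole, which then has rank `ρ i - 1`. -/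
def preRank {n : ℕ} (ρ : Fin n → ℕ) (i : Fin n) : Fin (n + 1) → ℕ :=
  Fin.cons 0 (Function.update ρ i (ρ i - 1))

/-- Parameters before the confluence: the simple pole is at `v = u_i + P_r(t^{(i)}, ε)`, `r = ρ i`,
and all other parameters are unchanged. -/
def Times.pre {n : ℕ} (p : Times n) (ρ : Fin n → ℕ) (i : Fin n) (ε : ℂ) : Times (n + 1) where
  pos := Fin.cons (p.pos i + confPoly (ρ i) (p.time i) ε) p.pos
  time := Fin.cons 0 p.time
  timeInf := p.timeInf

section Confluence

variable {m n s : ℕ} {ρ : Fin n → ℕ}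

/-- The confluence of a simple pole with the `i`-th pole: the points `γ ε` have the asymptotic
expansions, with `r = ρ i`,
`C ~ ∑_{j ≥ -r} W^{[j]} ε^j` and
`A_k ~ -∑_{l=1}^{r-k} W^{[-k-l]} ε^{-l} + A^{[k,0]} + ∑_{l ≥ 1} A^{[k,l]} ε^l` for `k < r`,
the coefficients at the other poles expand in nonnegative powers of `ε`, and the connection tends
to the connection with coordinates `X`. -/
def IsConfluence (p : Times n) (i : Fin n) (γ : ℂ → PhaseSpace m (preRank ρ i) s)
    (X : PhaseSpace m ρ s) : Prop :=
  (∃ W : ℤ → Matrix (Fin m) (Fin m) ℂ,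
    HasAsympExpansion (fun ε => coeffA (γ ε) 0 0) (ρ i) W ∧
    ∀ k < ρ i, ∃ c : ℤ → Matrix (Fin m) (Fin m) ℂ,
      (∀ l : ℕ, 1 ≤ l → l ≤ ρ i - k → c (-(l : ℤ)) = -W (-(k : ℤ) - l)) ∧
      HasAsympExpansion (fun ε => coeffA (γ ε) i.succ k) (ρ i - k) c) ∧
  (∀ j, j ≠ i → ∀ k ≤ ρ j, ∃ c, HasAsympExpansion (fun ε => coeffA (γ ε) j.succ k) 0 c) ∧
  (∀ k < s, ∃ c, HasAsympExpansion (fun ε => coeffInf (γ ε) k) 0 c) ∧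
  ∀ z, (∀ j, z ≠ p.pos j) → ∀ a b,
    Tendsto (fun ε => connection (p.pre ρ i ε) (γ ε) z a b) (𝓝[≠] 0) (𝓝 (connection p X z a b))

/-- The Hamiltonians before the confluence, rewritten for the times after the confluence.  As
`v = u_i + ∑_l t_l ε^l`, the form `∑ dt ∧ dH` turns into one in which `H_k + ε^k H_v` is conjugate to
`t_k` (and to `u_i` for `k = 0`), where `H_k` is absent for `k = ρ i`. -/
def mergedHamiltonian {i : Fin n}
    (H : Fin (n + 1) → ℕ → PhaseSpace m (preRank ρ i) s → ℂ) (ε : ℂ) (j : Fin n) (k : ℕ)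
    (Y : PhaseSpace m (preRank ρ i) s) : ℂ :=
  if j = i then (if k < ρ i then H i.succ k Y else 0) + ε ^ k * H 0 0 Y
  else H j.succ k Y

end Confluence

/-- `H` is a family of confluent Hamiltonians (`H i 0` for the time `u_i`, `H i k` for `t^{(i)}_k`,
`1 ≤ k ≤ ρ i`) at the parameters `p`: it is obtained by a confluence cascade from the Hamiltonians
`½ res Tr A²` of a system all of whose finite poles are simple.  In each step of the cascade a simple
pole collides with another pole; the new Hamiltonians are the limits, along all confluences, of the
Hamiltonians before the confluence, regularised by the addition of Casimirs (which may depend on `ε`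
but not on the curve). -/
inductive IsConfluentHamiltonian {m s : ℕ} :
    {n : ℕ} → (ρ : Fin n → ℕ) → Times n → (Fin n → ℕ → PhaseSpace m ρ s → ℂ) → Prop
  | schlesinger {n : ℕ} (ρ : Fin n → ℕ) (p : Times n) (H : Fin n → ℕ → PhaseSpace m ρ s → ℂ)
      (hρ : ∀ i, ρ i = 0) (hH : ∀ i X, H i 0 X = spectralInvariant p i 0 X) :
      IsConfluentHamiltonian ρ p H
  | confluence {n : ℕ} (ρ : Fin n → ℕ) (p : Times n) (H : Fin n → ℕ → PhaseSpace m ρ s → ℂ)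
      (i : Fin n) (hi : 1 ≤ ρ i)
      (H' : ℂ → Fin (n + 1) → ℕ → PhaseSpace m (preRank ρ i) s → ℂ)
      (U : Set ℂ) (hU : U ∈ 𝓝[≠] (0 : ℂ))
      (hH' : ∀ ε ∈ U, IsConfluentHamiltonian (preRank ρ i) (p.pre ρ i ε) (H' ε))
      (c : ℂ → Fin n → ℕ → PhaseSpace m (preRank ρ i) s → ℂ)
      (hc : ∀ ε ∈ U, ∀ j, ∀ k ≤ ρ j, IsCasimir (c ε j k))
      (hd : ∀ j, ∀ k ≤ ρ j, Differentiable ℂ (H j k))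
      (hlim : ∀ γ X, IsConfluence p i γ X → ∀ j, ∀ k ≤ ρ j,
        Tendsto (fun ε => mergedHamiltonian (H' ε) ε j k (γ ε) + c ε j k (γ ε)) (𝓝[≠] 0)
          (𝓝 (H j k X))) :
      IsConfluentHamiltonian ρ p H

/-! A pole of rank `r` is a simple pole at `u + P_r(t, x)` with coefficients in `ℂ[x]/(x^(r+1))`.
Indeed `𝓜_{k,j}` is the coefficient of `x^j` in `P^k`, so summing a geometric series shows that
`A_j` enters the connection with the factor `[x^j] (z - u - P)⁻¹`, and at infinity with the factor
`[x^j] (-P / (1 - z P))` (`connection_eq`). Both series satisfy a resolvent identity, and the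
Poisson bracket adds indices as multiplication in the truncated ring does. Together this is the
linear r-matrix bracket (`sum_slotFun_mul_slotFun_smul`).

Pairing it with `(w - u)^k A(w)` over a small circle gives `{S_k, A(z)} = [A(z), ∑_j [x^j] (P^k / (z
- u - P)) A_j]` (`sum_slotFun_smul_hamField_spectralInvariant`). For `k > r` the right side
vanishes, so `S_k` is a Casimir. For `1 ≤ k ≤ r`, `P^k = ∑_l 𝓜_{k,l} x^l` modulo `x^(r+1)`, hence
`𝓜⁻¹` turns `P^k` into `x^k`. Since `x^k / (z - u - P)` has `z`-derivative opposite to the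
`t_k`-derivative of `(z - u - P)⁻¹`, it is the generating series of `-Ω`, and the bracket relation
is the zero curvature equation. Conversely `Ω` is determined by its derivative and its decay, so two
isomonodromic Hamiltonians have the same bracket with `A(z)`. The factors of the `A_j` are linearly
independent (`eq_zero_of_sum_slotFun_eq_zero`), so the difference is a Casimir.

For a confluence, put `x = ε`: the simple pole `C / (z - u - P(ε))` is absorbed into `A_k + ε^k C`
up to an error `O(ε^(r+1)) C` (`connection_pre`), which tends to zero because `C = O(ε^(-r))`. The
prescribed singular parts cancel in `A_k + ε^k C`, so the connection converges uniformly on circles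
and the contour integral around both colliding poles tends to `S_q`. That integral is `S'_q + P(ε)^q
H'_v` plus Casimirs. Expanding `P(ε)^q` in `ε` and applying `𝓜⁻¹` yields the limits of `H'_k + ε^k
H'_v` (`hasRegularizedLimit_mergedHamiltonian`). Induction on the total rank gives existence.

Uniqueness requires that a limit of Casimirs is a Casimir (`isCasimir_of_tendsto`), although only
values along confluences converge and not derivatives. In the coordinates `A_k + ε^k C` the Poisson
structure before the confluence comes from `ℂ[x]/(x^r (x - ε))`, a deformation of `ℂ[x]/(x^(r+1))`.
Its Hamiltonian-type fields `[E, ·]` with `E² = 0` have polynomial flows, analytic in `ε`, that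
preserve the Casimirs. The limit function is therefore preserved by the limit flows, and square-zero
matrices suffice to detect a traceless matrix. -/

/-! ### The matrix `𝓜` and the powers of the polynomial of times -/

/-- The polynomial `∑_{l=1}^r t_l x^l`. -/
noncomputable def timePoly (r : ℕ) (t : ℕ → ℂ) : Polynomial ℂ :=
  ∑ l ∈ Finset.Icc 1 r, Polynomial.C (t l) * Polynomial.X ^ l

theorem timePoly_eq_sum_fin (r : ℕ) (t : ℕ → ℂ) :
    timePoly r t
      = ∑ l : Fin r, Polynomial.C (t ((l : ℕ) + 1)) * Polynomial.X ^ ((l : ℕ) + 1) := by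
  rw [timePoly, Fin.sum_univ_eq_sum_range
    (fun l => Polynomial.C (t (l + 1)) * Polynomial.X ^ (l + 1)) r, Finset.range_eq_Ico,
    Finset.sum_Ico_add' (fun l => Polynomial.C (t l) * (Polynomial.X : Polynomial ℂ) ^ l) 0 r 1]
  rfl

/-- This is the multinomial theorem, graded by the weight `∑ l α_l`. It reduces all statements about
`𝓜` to powers of one polynomial. -/
theorem monom_eq_coeff (r : ℕ) (t : ℕ → ℂ) (k j : ℕ) :
    monom r t k j = (timePoly r t ^ k).coeff j := by
  rw [timePoly_eq_sum_fin, Finset.sum_pow_eq_sum_piAntidiag, Polynomial.finsetSum_coeff, monom,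
    Finset.sum_filter]
  refine Finset.sum_congr rfl fun α _ => ?_
  have h : ∏ l : Fin r, (Polynomial.C (t ((l : ℕ) + 1)) * Polynomial.X ^ ((l : ℕ) + 1)) ^ α l
      = Polynomial.C (∏ l : Fin r, t ((l : ℕ) + 1) ^ α l)
        * Polynomial.X ^ (∑ l : Fin r, ((l : ℕ) + 1) * α l) := by
    simp only [mul_pow, Finset.prod_mul_distrib, ← pow_mul, Finset.prod_pow_eq_pow_sum, map_prod,
      map_pow]
  rw [h, ← Polynomial.C_eq_natCast, ← mul_assoc, ← Polynomial.C_mul, Polynomial.coeff_C_mul_X_pow]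
  simp only [eq_comm]

theorem eval_timePoly (r : ℕ) (t : ℕ → ℂ) (ε : ℂ) :
    (timePoly r t).eval ε = confPoly r t ε := by
  simp [timePoly, confPoly, Polynomial.eval_finsetSum]

theorem coeff_timePoly (r : ℕ) (t : ℕ → ℂ) (j : ℕ) :
    (timePoly r t).coeff j = if 1 ≤ j ∧ j ≤ r then t j else 0 := by
  simp [timePoly, Polynomial.finsetSum_coeff, Polynomial.coeff_C_mul, Polynomial.coeff_X_pow]

theorem X_dvd_timePoly (r : ℕ) (t : ℕ → ℂ) : Polynomial.X ∣ timePoly r t :=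
  Polynomial.X_dvd_iff.2 (by simp [coeff_timePoly])

theorem coeff_timePoly_pow_of_lt (r : ℕ) (t : ℕ → ℂ) {k j : ℕ} (h : j < k) :
    (timePoly r t ^ k).coeff j = 0 :=
  Polynomial.X_pow_dvd_iff.1 (pow_dvd_pow_of_dvd (X_dvd_timePoly r t) k) j h

theorem coeff_timePoly_pow_self {r : ℕ} (hr : 1 ≤ r) (t : ℕ → ℂ) (k : ℕ) :
    (timePoly r t ^ k).coeff k = t 1 ^ k := by
  obtain ⟨q, hq⟩ := X_dvd_timePoly r t
  have h1 : q.coeff 0 = t 1 := by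
    have := coeff_timePoly r t 1
    rw [hq, Polynomial.coeff_X_mul] at this
    simpa [hr] using this
  rw [hq, mul_pow, Polynomial.coeff_X_pow_mul', if_pos le_rfl, Nat.sub_self,
    Polynomial.coeff_zero_eq_eval_zero, Polynomial.eval_pow, ← Polynomial.coeff_zero_eq_eval_zero,
    h1]

/-- The two polynomials are congruent modulo `x^r`. This compares the rank `r - 1` pole before a
confluence with the rank `r` pole after it. -/
theorem coeff_timePoly_pow_pred {r : ℕ} (hr : 1 ≤ r) (t : ℕ → ℂ) (k : ℕ) {j : ℕ} (hj : j < r) :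
    (timePoly (r - 1) t ^ k).coeff j = (timePoly r t ^ k).coeff j := by
  have h : Polynomial.X ^ r ∣ timePoly r t - timePoly (r - 1) t := by
    refine Polynomial.X_pow_dvd_iff.2 fun d hd => ?_
    simp only [Polynomial.coeff_sub, coeff_timePoly]
    by_cases h1 : 1 ≤ d
    · rw [if_pos ⟨h1, hd.le⟩, if_pos ⟨h1, by omega⟩, sub_self]
    · simp [h1]
  have := Polynomial.X_pow_dvd_iff.1 (h.trans (sub_dvd_pow_sub_pow _ _ k)) j hj
  rw [Polynomial.coeff_sub, sub_eq_zero] at this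
  exact this.symm

/-- As `x^k` divides `P^k`, the matrix is upper triangular, with diagonal entries `t_1^k`. -/
theorem isUnit_det_monomMatrix {r : ℕ} {t : ℕ → ℂ} (h : 1 ≤ r → t 1 ≠ 0) :
    IsUnit (monomMatrix r t).det := by
  have hU : (monomMatrix r t).IsUpperTriangular := by
    intro k j hjk
    simp only [monomMatrix, Matrix.of_apply, monom_eq_coeff]
    exact coeff_timePoly_pow_of_lt r t (by simpa using hjk)
  rw [Matrix.det_of_isUpperTriangular hU, isUnit_iff_ne_zero, Finset.prod_ne_zero_iff]
  intro k _
  have hr : 1 ≤ r := by have := k.2; omega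
  simp only [monomMatrix, Matrix.of_apply, monom_eq_coeff, coeff_timePoly_pow_self hr]
  exact pow_ne_zero _ (h hr)

/-! ### Generating series of the coefficient functions -/

theorem PowerSeries.coeff_mul_of_X_pow_dvd {φ ψ : PowerSeries ℂ} {n j : ℕ}
    (h : PowerSeries.X ^ n ∣ ψ) (hj : j < n) : PowerSeries.coeff j (φ * ψ) = 0 :=
  PowerSeries.X_pow_dvd_iff.1 (h.mul_left φ) j hj

theorem X_pow_dvd_coe_timePoly_pow (r : ℕ) (t : ℕ → ℂ) (k : ℕ) :
    (PowerSeries.X : PowerSeries ℂ) ^ k ∣ (timePoly r t : PowerSeries ℂ) ^ k := by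
  refine PowerSeries.X_pow_dvd_iff.2 fun j hj => ?_
  rw [← Polynomial.coe_pow, Polynomial.coeff_coe, coeff_timePoly_pow_of_lt r t hj]

theorem constantCoeff_coe_timePoly (r : ℕ) (t : ℕ → ℂ) :
    PowerSeries.constantCoeff (timePoly r t : PowerSeries ℂ) = 0 := by
  rw [← PowerSeries.coeff_zero_eq_constantCoeff_apply, Polynomial.coeff_coe, coeff_timePoly]
  simp

/-- The power series `(ζ - P_r(t, x))⁻¹`. -/
noncomputable def poleSeries (r : ℕ) (t : ℕ → ℂ) (ζ : ℂ) : PowerSeries ℂ :=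
  (PowerSeries.C ζ - (timePoly r t : PowerSeries ℂ))⁻¹

/-- The power series `-P_r(t, x) (1 - z P_r(t, x))⁻¹`. -/
noncomputable def infSeries (r : ℕ) (t : ℕ → ℂ) (z : ℂ) : PowerSeries ℂ :=
  -((timePoly r t : PowerSeries ℂ) * (1 - PowerSeries.C z * (timePoly r t : PowerSeries ℂ))⁻¹)

theorem constantCoeff_C_sub_timePoly (r : ℕ) (t : ℕ → ℂ) (ζ : ℂ) :
    PowerSeries.constantCoeff (PowerSeries.C ζ - (timePoly r t : PowerSeries ℂ)) = ζ := by
  rw [map_sub, constantCoeff_coe_timePoly, PowerSeries.constantCoeff_C, sub_zero]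

theorem constantCoeff_one_sub_timePoly (r : ℕ) (t : ℕ → ℂ) (z : ℂ) :
    PowerSeries.constantCoeff (1 - PowerSeries.C z * (timePoly r t : PowerSeries ℂ)) = 1 := by
  simp [coeff_timePoly]

theorem mul_poleSeries (r : ℕ) (t : ℕ → ℂ) {ζ : ℂ} (hζ : ζ ≠ 0) :
    (PowerSeries.C ζ - (timePoly r t : PowerSeries ℂ)) * poleSeries r t ζ = 1 :=
  PowerSeries.mul_inv_cancel _ (by rwa [constantCoeff_C_sub_timePoly])

theorem mul_infSeries (r : ℕ) (t : ℕ → ℂ) (z : ℂ) :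
    (1 - PowerSeries.C z * (timePoly r t : PowerSeries ℂ)) * infSeries r t z
      = -(timePoly r t : PowerSeries ℂ) := by
  have := PowerSeries.mul_inv_cancel (1 - PowerSeries.C z * (timePoly r t : PowerSeries ℂ))
    (by rw [constantCoeff_one_sub_timePoly]; exact one_ne_zero)
  rw [infSeries]
  linear_combination (-(timePoly r t : PowerSeries ℂ)) * this

/-- The remainder of the geometric series is divisible by `x^N`, so it does not affect coefficients
below `N`. -/
theorem geom_sum_poleSeries (r : ℕ) (t : ℕ → ℂ) {ζ : ℂ} (hζ : ζ ≠ 0) (N : ℕ) :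
    ∑ a ∈ Finset.range N,
        PowerSeries.C ((ζ ^ (a + 1))⁻¹) * (timePoly r t : PowerSeries ℂ) ^ a
      = poleSeries r t ζ
        - PowerSeries.C ((ζ ^ N)⁻¹) * (poleSeries r t ζ * (timePoly r t : PowerSeries ℂ) ^ N) := by
  induction N with
  | zero => simp
  | succ N ih =>
    rw [Finset.sum_range_succ, ih]
    have h1 := mul_poleSeries r t hζ
    have h2 : PowerSeries.C ((ζ ^ N)⁻¹) = PowerSeries.C ((ζ ^ (N + 1))⁻¹) * PowerSeries.C ζ := by
      rw [← map_mul, pow_succ, mul_inv, mul_assoc, inv_mul_cancel₀ hζ, mul_one]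
    rw [h2, pow_succ (timePoly r t : PowerSeries ℂ) N]
    linear_combination (-(PowerSeries.C ((ζ ^ (N + 1))⁻¹))
      * (timePoly r t : PowerSeries ℂ) ^ N) * h1

theorem coeff_poleSeries (r : ℕ) (t : ℕ → ℂ) (ζ : ℂ) {N j : ℕ} (hj : j < N) :
    PowerSeries.coeff j (poleSeries r t ζ)
      = ∑ a ∈ Finset.range N, (ζ ^ (a + 1))⁻¹ * (timePoly r t ^ a).coeff j := by
  rcases eq_or_ne ζ 0 with rfl | hζ
  -- At `ζ = 0` both sides are zero by the conventions for inverses.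
  · have : poleSeries r t 0 = 0 := PowerSeries.inv_eq_zero.2 (constantCoeff_C_sub_timePoly r t 0)
    simp [this]
  · have h := congrArg (PowerSeries.coeff j) (geom_sum_poleSeries r t hζ N)
    rw [map_sum, map_sub, PowerSeries.coeff_C_mul,
      PowerSeries.coeff_mul_of_X_pow_dvd (X_pow_dvd_coe_timePoly_pow r t N) hj, mul_zero,
      sub_zero] at h
    rw [← h]
    refine Finset.sum_congr rfl fun a _ => ?_
    rw [PowerSeries.coeff_C_mul, ← Polynomial.coe_pow, Polynomial.coeff_coe]

/-- The terms with `a ≥ k` are those of `ζ^k / (ζ - P)` with negative powers of `ζ`: multiplying by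
`P^k` is multiplying by `ζ^k` and then taking the polar part. -/
theorem coeff_pow_mul_poleSeries (r : ℕ) (t : ℕ → ℂ) {ζ : ℂ} (hζ : ζ ≠ 0) (k : ℕ) {N j : ℕ}
    (hj : j < N) :
    PowerSeries.coeff j ((timePoly r t : PowerSeries ℂ) ^ k * poleSeries r t ζ)
      = ∑ a ∈ Finset.range N,
        if k ≤ a then (ζ ^ (a - k + 1))⁻¹ * (timePoly r t ^ a).coeff j else 0 := by
  have h := congrArg (fun φ => PowerSeries.coeff j ((timePoly r t : PowerSeries ℂ) ^ k * φ))
    (geom_sum_poleSeries r t hζ (N - k))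
  have hdvd : (PowerSeries.X : PowerSeries ℂ) ^ N ∣
      (timePoly r t : PowerSeries ℂ) ^ (k + (N - k)) :=
    (pow_dvd_pow _ (by omega)).trans (X_pow_dvd_coe_timePoly_pow r t (k + (N - k)))
  have h0 : PowerSeries.coeff j ((timePoly r t : PowerSeries ℂ) ^ k *
      (PowerSeries.C ((ζ ^ (N - k))⁻¹)
        * (poleSeries r t ζ * (timePoly r t : PowerSeries ℂ) ^ (N - k)))) = 0 := by
    rw [show (timePoly r t : PowerSeries ℂ) ^ k * (PowerSeries.C ((ζ ^ (N - k))⁻¹)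
        * (poleSeries r t ζ * (timePoly r t : PowerSeries ℂ) ^ (N - k)))
        = (PowerSeries.C ((ζ ^ (N - k))⁻¹) * poleSeries r t ζ)
          * (timePoly r t : PowerSeries ℂ) ^ (k + (N - k)) by ring]
    exact PowerSeries.coeff_mul_of_X_pow_dvd hdvd hj
  simp only [mul_sub, map_sub, h0, sub_zero] at h
  rw [← h, Finset.mul_sum, map_sum]
  rcases le_total k N with hk | hk
  · conv_rhs => rw [← Nat.add_sub_cancel' hk, Finset.sum_range_add]
    rw [Finset.sum_eq_zero (s := Finset.range k), zero_add]
    · refine Finset.sum_congr rfl fun a _ => ?_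
      rw [if_pos (by omega), show k + a - k = a by omega, mul_left_comm, PowerSeries.coeff_C_mul,
        ← pow_add, ← Polynomial.coe_pow, Polynomial.coeff_coe]
    · intro a ha
      rw [if_neg (by simpa using ha)]
  · rw [show N - k = 0 by omega, Finset.range_zero, Finset.sum_empty]
    refine (Finset.sum_eq_zero fun a ha => ?_).symm
    split_ifs with h'
    · exfalso
      have := Finset.mem_range.1 ha
      omega
    · rfl

/-- The extra factor `P` in the numerator makes the remainder divisible by `x^(N+1)`, which allows
`j = N`. -/
theorem coeff_infSeries (r : ℕ) (t : ℕ → ℂ) (z : ℂ) {N j : ℕ} (hj : j ≤ N) :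
    PowerSeries.coeff j (infSeries r t z)
      = -∑ a ∈ Finset.Icc 1 N, z ^ (a - 1) * (timePoly r t ^ a).coeff j := by
  have key : ∀ N : ℕ, ∑ a ∈ Finset.range N,
      PowerSeries.C (z ^ a) * (timePoly r t : PowerSeries ℂ) ^ (a + 1)
      = -infSeries r t z
        + PowerSeries.C (z ^ N) * (infSeries r t z * (timePoly r t : PowerSeries ℂ) ^ N) := by
    intro N
    induction N with
    | zero => simp
    | succ N ih =>
      rw [Finset.sum_range_succ, ih]
      have h1 := mul_infSeries r t z
      rw [pow_succ z N, map_mul, pow_succ]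
      linear_combination ((PowerSeries.C (z ^ N))
        * (timePoly r t : PowerSeries ℂ) ^ N) * h1
  have h0 : PowerSeries.coeff j (infSeries r t z * (timePoly r t : PowerSeries ℂ) ^ N) = 0 := by
    rw [infSeries, neg_mul, map_neg, neg_eq_zero, mul_comm (timePoly r t : PowerSeries ℂ),
      mul_assoc, ← pow_succ']
    exact PowerSeries.coeff_mul_of_X_pow_dvd (X_pow_dvd_coe_timePoly_pow r t (N + 1)) (by omega)
  have h := congrArg (PowerSeries.coeff j) (key N)
  rw [map_sum, map_add, PowerSeries.coeff_C_mul, h0, mul_zero, add_zero, map_neg] at h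
  rw [eq_neg_iff_add_eq_zero, add_comm, ← eq_neg_iff_add_eq_zero, ← h, ← Finset.Ico_add_one_right_eq_Icc,
    ← Finset.sum_Ico_add' (fun a => z ^ (a - 1) * (timePoly r t ^ a).coeff j) 0 N 1,
    ← Finset.range_eq_Ico]
  refine Finset.sum_congr rfl fun a _ => ?_
  rw [PowerSeries.coeff_C_mul, ← Polynomial.coe_pow, Polynomial.coeff_coe, Nat.add_sub_cancel]

/-- Resolvent identity; it and its analogue at infinity are the source of the r-matrix bracket. -/
theorem poleSeries_mul (r : ℕ) (t : ℕ → ℂ) {ζ η : ℂ} (hζ : ζ ≠ 0) (hη : η ≠ 0) :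
    PowerSeries.C (η - ζ) * (poleSeries r t ζ * poleSeries r t η)
      = poleSeries r t ζ - poleSeries r t η := by
  have h1 := mul_poleSeries r t hζ
  have h2 := mul_poleSeries r t hη
  rw [map_sub]
  linear_combination poleSeries r t ζ * h2 - poleSeries r t η * h1

theorem infSeries_mul (r : ℕ) (t : ℕ → ℂ) (w z : ℂ) :
    PowerSeries.C (z - w) * (infSeries r t w * infSeries r t z)
      = infSeries r t w - infSeries r t z := by
  have h1 := PowerSeries.mul_inv_cancel (1 - PowerSeries.C w * (timePoly r t : PowerSeries ℂ))
    (by rw [constantCoeff_one_sub_timePoly]; exact one_ne_zero)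
  have h2 := PowerSeries.mul_inv_cancel (1 - PowerSeries.C z * (timePoly r t : PowerSeries ℂ))
    (by rw [constantCoeff_one_sub_timePoly]; exact one_ne_zero)
  rw [infSeries, infSeries, map_sub]
  linear_combination
    (timePoly r t : PowerSeries ℂ) *
      ((1 - PowerSeries.C z * (timePoly r t : PowerSeries ℂ))⁻¹ * h1
      - (1 - PowerSeries.C w * (timePoly r t : PowerSeries ℂ))⁻¹ * h2)

theorem constantCoeff_infSeries (r : ℕ) (t : ℕ → ℂ) (z : ℂ) :
    PowerSeries.coeff 0 (infSeries r t z) = 0 := by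
  simp [infSeries, coeff_timePoly]

/-! ### Coefficientwise differentiation of power series -/

/-- The coefficients of an inverse are given recursively by those of lower index. -/
theorem differentiableAt_coeff_inv {φ : ℂ → PowerSeries ℂ} {w : ℂ}
    (h : ∀ n, DifferentiableAt ℂ (fun x => PowerSeries.coeff n (φ x)) w)
    (h0 : PowerSeries.constantCoeff (φ w) ≠ 0) (n : ℕ) :
    DifferentiableAt ℂ (fun x => PowerSeries.coeff n (φ x)⁻¹) w := by
  have hc : DifferentiableAt ℂ (fun x => (PowerSeries.constantCoeff (φ x))⁻¹) w := by
    have := h 0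
    simp only [PowerSeries.coeff_zero_eq_constantCoeff_apply] at this
    exact this.inv h0
  induction n using Nat.strong_induction_on with
  | _ n ih =>
    by_cases hn : n = 0
    · subst hn
      simpa only [PowerSeries.coeff_zero_eq_constantCoeff_apply, PowerSeries.constantCoeff_inv]
        using hc
    · have hrec : (fun x => PowerSeries.coeff n (φ x)⁻¹) = fun x =>
          -(PowerSeries.constantCoeff (φ x))⁻¹ * ∑ y ∈ Finset.HasAntidiagonal.antidiagonal n,
            if y.2 < n then PowerSeries.coeff y.1 (φ x) * PowerSeries.coeff y.2 (φ x)⁻¹ else 0 := by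
        funext x
        rw [PowerSeries.coeff_inv, if_neg hn]
      rw [hrec]
      refine hc.neg.mul (DifferentiableAt.fun_sum fun x _ => ?_)
      by_cases hx : x.2 < n
      · simp only [hx, if_true]
        exact (h x.1).mul (ih x.2 hx)
      · simp [hx]

theorem hasDerivAt_coeff_mul {φ ψ : ℂ → PowerSeries ℂ} {φ' ψ' : PowerSeries ℂ} {w : ℂ}
    (hφ : ∀ n, HasDerivAt (fun x => PowerSeries.coeff n (φ x)) (PowerSeries.coeff n φ') w)
    (hψ : ∀ n, HasDerivAt (fun x => PowerSeries.coeff n (ψ x)) (PowerSeries.coeff n ψ') w) (n : ℕ) :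
    HasDerivAt (fun x => PowerSeries.coeff n (φ x * ψ x))
      (PowerSeries.coeff n (φ' * ψ w + φ w * ψ')) w := by
  simp only [map_add, PowerSeries.coeff_mul, ← Finset.sum_add_distrib]
  exact HasDerivAt.fun_sum fun x _ => (hφ x.1).mul (hψ x.2)

/-- Each coefficient of the inverse is differentiable, so the derivatives form a power series; the
product rule applied to `φ φ⁻¹ = 1` determines it. -/
theorem hasDerivAt_coeff_inv {φ : ℂ → PowerSeries ℂ} {φ' : PowerSeries ℂ} {w : ℂ}
    (h : ∀ n, HasDerivAt (fun x => PowerSeries.coeff n (φ x)) (PowerSeries.coeff n φ') w)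
    (h0 : PowerSeries.constantCoeff (φ w) ≠ 0) (n : ℕ) :
    HasDerivAt (fun x => PowerSeries.coeff n (φ x)⁻¹)
      (PowerSeries.coeff n (-(φ' * ((φ w)⁻¹ * (φ w)⁻¹)))) w := by
  set ψ' : PowerSeries ℂ :=
    PowerSeries.mk fun n => deriv (fun x => PowerSeries.coeff n (φ x)⁻¹) w with hψ'
  have hψ : ∀ n, HasDerivAt (fun x => PowerSeries.coeff n (φ x)⁻¹) (PowerSeries.coeff n ψ') w := by
    intro n
    rw [hψ', PowerSeries.coeff_mk]
    exact (differentiableAt_coeff_inv (fun n => (h n).differentiableAt) h0 n).hasDerivAt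
  have hone : ∀ᶠ x in 𝓝 w, φ x * (φ x)⁻¹ = 1 := by
    have hc : ContinuousAt (fun x => PowerSeries.coeff 0 (φ x)) w := (h 0).continuousAt
    simp only [PowerSeries.coeff_zero_eq_constantCoeff_apply] at hc
    filter_upwards [hc.eventually_ne h0] with x hx using PowerSeries.mul_inv_cancel _ hx
  have hzero : φ' * (φ w)⁻¹ + φ w * ψ' = 0 := by
    ext n
    have h1 := hasDerivAt_coeff_mul h hψ n
    have h2 : HasDerivAt (fun x => PowerSeries.coeff n (φ x * (φ x)⁻¹)) 0 w :=
      (hasDerivAt_const w (PowerSeries.coeff n (1 : PowerSeries ℂ))).congr_of_eventuallyEq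
        (hone.mono fun x hx => by simp only [hx])
    rw [h1.unique h2, map_zero]
  have hinv := PowerSeries.mul_inv_cancel _ h0
  have : ψ' = -(φ' * ((φ w)⁻¹ * (φ w)⁻¹)) := by
    linear_combination (φ w)⁻¹ * hzero - ψ' * hinv
  rw [← this]
  exact hψ n

theorem hasDerivAt_coeff_poleSeries (r : ℕ) (t : ℕ → ℂ) {ζ : ℂ} (hζ : ζ ≠ 0) (n : ℕ) :
    HasDerivAt (fun x => PowerSeries.coeff n (poleSeries r t x))
      (-PowerSeries.coeff n (poleSeries r t ζ * poleSeries r t ζ)) ζ := by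
  have := hasDerivAt_coeff_inv (φ := fun x => PowerSeries.C x - (timePoly r t : PowerSeries ℂ))
    (φ' := 1) (w := ζ) (fun n => ?_) (by rwa [constantCoeff_C_sub_timePoly]) n
  · simpa only [one_mul, map_neg, poleSeries] using this
  · simp only [map_sub, PowerSeries.coeff_C, PowerSeries.coeff_one]
    refine HasDerivAt.sub_const _ ?_
    split_ifs
    · exact hasDerivAt_id' ζ
    · exact hasDerivAt_const ζ 0

theorem timePoly_update (r : ℕ) (t : ℕ → ℂ) {k : ℕ} (hk : 1 ≤ k) (hkr : k ≤ r) (w : ℂ) :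
    timePoly r (Function.update t k (t k + w))
      = timePoly r t + Polynomial.C w * Polynomial.X ^ k := by
  ext j
  simp only [Polynomial.coeff_add, coeff_timePoly, Polynomial.coeff_C_mul, Polynomial.coeff_X_pow]
  by_cases hj : j = k
  · subst hj; simp [hk, hkr]
  · simp [hj]

theorem hasDerivAt_coeff_poleSeries_time (r : ℕ) (t : ℕ → ℂ) {k : ℕ} (hk : 1 ≤ k) (hkr : k ≤ r)
    {ζ : ℂ} (hζ : ζ ≠ 0) (n : ℕ) :
    HasDerivAt (fun w => PowerSeries.coeff n (poleSeries r (Function.update t k (t k + w)) ζ))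
      (PowerSeries.coeff n (PowerSeries.X ^ k * (poleSeries r t ζ * poleSeries r t ζ))) 0 := by
  have := hasDerivAt_coeff_inv
    (φ := fun x => PowerSeries.C ζ - (timePoly r (Function.update t k (t k + x)) : PowerSeries ℂ))
    (φ' := -PowerSeries.X ^ k) (w := 0) (fun n => ?_) (by rwa [constantCoeff_C_sub_timePoly]) n
  · simpa only [neg_mul, neg_neg, add_zero, Function.update_eq_self, poleSeries] using this
  · simp only [timePoly_update r t hk hkr, map_sub, map_neg, Polynomial.coe_add, map_add,
      Polynomial.coe_mul, Polynomial.coe_C, Polynomial.coe_pow, Polynomial.coe_X,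
      PowerSeries.coeff_C_mul]
    have h1 := ((hasDerivAt_id' (0 : ℂ)).mul_const
      (PowerSeries.coeff n ((PowerSeries.X : PowerSeries ℂ) ^ k))).const_add
      (PowerSeries.coeff n (timePoly r t : PowerSeries ℂ)) |>.const_sub
      (PowerSeries.coeff n (PowerSeries.C ζ))
    simpa only [one_mul] using h1

theorem differentiable_coeff_infSeries (r : ℕ) (t : ℕ → ℂ) (n : ℕ) :
    Differentiable ℂ (fun z => PowerSeries.coeff n (infSeries r t z)) := by
  simp only [coeff_infSeries r t _ (le_refl n)]
  fun_prop

/-! ### The connection as a linear function on the phase space -/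

/-- The coordinate matrices of the phase space. -/
abbrev Slot {n : ℕ} (ρ : Fin n → ℕ) (s : ℕ) : Type := ((i : Fin n) × Fin (ρ i + 1)) ⊕ Fin s

section Slot

variable {m n s : ℕ} {ρ : Fin n → ℕ}

/-- The coefficient of a coordinate matrix in the connection, as a function of `z`. -/
noncomputable def slotFun (p : Times n) : Slot ρ s → ℂ → ℂ
  | Sum.inl ⟨i, k⟩, z => PowerSeries.coeff (k : ℕ) (poleSeries (ρ i) (p.time i) (z - p.pos i))
  | Sum.inr k, z => PowerSeries.coeff ((k : ℕ) + 1) (infSeries s p.timeInf z)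

/-- The coordinate matrix in a given slot. -/
def slotMat (X : PhaseSpace m ρ s) (κ : Slot ρ s) : Matrix (Fin m) (Fin m) ℂ :=
  Matrix.of fun a b => X (κ, a, b)

theorem coeffA_fin (X : PhaseSpace m ρ s) (i : Fin n) (k : Fin (ρ i + 1)) :
    coeffA X i k = slotMat X (Sum.inl ⟨i, k⟩) := by
  rw [coeffA, dif_pos k.2]; rfl

theorem coeffInf_fin (X : PhaseSpace m ρ s) (k : Fin s) :
    coeffInf X k = slotMat X (Sum.inr k) := by
  rw [coeffInf, dif_pos k.2]; rfl

theorem coeffA_of_lt (X : PhaseSpace m ρ s) {i : Fin n} {k : ℕ} (h : ρ i < k) :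
    coeffA X i k = 0 := by
  rw [coeffA, dif_neg (by omega)]

theorem coeffInf_of_le (X : PhaseSpace m ρ s) {k : ℕ} (h : s ≤ k) : coeffInf X k = 0 := by
  rw [coeffInf, dif_neg (by omega)]

theorem coeffB_eq (p : Times n) (X : PhaseSpace m ρ s) (i : Fin n) (k : ℕ) :
    coeffB p X i k
      = ∑ j ∈ Finset.range (ρ i + 1), (timePoly (ρ i) (p.time i) ^ k).coeff j • coeffA X i j := by
  simp only [coeffB, monom_eq_coeff]
  refine Finset.sum_subset (fun j hj => ?_) fun j hj hj' => ?_
  · rw [Finset.mem_Icc] at hj; rw [Finset.mem_range]; omega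
  · rw [Finset.mem_range] at hj
    rw [Finset.mem_Icc] at hj'
    rw [coeff_timePoly_pow_of_lt _ _ (by omega), zero_smul]

theorem coeffBInf_eq (p : Times n) (X : PhaseSpace m ρ s) {k : ℕ} (hk : 1 ≤ k) :
    coeffBInf p X k
      = ∑ j ∈ Finset.range s, (timePoly s p.timeInf ^ k).coeff (j + 1) • coeffInf X j := by
  simp only [coeffBInf, monom_eq_coeff]
  rw [Finset.range_eq_Ico]
  have := Finset.sum_Ico_add' (fun j => (timePoly s p.timeInf ^ k).coeff j • coeffInf X (j - 1)) 0 s 1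
  simp only [Nat.add_sub_cancel] at this
  rw [this]
  refine Finset.sum_subset (fun j hj => ?_) fun j hj hj' => ?_
  · rw [Finset.mem_Icc] at hj; rw [Finset.mem_Ico]; omega
  · rw [Finset.mem_Ico] at hj
    rw [Finset.mem_Icc] at hj'
    rw [coeff_timePoly_pow_of_lt _ _ (by omega), zero_smul]

/-- Exchanging the sums over the order of the pole and over `j` collects a truncated geometric
series in `P` in front of each `A_j`. -/
theorem connection_eq (p : Times n) (X : PhaseSpace m ρ s) (z : ℂ) :
    connection p X z = ∑ κ, slotFun p κ z • slotMat X κ := by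
  rw [connection, Fintype.sum_sum_type, Fintype.sum_sigma, sub_eq_add_neg]
  congr 1
  · refine Finset.sum_congr rfl fun i _ => ?_
    simp only [coeffB_eq, Finset.smul_sum, smul_smul]
    rw [Finset.sum_comm, Finset.sum_range]
    refine Finset.sum_congr rfl fun j _ => ?_
    rw [slotFun, coeff_poleSeries _ _ _ j.2, Finset.sum_smul]
    simp only [coeffA_fin]
  · rw [Finset.sum_congr rfl fun k hk => by rw [coeffBInf_eq p X (Finset.mem_Icc.1 hk).1]]
    simp only [Finset.smul_sum, smul_smul]
    rw [Finset.sum_comm, Finset.sum_range, ← Finset.sum_neg_distrib]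
    refine Finset.sum_congr rfl fun j _ => ?_
    rw [slotFun, coeff_infSeries s p.timeInf z (Nat.succ_le_of_lt j.2), neg_smul, Finset.sum_smul]
    simp only [coeffInf_fin]

theorem connection_apply (p : Times n) (X : PhaseSpace m ρ s) (z : ℂ) (a b : Fin m) :
    connection p X z a b = ∑ κ, slotFun p κ z * X (κ, a, b) := by
  simp [connection_eq, Matrix.sum_apply, slotMat]

theorem differentiableAt_slotFun (p : Times n) (κ : Slot ρ s) {z : ℂ}
    (hz : ∀ i k, κ = Sum.inl ⟨i, k⟩ → z ≠ p.pos i) :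
    DifferentiableAt ℂ (slotFun p κ) z := by
  rcases κ with ⟨i, k⟩ | k
  · exact (hasDerivAt_coeff_poleSeries (ρ i) (p.time i)
      (sub_ne_zero.2 (hz i k rfl)) k).differentiableAt.comp (f := fun z => z - p.pos i) z
      (by fun_prop)
  · exact differentiable_coeff_infSeries s p.timeInf (k + 1) z

/-- The coordinate matrix at the sum of two slots at the same pole, and `0` for slots at different
poles. -/
def slotAdd (X : PhaseSpace m ρ s) : Slot ρ s → Slot ρ s → Matrix (Fin m) (Fin m) ℂ
  | Sum.inl ⟨i, k⟩, Sum.inl ⟨j, l⟩ => if i = j then coeffA X i ((k : ℕ) + l) else 0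
  | Sum.inr k, Sum.inr l => coeffInf X ((k : ℕ) + l + 1)
  | Sum.inl _, Sum.inr _ => 0
  | Sum.inr _, Sum.inl _ => 0

theorem poissonTensor_eq (X : PhaseSpace m ρ s) (κ μ : Slot ρ s) (a b c d : Fin m) :
    poissonTensor X (κ, a, b) (μ, c, d)
      = (if b = c then slotAdd X κ μ a d else 0) - (if a = d then slotAdd X κ μ c b else 0) := by
  rcases κ with ⟨i, k⟩ | k <;> rcases μ with ⟨j, l⟩ | l <;> simp only [poissonTensor, slotAdd]
  · split_ifs <;> simp
  · simp
  · simp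

/-- Terms with `k + l ≥ N` drop out, so the double sum sees the product in `ℂ[x]/(x^N)`. -/
theorem sum_coeff_mul_coeff_smul (φ ψ : PowerSeries ℂ) (N : ℕ)
    (A : ℕ → Matrix (Fin m) (Fin m) ℂ) (hA : ∀ q, N ≤ q → A q = 0) :
    ∑ k ∈ Finset.range N, ∑ l ∈ Finset.range N,
        (PowerSeries.coeff k φ * PowerSeries.coeff l ψ) • A (k + l)
      = ∑ q ∈ Finset.range N, PowerSeries.coeff q (φ * ψ) • A q := by
  simp only [PowerSeries.coeff_mul, Finset.sum_smul]
  rw [← Finset.sum_product', Finset.sum_sigma', ← Finset.sum_filter_add_sum_filter_not _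
    (fun x : ℕ × ℕ => x.1 + x.2 < N)]
  rw [Finset.sum_eq_zero (s := Finset.filter (fun x : ℕ × ℕ => ¬ (x.1 + x.2 < N)) _), add_zero]
  · refine Finset.sum_bij' (fun x _ => ⟨x.1 + x.2, x⟩) (fun y _ => y.2) ?_ ?_ ?_ ?_ ?_
    · rintro ⟨k, l⟩ h
      simp only [Finset.mem_filter] at h
      simp [h.2]
    · rintro ⟨q, k, l⟩ h
      obtain ⟨h1, h2⟩ := Finset.mem_sigma.1 h
      have h1 := Finset.mem_range.1 h1
      have h2 := Finset.HasAntidiagonal.mem_antidiagonal.1 h2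
      simp only at h1 h2
      simp only [Finset.mem_filter, Finset.mem_product, Finset.mem_range]
      omega
    · rintro x _; rfl
    · rintro ⟨q, k, l⟩ h
      have h2 := Finset.HasAntidiagonal.mem_antidiagonal.1 (Finset.mem_sigma.1 h).2
      simp only at h2
      subst h2
      rfl
    · rintro ⟨k, l⟩ _; rfl
  · rintro ⟨k, l⟩ h
    simp only [Finset.mem_filter] at h
    rw [hA _ (by simpa using h.2), smul_zero]

/-- This is the r-matrix form of the bracket: the index addition turns the double sum into a product
of generating series, to which the resolvent identities apply. -/
theorem sum_slotFun_mul_slotFun_smul (p : Times n) (X : PhaseSpace m ρ s) {w z : ℂ}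
    (hw : ∀ i, w ≠ p.pos i) (hz : ∀ i, z ≠ p.pos i) :
    (z - w) • ∑ κ : Slot ρ s, ∑ μ : Slot ρ s, (slotFun p κ w * slotFun p μ z) • slotAdd X κ μ
      = ∑ κ : Slot ρ s, (slotFun p κ w - slotFun p κ z) • slotMat X κ := by
  simp only [Fintype.sum_sum_type, Fintype.sum_sigma, slotAdd, smul_zero, Finset.sum_const_zero,
    add_zero, zero_add, smul_add]
  congr 1
  · rw [Finset.smul_sum]
    refine Finset.sum_congr rfl fun i _ => ?_
    have h1 : ∀ k : Fin (ρ i + 1), ∑ j : Fin n, ∑ l : Fin (ρ j + 1),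
        (slotFun (s := s) p (Sum.inl ⟨i, k⟩) w * slotFun (s := s) p (Sum.inl ⟨j, l⟩) z)
          • (if i = j then coeffA X i (k + l) else 0)
        = ∑ l : Fin (ρ i + 1),
          (slotFun (s := s) p (Sum.inl ⟨i, k⟩) w * slotFun (s := s) p (Sum.inl ⟨i, l⟩) z)
            • coeffA X i (k + l) := by
      intro k
      rw [Finset.sum_eq_single i]
      · simp
      · intro j _ hj
        simp [Ne.symm hj]
      · simp
    simp only [h1]
    simp only [slotFun]
    have h2 := sum_coeff_mul_coeff_smul (poleSeries (ρ i) (p.time i) (w - p.pos i))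
      (poleSeries (ρ i) (p.time i) (z - p.pos i)) (ρ i + 1) (coeffA X i)
      (fun q hq => coeffA_of_lt X (by omega))
    have h3 := poleSeries_mul (ρ i) (p.time i) (sub_ne_zero.2 (hw i)) (sub_ne_zero.2 (hz i))
    rw [sub_sub_sub_cancel_right] at h3
    simp only [Finset.sum_range] at h2
    rw [h2, Finset.smul_sum]
    refine Finset.sum_congr rfl fun k _ => ?_
    rw [smul_smul, ← PowerSeries.coeff_C_mul, h3, map_sub, coeffA_fin]
  -- The matrices at infinity start at index `1`. They are padded with a zero matrix at index `0`,
  -- which is harmless because the series has no constant term.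
  · have h2 := sum_coeff_mul_coeff_smul (infSeries s p.timeInf w) (infSeries s p.timeInf z)
      (s + 1) (fun q => if q = 0 then 0 else coeffInf X (q - 1))
      (fun q hq => by simp only [if_neg (show q ≠ 0 by omega)]; exact coeffInf_of_le X (by omega))
    have h3 := infSeries_mul s p.timeInf w z
    simp only [Finset.sum_range_succ', constantCoeff_infSeries, zero_mul, mul_zero, zero_smul,
      Finset.sum_const_zero, add_zero, if_true, smul_zero, Nat.add_eq_zero_iff, one_ne_zero,
      and_false, if_false, Nat.add_sub_cancel] at h2
    simp only [Finset.sum_range] at h2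
    have h4 : ∀ k l : ℕ, k + 1 + (l + 1) - 1 = k + l + 1 := fun k l => by omega
    simp only [h4] at h2
    simp only [slotFun]
    rw [h2, Finset.smul_sum]
    refine Finset.sum_congr rfl fun k _ => ?_
    rw [smul_smul, ← PowerSeries.coeff_C_mul, h3, map_sub, coeffInf_fin]

end Slot

/-! ### Contour integrals -/

/-- The normalised contour integral `(2πi)⁻¹ ∮ f` over the circle of radius `R` around `u`. -/
noncomputable def contourMean (u : ℂ) (R : ℝ) (f : ℂ → ℂ) : ℂ :=
  (2 * (Real.pi : ℂ) * Complex.I)⁻¹ * ∮ z in C(u, R), f z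

theorem contourMean_congr {u : ℂ} {R : ℝ} (hR : 0 ≤ R) {f g : ℂ → ℂ}
    (h : ∀ z ∈ Metric.sphere u R, f z = g z) : contourMean u R f = contourMean u R g := by
  rw [contourMean, contourMean, circleIntegral.integral_congr hR h]

theorem contourMean_sum {ι : Type*} {u : ℂ} {R : ℝ} (hR : 0 ≤ R) (S : Finset ι) (c : ι → ℂ)
    {f : ι → ℂ → ℂ} (hf : ∀ i ∈ S, ContinuousOn (f i) (Metric.sphere u R)) :
    contourMean u R (fun z => ∑ i ∈ S, c i * f i z) = ∑ i ∈ S, c i * contourMean u R (f i) := by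
  rw [contourMean, circleIntegral.integral_fun_sum, Finset.mul_sum]
  · refine Finset.sum_congr rfl fun i _ => ?_
    rw [circleIntegral.integral_const_mul, contourMean]
    ring
  · intro i hi
    exact (continuousOn_const.mul (hf i hi)).circleIntegrable hR

theorem contourMean_add {u : ℂ} {R : ℝ} (hR : 0 ≤ R) {f g : ℂ → ℂ}
    (hf : ContinuousOn f (Metric.sphere u R)) (hg : ContinuousOn g (Metric.sphere u R)) :
    contourMean u R (fun z => f z + g z) = contourMean u R f + contourMean u R g := by
  rw [contourMean, circleIntegral.integral_add (hf.circleIntegrable hR) (hg.circleIntegrable hR),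
    mul_add, contourMean, contourMean]

theorem contourMean_const_mul (u : ℂ) (R : ℝ) (c : ℂ) (f : ℂ → ℂ) :
    contourMean u R (fun z => c * f z) = c * contourMean u R f := by
  rw [contourMean, circleIntegral.integral_const_mul, contourMean]
  ring

theorem contourMean_eq_zero {u : ℂ} {R : ℝ} (hR : 0 ≤ R) {f : ℂ → ℂ}
    (h : ∀ z ∈ Metric.closedBall u R, DifferentiableAt ℂ f z) : contourMean u R f = 0 := by
  rw [contourMean, Complex.circleIntegral_eq_zero_of_differentiable_on_off_countable hR
    Set.countable_empty (fun z hz => (h z hz).continuousAt.continuousWithinAt)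
    (fun z hz => h z (Metric.ball_subset_closedBall hz.1)), mul_zero]

theorem contourMean_eq_of_le {u : ℂ} {r R : ℝ} (hr : 0 < r) (hrR : r ≤ R) {f : ℂ → ℂ}
    (h : ∀ z ∈ Metric.closedBall u R, z ≠ u → DifferentiableAt ℂ f z) :
    contourMean u R f = contourMean u r f := by
  rw [contourMean, Complex.circleIntegral_eq_of_differentiable_on_annulus_off_countable hr hrR
    Set.countable_empty, contourMean]
  · rintro z ⟨hz, hz'⟩
    refine (h z hz ?_).continuousAt.continuousWithinAt
    rintro rfl
    exact hz' (Metric.mem_ball_self hr)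
  · rintro z ⟨⟨hz, hz'⟩, -⟩
    refine h z (Metric.ball_subset_closedBall hz) ?_
    rintro rfl
    exact hz' (Metric.mem_closedBall_self hr.le)

/-- By Cauchy's theorem on annuli the integrals are constant for small radii, so the limit is
attained. -/
theorem residueAt_eq_contourMean {u : ℂ} {R : ℝ} (hR : 0 < R) {f : ℂ → ℂ}
    (h : ∀ z ∈ Metric.closedBall u R, z ≠ u → DifferentiableAt ℂ f z) :
    residueAt f u = contourMean u R f := by
  refine Tendsto.limUnder_eq ?_
  refine tendsto_const_nhds.congr' ?_
  filter_upwards [Ioc_mem_nhdsGT hR] with r hr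
  exact contourMean_eq_of_le hr.1 hr.2 h

theorem contourMean_sub_zpow (u : ℂ) {R : ℝ} (hR : 0 < R) (n : ℤ) :
    contourMean u R (fun z => (z - u) ^ n) = if n = -1 then 1 else 0 := by
  split_ifs with h
  · subst h
    simp only [zpow_neg_one]
    rw [contourMean, circleIntegral.integral_sub_center_inv u hR.ne']
    exact inv_mul_cancel₀ Complex.two_pi_I_ne_zero
  · rw [contourMean, circleIntegral.integral_sub_zpow_of_ne h, mul_zero]

theorem ne_center_of_mem_sphere {u z : ℂ} {R : ℝ} (hR : 0 < R) (hz : z ∈ Metric.sphere u R) :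
    z ≠ u := by
  rintro rfl
  simp at hz
  exact hR.ne hz

/-- Integration against `(z - w)⁻¹` with `z` outside the disc projects onto the polar part at `u`.
-/
theorem contourMean_inv_pow_mul_kernel {u z : ℂ} {R : ℝ} (hR : 0 < R)
    (hz : z ∉ Metric.closedBall u R) (n : ℕ) :
    contourMean u R (fun w => ((w - u) ^ n)⁻¹ * (z - w)⁻¹)
      = if n = 0 then 0 else ((z - u) ^ n)⁻¹ := by
  have hzu : z - u ≠ 0 := by
    rw [sub_ne_zero]; rintro rfl; exact hz (Metric.mem_closedBall_self hR.le)
  have hd : ∀ w ∈ Metric.closedBall u R, z - w ≠ 0 := by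
    intro w hw; rw [sub_ne_zero]; rintro rfl; exact hz hw
  have hS : ∀ w ∈ Metric.sphere u R, w - u ≠ 0 := fun w hw =>
    sub_ne_zero.2 (ne_center_of_mem_sphere hR hw)
  induction n with
  | zero =>
    rw [if_pos rfl]
    refine contourMean_eq_zero hR.le fun w hw => ?_
    have := hd w hw
    fun_prop (disch := first | assumption | simp)
  | succ n ih =>
    -- Partial fractions: `1 / ((w - u) (z - w)) = (z - u)⁻¹ (1 / (w - u) + 1 / (z - w))`.
    have hsplit : ∀ w ∈ Metric.sphere u R, ((w - u) ^ (n + 1))⁻¹ * (z - w)⁻¹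
        = (z - u)⁻¹ * ((w - u) ^ (-((n : ℤ) + 1))) + (z - u)⁻¹ * (((w - u) ^ n)⁻¹ * (z - w)⁻¹) := by
      intro w hw
      have h1 := hS w hw
      have h2 := hd w (Metric.sphere_subset_closedBall hw)
      rw [zpow_neg, show ((n : ℤ) + 1) = ((n + 1 : ℕ) : ℤ) by push_cast; rfl, zpow_natCast]
      field_simp
      ring
    have hc1 : ContinuousOn (fun w => (z - u)⁻¹ * ((w - u) ^ (-((n : ℤ) + 1))))
        (Metric.sphere u R) := by
      refine continuousOn_const.mul (ContinuousOn.zpow₀ (by fun_prop) _ fun w hw => Or.inl (hS w hw))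
    have hc2 : ContinuousOn (fun w => (z - u)⁻¹ * (((w - u) ^ n)⁻¹ * (z - w)⁻¹))
        (Metric.sphere u R) := by
      refine continuousOn_const.mul (ContinuousOn.mul (ContinuousOn.inv₀ (by fun_prop) fun w hw =>
        pow_ne_zero _ (hS w hw)) (ContinuousOn.inv₀ (by fun_prop) fun w hw =>
        hd w (Metric.sphere_subset_closedBall hw)))
    rw [contourMean_congr hR.le hsplit, contourMean_add hR.le hc1 hc2, contourMean_const_mul,
      contourMean_const_mul, ih, contourMean_sub_zpow u hR]
    rcases Nat.eq_zero_or_pos n with rfl | hn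
    · simp
    · rw [if_neg (by omega), if_neg (by omega), if_neg (by omega), mul_zero, zero_add, ← mul_inv,
        pow_succ']

theorem Complex.differentiableAt_dslope {G : ℂ → ℂ} {v z : ℂ}
    (hv : ∀ᶠ x in 𝓝 v, DifferentiableAt ℂ G x) (hz : DifferentiableAt ℂ G z) :
    DifferentiableAt ℂ (dslope G v) z := by
  rcases eq_or_ne z v with rfl | h
  · obtain ⟨s, hs, hs', hzs⟩ := eventually_nhds_iff.1 hv
    have h1 : DifferentiableOn ℂ G s := fun x hx => (hs x hx).differentiableWithinAt
    exact ((Complex.differentiableOn_dslope (hs'.mem_nhds hzs)).2 h1).differentiableAt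
      (hs'.mem_nhds hzs)
  · exact (differentiableAt_dslope_of_ne h).2 hz

/-- Residue theorem with one pole `v` of order at most two: after its principal part is split off,
the rest is singular only at `u`, and circles around `u` may be shrunk. -/
theorem contourMean_eq_residueAt_add_residueAt {F G : ℂ → ℂ} {u v : ℂ} {R : ℝ}
    (hv : v ∈ Metric.ball u R) (hvu : v ≠ u)
    (hG : ∀ z ∈ Metric.closedBall u R, z ≠ u → DifferentiableAt ℂ G z)
    (hF : ∀ z, z ≠ u → z ≠ v → F z = G z / (z - v) ^ 2) :
    contourMean u R F = residueAt F u + residueAt F v := by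
  have hd : 0 < dist v u := dist_pos.2 hvu
  have hdR : dist v u < R := hv
  have hR : 0 < R := hd.trans hdR
  -- `g` is the second Taylor remainder: `G z = G v + G'(v) (z - v) + g z (z - v)^2`.
  set g : ℂ → ℂ := dslope (dslope G v) v with hg
  have hopen : ∀ᶠ x in 𝓝 v, DifferentiableAt ℂ G x := by
    filter_upwards [Metric.isOpen_ball.mem_nhds hv, isOpen_ne.mem_nhds hvu] with x hx hx'
    exact hG x (Metric.ball_subset_closedBall hx) hx'
  have hg1 : ∀ z ∈ Metric.closedBall u R, z ≠ u → DifferentiableAt ℂ g z := fun z hz hz' =>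
    Complex.differentiableAt_dslope
      (hopen.mono fun x hx => Complex.differentiableAt_dslope hopen hx)
      (Complex.differentiableAt_dslope hopen (hG z hz hz'))
  have hdec : ∀ z, z ≠ u → z ≠ v →
      F z = (G v * (z - v) ^ (-2 : ℤ) + deriv G v * (z - v) ^ (-1 : ℤ)) + g z := by
    intro z hz hz'
    have h1 : z - v ≠ 0 := sub_ne_zero.2 hz'
    rw [hF z hz hz', hg, dslope_of_ne _ hz', slope_def_field, dslope_of_ne _ hz', dslope_same,
      slope_def_field]
    rw [zpow_neg, zpow_neg]
    norm_cast
    field_simp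
    ring
  -- The double pole term integrates to zero over every circle that avoids `v`, so only the simple
  -- pole term and `g` remain.
  have hint : ∀ (c : ℂ) (r : ℝ), 0 < r → v ∉ Metric.sphere c r →
      u ∉ Metric.sphere c r → (∀ z ∈ Metric.sphere c r, z ∈ Metric.closedBall u R) →
      contourMean c r F = deriv G v * contourMean c r (fun z => (z - v) ^ (-1 : ℤ))
        + contourMean c r g := by
    intro c r hr hvc huc hsub
    have hne : ∀ z ∈ Metric.sphere c r, z ≠ u ∧ z ≠ v := fun z hz =>
      ⟨fun h => huc (h ▸ hz), fun h => hvc (h ▸ hz)⟩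
    have hcz : ∀ (n : ℤ), ContinuousOn (fun z => (z - v) ^ n) (Metric.sphere c r) := fun n =>
      ContinuousOn.zpow₀ (by fun_prop) _ fun z hz => Or.inl (sub_ne_zero.2 (hne z hz).2)
    rw [contourMean_congr hr.le fun z hz => hdec z (hne z hz).1 (hne z hz).2,
      contourMean_add hr.le, contourMean_add hr.le, contourMean_const_mul, contourMean_const_mul]
    · congr 1
      rw [contourMean, circleIntegral.integral_sub_zpow_of_ne (by norm_num), mul_zero, mul_zero,
        zero_add]
    · exact continuousOn_const.mul (hcz _)
    · exact continuousOn_const.mul (hcz _)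
    · exact (continuousOn_const.mul (hcz _)).add (continuousOn_const.mul (hcz _))
    · exact fun z hz => (hg1 z (hsub z hz) (hne z hz).1).continuousAt.continuousWithinAt
  have hFd : ∀ z ∈ Metric.closedBall u R, z ≠ u → z ≠ v → DifferentiableAt ℂ F z := by
    intro z hz hz' hz''
    have hev : F =ᶠ[𝓝 z] fun z => G z / (z - v) ^ 2 := by
      filter_upwards [isOpen_ne.mem_nhds hz', isOpen_ne.mem_nhds hz''] with x hx hx'
      exact hF x hx hx'
    refine DifferentiableAt.congr_of_eventuallyEq ?_ hev
    exact (hG z hz hz').div (by fun_prop) (pow_ne_zero _ (sub_ne_zero.2 hz''))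
  -- The radii ensure that each small disc misses the other pole and lies in the disc of radius `R`.
  set r₁ := dist v u / 2 with hr₁
  have hr₁0 : 0 < r₁ := by positivity
  set r₂ := min r₁ ((R - dist v u) / 2) with hr₂
  have hr₂0 : 0 < r₂ := lt_min hr₁0 (by linarith)
  have hr₂1 : r₂ ≤ r₁ := min_le_left _ _
  have hr₂2 : r₂ ≤ (R - dist v u) / 2 := min_le_right _ _
  have hb1 : v ∉ Metric.closedBall u r₁ := by
    rw [Metric.mem_closedBall]; linarith
  have hb2 : u ∉ Metric.closedBall v r₂ := by
    rw [Metric.mem_closedBall, dist_comm]; linarith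
  have hb3 : ∀ z ∈ Metric.closedBall v r₂, z ∈ Metric.closedBall u R := by
    intro z hz
    rw [Metric.mem_closedBall] at hz ⊢
    linarith [dist_triangle z v u]
  have hb4 : ∀ z ∈ Metric.closedBall u r₁, z ∈ Metric.closedBall u R :=
    fun z hz => Metric.closedBall_subset_closedBall (by linarith) hz
  rw [residueAt_eq_contourMean hr₁0 fun z hz hz' => hFd z (hb4 z hz) hz' fun h => hb1 (h ▸ hz),
    residueAt_eq_contourMean hr₂0 fun z hz hz' => hFd z (hb3 z hz) (fun h => hb2 (h ▸ hz)) hz',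
    hint u R hR (fun h => hdR.ne h) (fun h => hR.ne (by simpa using h))
      (fun z hz => Metric.sphere_subset_closedBall hz),
    hint u r₁ hr₁0 (fun h => hb1 (Metric.sphere_subset_closedBall h))
      (fun h => hr₁0.ne (by simpa using h))
      (fun z hz => hb4 z (Metric.sphere_subset_closedBall hz)),
    hint v r₂ hr₂0 (fun h => hr₂0.ne (by simpa using h))
      (fun h => hb2 (Metric.sphere_subset_closedBall h))
      (fun z hz => hb3 z (Metric.sphere_subset_closedBall hz)),
    contourMean_eq_of_le hr₁0 (by linarith) hg1, contourMean_sub_zpow v hr₂0 (-1), if_pos rfl,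
    contourMean_eq_zero (f := g) hr₂0.le
      (fun z hz => hg1 z (hb3 z hz) fun h => hb2 (h ▸ hz)),
    contourMean_eq_zero (u := u) (R := r₁) (f := fun z => (z - v) ^ (-1 : ℤ)) hr₁0.le]
  · simp only [zpow_neg_one]
    rw [contourMean, circleIntegral.integral_sub_inv_of_mem_ball hv,
      inv_mul_cancel₀ Complex.two_pi_I_ne_zero]
    ring
  · intro z hz
    have : z - v ≠ 0 := sub_ne_zero.2 fun h => hb1 (h ▸ hz)
    exact DifferentiableAt.zpow (by fun_prop) (Or.inl this)

/-! ### Residues of the coefficient functions -/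

section Slot

variable {m n s : ℕ} {ρ : Fin n → ℕ}

/-- The closed disc of radius `R > 0` around the `i`-th pole contains no other pole. -/
def Times.IsolatedAt (p : Times n) (i : Fin n) (R : ℝ) : Prop :=
  0 < R ∧ ∀ j, j ≠ i → p.pos j ∉ Metric.closedBall (p.pos i) R

theorem Times.exists_isolatedAt {p : Times n} (hp : Function.Injective p.pos) (i : Fin n) {δ : ℝ}
    (hδ : 0 < δ) : ∃ R < δ, p.IsolatedAt i R := by
  have h : ∀ᶠ R in 𝓝[>] (0 : ℝ), ∀ j, j ≠ i → p.pos j ∉ Metric.closedBall (p.pos i) R := by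
    rw [eventually_all]
    intro j
    by_cases hj : j = i
    · simp [hj]
    · have : 0 < dist (p.pos j) (p.pos i) := dist_pos.2 fun h => hj (hp h)
      filter_upwards [Ioo_mem_nhdsGT this] with R hR _
      rw [Metric.mem_closedBall, not_le]
      exact hR.2
  obtain ⟨R, h1, h2⟩ := (h.and (Ioo_mem_nhdsGT hδ)).exists
  exact ⟨R, h2.2, h2.1, h1⟩

theorem Times.IsolatedAt.differentiableAt_slotFun {p : Times n} {i : Fin n} {R : ℝ}
    (h : p.IsolatedAt i R) (κ : Slot ρ s) {z : ℂ} (hz : z ∈ Metric.closedBall (p.pos i) R)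
    (hz' : z ≠ p.pos i) : DifferentiableAt ℂ (slotFun p κ) z := by
  refine _root_.differentiableAt_slotFun p κ fun j k _ => ?_
  rcases eq_or_ne j i with rfl | hj
  · exact hz'
  · exact fun h' => h.2 j hj (h' ▸ hz)

theorem Times.IsolatedAt.continuousOn_slotFun {p : Times n} {i : Fin n} {R : ℝ}
    (h : p.IsolatedAt i R) (κ : Slot ρ s) :
    ContinuousOn (slotFun p κ) (Metric.sphere (p.pos i) R) := fun _ hz =>
  (h.differentiableAt_slotFun κ (Metric.sphere_subset_closedBall hz)
    (ne_center_of_mem_sphere h.1 hz)).continuousAt.continuousWithinAt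

/-- The coefficients of the coordinate matrices of the `i`-th pole in the expression
`∑_j [x^j] (φ(x) / (z - u_i - P(x))) A_j`. -/
noncomputable def slotPart (p : Times n) (i : Fin n) (φ : PowerSeries ℂ) (z : ℂ) : Slot ρ s → ℂ
  | Sum.inl ⟨j, l⟩ => if j = i then
      PowerSeries.coeff (l : ℕ) (φ * poleSeries (ρ j) (p.time j) (z - p.pos j)) else 0
  | Sum.inr _ => 0

/-- Slots at other poles are holomorphic in the disc and contribute zero. At the `i`-th pole the
kernel keeps the polar part of `(w - u)^k / (w - u - P)`, which is `P^k / (z - u - P)`. -/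
theorem contourMean_slotFun_mul_kernel {p : Times n} {i : Fin n} {R : ℝ} (h : p.IsolatedAt i R)
    {z : ℂ} (hz : z ∉ Metric.closedBall (p.pos i) R) (k : ℕ) (κ : Slot ρ s) :
    contourMean (p.pos i) R (fun w => (w - p.pos i) ^ k * slotFun p κ w * (z - w)⁻¹)
      = slotPart p i ((timePoly (ρ i) (p.time i) : PowerSeries ℂ) ^ k) z κ := by
  have hR := h.1
  have hd : ∀ w ∈ Metric.closedBall (p.pos i) R, z - w ≠ 0 := by
    intro w hw; rw [sub_ne_zero]; rintro rfl; exact hz hw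
  have hreg : (∀ j l, κ = Sum.inl ⟨j, l⟩ → j ≠ i) →
      contourMean (p.pos i) R (fun w => (w - p.pos i) ^ k * slotFun p κ w * (z - w)⁻¹) = 0 := by
    intro hκ
    refine contourMean_eq_zero hR.le fun w hw => ?_
    have h1 : DifferentiableAt ℂ (slotFun p κ) w := _root_.differentiableAt_slotFun p κ
      fun j l hjl h' => h.2 j (hκ j l hjl) (h' ▸ hw)
    have h2 := hd w hw
    fun_prop (disch := assumption)
  rcases κ with ⟨j, l⟩ | l
  · by_cases hj : j = i
    · subst hj
      have hzu : z - p.pos j ≠ 0 := by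
        rw [sub_ne_zero]; rintro h'; exact hz (h' ▸ Metric.mem_closedBall_self hR.le)
      simp only [slotPart, slotFun, if_true]
      rw [coeff_pow_mul_poleSeries _ _ hzu k l.2]
      have hS : ∀ w ∈ Metric.sphere (p.pos j) R, w - p.pos j ≠ 0 := fun w hw =>
        sub_ne_zero.2 (ne_center_of_mem_sphere hR hw)
      have hpt : ∀ w ∈ Metric.sphere (p.pos j) R, (w - p.pos j) ^ k *
          PowerSeries.coeff (l : ℕ) (poleSeries (ρ j) (p.time j) (w - p.pos j)) * (z - w)⁻¹
          = ∑ a ∈ Finset.range (ρ j + 1), (timePoly (ρ j) (p.time j) ^ a).coeff l *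
            ((w - p.pos j) ^ ((k : ℤ) - (a + 1)) * (z - w)⁻¹) := by
        intro w hw
        rw [coeff_poleSeries _ _ _ l.2, Finset.mul_sum, Finset.sum_mul]
        refine Finset.sum_congr rfl fun a _ => ?_
        rw [zpow_sub₀ (hS w hw), zpow_natCast, show ((a : ℤ) + 1) = ((a + 1 : ℕ) : ℤ) by push_cast; rfl,
          zpow_natCast]
        ring
      rw [contourMean_congr hR.le hpt, contourMean_sum hR.le]
      · refine Finset.sum_congr rfl fun a _ => ?_
        split_ifs with hka
        · have h1 := contourMean_inv_pow_mul_kernel hR hz (a - k + 1)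
          rw [if_neg (by omega)] at h1
          rw [mul_comm, ← h1]
          congr 2
          funext w
          rw [show (k : ℤ) - (a + 1) = -((a - k + 1 : ℕ) : ℤ) by push_cast [Nat.cast_sub hka]; ring,
            zpow_neg, zpow_natCast]
        · rw [contourMean_eq_zero hR.le, mul_zero]
          intro w hw
          have h2 := hd w hw
          rw [show (k : ℤ) - (a + 1) = ((k - (a + 1) : ℕ) : ℤ) by
            push_cast [Nat.cast_sub (show a + 1 ≤ k by omega)]; ring]
          simp only [zpow_natCast]
          fun_prop (disch := assumption)
      · intro a _
        exact (ContinuousOn.zpow₀ (by fun_prop) _ fun w hw => Or.inl (hS w hw)).mul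
          (ContinuousOn.inv₀ (by fun_prop) fun w hw => hd w (Metric.sphere_subset_closedBall hw))
    · simp only [slotPart, hj, if_false]
      exact hreg fun j' l' hjl => by cases hjl; exact hj
  · exact hreg fun j' l' hjl => by cases hjl

/-- Only the term `P^k / (w - u)^(k+1)` of the geometric series has a residue after multiplication
by `(w - u)^k`. The moments of the slot functions are therefore entries of `𝓜`. -/
theorem contourMean_slotFun {p : Times n} {i : Fin n} {R : ℝ} (h : p.IsolatedAt i R) (k : ℕ)
    (hk : k ≤ ρ i) (κ : Slot ρ s) :
    contourMean (p.pos i) R (fun w => (w - p.pos i) ^ k * slotFun p κ w)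
      = match κ with
        | Sum.inl ⟨j, l⟩ => if j = i then (timePoly (ρ i) (p.time i) ^ k).coeff (l : ℕ) else 0
        | Sum.inr _ => 0 := by
  have hR := h.1
  have hreg : (∀ j l, κ = Sum.inl ⟨j, l⟩ → j ≠ i) →
      contourMean (p.pos i) R (fun w => (w - p.pos i) ^ k * slotFun p κ w) = 0 := by
    intro hκ
    refine contourMean_eq_zero hR.le fun w hw => ?_
    have h1 : DifferentiableAt ℂ (slotFun p κ) w := _root_.differentiableAt_slotFun p κ
      fun j l hjl h' => h.2 j (hκ j l hjl) (h' ▸ hw)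
    fun_prop
  rcases κ with ⟨j, l⟩ | l
  · by_cases hj : j = i
    · subst hj
      simp only [slotFun, if_true]
      have hS : ∀ w ∈ Metric.sphere (p.pos j) R, w - p.pos j ≠ 0 := fun w hw =>
        sub_ne_zero.2 (ne_center_of_mem_sphere hR hw)
      have hpt : ∀ w ∈ Metric.sphere (p.pos j) R, (w - p.pos j) ^ k *
          PowerSeries.coeff (l : ℕ) (poleSeries (ρ j) (p.time j) (w - p.pos j))
          = ∑ a ∈ Finset.range (ρ j + 1), (timePoly (ρ j) (p.time j) ^ a).coeff l *
            (w - p.pos j) ^ ((k : ℤ) - (a + 1)) := by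
        intro w hw
        rw [coeff_poleSeries _ _ _ l.2, Finset.mul_sum]
        refine Finset.sum_congr rfl fun a _ => ?_
        rw [zpow_sub₀ (hS w hw), zpow_natCast, show ((a : ℤ) + 1) = ((a + 1 : ℕ) : ℤ) by push_cast; rfl,
          zpow_natCast]
        ring
      rw [contourMean_congr hR.le hpt, contourMean_sum hR.le]
      · simp only [contourMean_sub_zpow _ hR]
        rw [Finset.sum_eq_single k]
        · simp
        · intro a _ ha
          rw [if_neg (by omega), mul_zero]
        · intro hk'
          exact absurd (Finset.mem_range.2 (by omega)) hk'
      · intro a _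
        exact ContinuousOn.zpow₀ (by fun_prop) _ fun w hw => Or.inl (hS w hw)
    · simp only [hj, if_false]
      exact hreg fun j' l' hjl => by cases hjl; exact hj
  · exact hreg fun j' l' hjl => by cases hjl

end Slot

/-! ### Commutators of matrices -/

section Commutator

variable {m : ℕ} {ι : Type*}

theorem Matrix.sum_lie (S : Finset ι) (f : ι → Matrix (Fin m) (Fin m) ℂ)
    (B : Matrix (Fin m) (Fin m) ℂ) : ⁅∑ i ∈ S, f i, B⁆ = ∑ i ∈ S, ⁅f i, B⁆ := by
  simp only [Ring.lie_def, Finset.sum_mul, Finset.mul_sum, Finset.sum_sub_distrib]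

theorem Matrix.lie_sum (S : Finset ι) (f : ι → Matrix (Fin m) (Fin m) ℂ)
    (B : Matrix (Fin m) (Fin m) ℂ) : ⁅B, ∑ i ∈ S, f i⁆ = ∑ i ∈ S, ⁅B, f i⁆ := by
  simp only [Ring.lie_def, Finset.sum_mul, Finset.mul_sum, Finset.sum_sub_distrib]

theorem Matrix.smul_lie (c : ℂ) (A B : Matrix (Fin m) (Fin m) ℂ) : ⁅c • A, B⁆ = c • ⁅A, B⁆ := by
  simp only [Ring.lie_def, smul_mul_assoc, mul_smul_comm, smul_sub]

theorem Matrix.lie_smul (c : ℂ) (A B : Matrix (Fin m) (Fin m) ℂ) : ⁅A, c • B⁆ = c • ⁅A, B⁆ := by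
  simp only [Ring.lie_def, smul_mul_assoc, mul_smul_comm, smul_sub]

theorem Matrix.sub_lie (A A' B : Matrix (Fin m) (Fin m) ℂ) : ⁅A - A', B⁆ = ⁅A, B⁆ - ⁅A', B⁆ := by
  simp only [Ring.lie_def, sub_mul, mul_sub]
  abel

end Commutator

section Poisson

variable {m n s : ℕ} {ρ : Fin n → ℕ}

/-! ### Partial fractions -/

theorem eq_zero_of_sum_coeff_eq_zero {r : ℕ} {t : ℕ → ℂ} (h : 1 ≤ r → t 1 ≠ 0) (v : Fin r → ℂ)
    (hv : ∀ k, 1 ≤ k → k ≤ r → ∑ l : Fin r, v l * (timePoly r t ^ k).coeff ((l : ℕ) + 1) = 0) :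
    v = 0 := by
  refine Matrix.eq_zero_of_mulVec_eq_zero (isUnit_det_monomMatrix h).ne_zero ?_
  funext k
  rw [Matrix.mulVec, dotProduct, Pi.zero_apply, ← hv (k + 1) (by omega) k.2]
  refine Finset.sum_congr rfl fun l _ => ?_
  rw [monomMatrix, Matrix.of_apply, monom_eq_coeff, mul_comm]

/-- Linear independence of the slot functions. Moments around each finite pole form an invertible
triangular system; once the finite slots are removed, a polynomial remains, whose coefficients again
form such a system. -/
theorem eq_zero_of_sum_slotFun_eq_zero {p : Times n} (hp : p.Admissible ρ s) (v : Slot ρ s → ℂ)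
    (h : ∀ z, (∀ i, z ≠ p.pos i) → ∑ κ, v κ * slotFun p κ z = 0) : v = 0 := by
  have hfin : ∀ i k, v (Sum.inl ⟨i, k⟩) = 0 := by
    intro i
    obtain ⟨R, -, hR⟩ := Times.exists_isolatedAt hp.1 i one_pos
    have h1 : ∀ k ≤ ρ i, ∑ l : Fin (ρ i + 1), v (Sum.inl ⟨i, l⟩)
        * (timePoly (ρ i) (p.time i) ^ k).coeff (l : ℕ) = 0 := by
      intro k hk
      have h2 := contourMean_sum (u := p.pos i) hR.1.le (Finset.univ : Finset (Slot ρ s)) v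
        (f := fun κ w => (w - p.pos i) ^ k * slotFun p κ w)
        (fun κ _ => ContinuousOn.mul (by fun_prop) (hR.continuousOn_slotFun κ))
      rw [contourMean_congr (g := fun _ => 0) hR.1.le, contourMean_eq_zero hR.1.le] at h2
      · simp only [contourMean_slotFun hR k hk] at h2
        rw [Fintype.sum_sum_type, Fintype.sum_sigma] at h2
        simp only [mul_zero, Finset.sum_const_zero, add_zero] at h2
        rw [Finset.sum_eq_single i] at h2
        · simpa using h2.symm
        · intro j _ hj
          simp [hj]
        · simp
      · intro z _
        exact differentiableAt_const 0
      · intro z hz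
        have h3 := h z fun j => by
          rcases eq_or_ne j i with rfl | hj
          · exact ne_center_of_mem_sphere hR.1 hz
          · exact fun h' => hR.2 j hj (h' ▸ Metric.sphere_subset_closedBall hz)
        calc _ = (z - p.pos i) ^ k * ∑ κ, v κ * slotFun p κ z := by
              rw [Finset.mul_sum]
              exact Finset.sum_congr rfl fun κ _ => by ring
          _ = 0 := by rw [h3, mul_zero]
    -- The zeroth moment involves `P^0 = 1` and so isolates the slot of index `0`, which the matrix
    -- `𝓜` does not cover.
    have h0 : v (Sum.inl ⟨i, 0⟩) = 0 := by
      have := h1 0 (Nat.zero_le _)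
      rw [Fin.sum_univ_succ] at this
      simpa [Polynomial.coeff_one] using this
    have hs := eq_zero_of_sum_coeff_eq_zero (hp.2.1 i) (fun l => v (Sum.inl ⟨i, l.succ⟩))
      fun k hk hk' => by
        have := h1 k hk'
        rw [Fin.sum_univ_succ, h0, zero_mul, zero_add] at this
        simpa using this
    intro k
    refine Fin.cases h0 (fun l => ?_) k
    exact congrFun hs l
  have hinf := eq_zero_of_sum_coeff_eq_zero hp.2.2 (fun l => v (Sum.inr l)) fun k hk hk' => by
    set b : ℕ → ℂ := fun a =>
      ∑ l : Fin s, v (Sum.inr l) * (timePoly s p.timeInf ^ a).coeff ((l : ℕ) + 1) with hb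
    set Q : Polynomial ℂ := ∑ a ∈ Finset.Icc 1 s, Polynomial.C (b a) * Polynomial.X ^ (a - 1)
      with hQ
    -- The relation is known only off the finitely many poles, which is enough for a polynomial.
    have hQ0 : Q = 0 := by
      refine Polynomial.eq_zero_of_infinite_isRoot Q
        (((Set.finite_range p.pos).infinite_compl).mono fun z hz => ?_)
      have h1 := h z fun i hi => hz ⟨i, hi.symm⟩
      rw [Fintype.sum_sum_type, Fintype.sum_sigma] at h1
      simp only [hfin, zero_mul, Finset.sum_const_zero, zero_add] at h1
      rw [Set.mem_ofPred_eq, Polynomial.IsRoot, hQ, Polynomial.eval_finsetSum, ← neg_eq_zero, ← h1]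
      simp only [hb, Polynomial.eval_mul, Polynomial.eval_C, Polynomial.eval_pow,
        Polynomial.eval_X, Finset.sum_mul]
      rw [Finset.sum_comm, ← Finset.sum_neg_distrib]
      refine Finset.sum_congr rfl fun l _ => ?_
      rw [slotFun, coeff_infSeries s p.timeInf z (Nat.succ_le_of_lt l.2), mul_neg, Finset.mul_sum]
      exact congrArg _ (Finset.sum_congr rfl fun a _ => by ring)
    have h2 : Q.coeff (k - 1) = b k := by
      simp only [hQ, Polynomial.finsetSum_coeff, Polynomial.coeff_C_mul, Polynomial.coeff_X_pow]
      rw [Finset.sum_eq_single k]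
      · simp
      · intro a ha hak
        have := (Finset.mem_Icc.1 ha).1
        rw [if_neg (by omega), mul_zero]
      · intro h'; exact absurd (Finset.mem_Icc.2 ⟨hk, hk'⟩) h'
    rw [hQ0, Polynomial.coeff_zero] at h2
    exact h2.symm
  funext κ
  rcases κ with ⟨i, k⟩ | l
  · exact hfin i k
  · exact congrFun hinf l

/-! ### The Poisson bracket with the connection -/

/-- The matrix of partial derivatives of `f` in a slot, `(∇_κ f)_{ba} = ∂f / ∂(X_κ)_{ab}`. -/
noncomputable def slotGrad (f : PhaseSpace m ρ s → ℂ) (X : PhaseSpace m ρ s) (κ : Slot ρ s) :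
    Matrix (Fin m) (Fin m) ℂ :=
  Matrix.of fun b a => fderiv ℂ f X (Pi.single (κ, a, b) 1)

/-- The Hamiltonian vector field `{f, X_μ}`. -/
noncomputable def hamField (f : PhaseSpace m ρ s → ℂ) (X : PhaseSpace m ρ s) (μ : Slot ρ s) :
    Matrix (Fin m) (Fin m) ℂ :=
  ∑ κ : Slot ρ s, ⁅slotGrad f X κ, slotAdd X κ μ⁆

/-- The transposition built into the gradient is what turns the two delta terms of the bracket into
a commutator. -/
theorem hamField_apply (f : PhaseSpace m ρ s → ℂ) (X : PhaseSpace m ρ s) (μ : Slot ρ s)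
    (c d : Fin m) :
    hamField f X μ c d
      = ∑ x, poissonTensor X x (μ, c, d) * fderiv ℂ f X (Pi.single x 1) := by
  rw [hamField, Matrix.sum_apply, Fintype.sum_prod_type]
  refine Finset.sum_congr rfl fun κ _ => ?_
  rw [Fintype.sum_prod_type, Ring.lie_def, Matrix.sub_apply, Matrix.mul_apply, Matrix.mul_apply]
  simp only [poissonTensor_eq, sub_mul, ite_mul, zero_mul, Finset.sum_sub_distrib, slotGrad,
    Matrix.of_apply]
  congr 1
  · refine Finset.sum_congr rfl fun a _ => ?_
    simp [mul_comm]
  · rw [Finset.sum_comm]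
    refine Finset.sum_congr rfl fun b _ => ?_
    simp

theorem poisson_eq_sum_hamField (f g : PhaseSpace m ρ s → ℂ) (X : PhaseSpace m ρ s) :
    poisson f g X
      = ∑ y : CoordIdx m ρ s, hamField f X y.1 y.2.1 y.2.2 * fderiv ℂ g X (Pi.single y 1) := by
  rw [poisson, Finset.sum_comm]
  refine Finset.sum_congr rfl fun y _ => ?_
  rw [hamField_apply, Finset.sum_mul]

theorem fderiv_linear_single {ι : Type*} [Fintype ι] [DecidableEq ι] (c : ι → ℂ) (X : ι → ℂ)
    (y : ι) : fderiv ℂ (fun Y : ι → ℂ => ∑ x, c x * Y x) X (Pi.single y 1) = c y := by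
  have h : HasFDerivAt (fun Y : ι → ℂ => ∑ x, c x * Y x)
      (∑ x, c x • ContinuousLinearMap.proj (R := ℂ) (φ := fun _ : ι => ℂ) x) X := by
    refine HasFDerivAt.fun_sum fun x _ => ?_
    exact (ContinuousLinearMap.proj (R := ℂ) (φ := fun _ : ι => ℂ) x).hasFDerivAt.const_mul (c x)
  rw [h.fderiv]
  simp [Pi.single_apply]

theorem poisson_coord (f : PhaseSpace m ρ s → ℂ) (X : PhaseSpace m ρ s) (μ : Slot ρ s)
    (c d : Fin m) : poisson f (fun Y => Y (μ, c, d)) X = hamField f X μ c d := by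
  have h : (fun Y : PhaseSpace m ρ s => Y (μ, c, d))
      = fun Y => ∑ x, (if x = (μ, c, d) then 1 else 0) * Y x := by
    funext Y; simp
  rw [poisson_eq_sum_hamField, h]
  simp only [fderiv_linear_single]
  simp

theorem poisson_connection (p : Times n) (f : PhaseSpace m ρ s → ℂ) (X : PhaseSpace m ρ s) (z : ℂ)
    (c d : Fin m) :
    poisson f (fun Y => connection p Y z c d) X
      = (∑ μ, slotFun p μ z • hamField f X μ) c d := by
  have h : (fun Y : PhaseSpace m ρ s => connection p Y z c d)
      = fun Y => ∑ x : CoordIdx m ρ s, (if x.2 = (c, d) then slotFun p x.1 z else 0) * Y x := by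
    funext Y
    rw [connection_apply, Fintype.sum_prod_type]
    simp
  rw [poisson_eq_sum_hamField, h]
  simp only [fderiv_linear_single]
  rw [Fintype.sum_prod_type, Matrix.sum_apply]
  refine Finset.sum_congr rfl fun μ _ => ?_
  simp [mul_comm]

/-- The bracket depends on the second function only through its differential, so coordinate
functions suffice as test functions. -/
theorem isCasimir_iff (f : PhaseSpace m ρ s → ℂ) :
    IsCasimir f ↔ Differentiable ℂ f ∧ ∀ X μ, hamField f X μ = 0 := by
  refine and_congr_right fun _ => ⟨fun h X μ => ?_, fun h g _ X => ?_⟩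
  · ext c d
    rw [← poisson_coord, h _ (by fun_prop), Matrix.zero_apply]
  · rw [poisson_eq_sum_hamField]
    simp [h]

/-- By linear independence of the slot functions, the bracket with the connection at all `z`
determines the brackets with all coordinates. -/
theorem isCasimir_of_poisson_connection {p : Times n} (hp : p.Admissible ρ s)
    {f : PhaseSpace m ρ s → ℂ} (hf : Differentiable ℂ f)
    (h : ∀ X z, (∀ i, z ≠ p.pos i) → ∀ c d, poisson f (fun Y => connection p Y z c d) X = 0) :
    IsCasimir f := by
  refine (isCasimir_iff f).2 ⟨hf, fun X μ => ?_⟩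
  ext c d
  have := eq_zero_of_sum_slotFun_eq_zero hp (fun κ => hamField f X κ c d) fun z hz => by
    rw [← h X z hz c d, poisson_connection, Matrix.sum_apply]
    exact Finset.sum_congr rfl fun κ _ => by rw [Matrix.smul_apply, smul_eq_mul, mul_comm]
  exact congrFun this μ

theorem slotGrad_sub {f g : PhaseSpace m ρ s → ℂ} {X : PhaseSpace m ρ s}
    (hf : DifferentiableAt ℂ f X) (hg : DifferentiableAt ℂ g X) (κ : Slot ρ s) :
    slotGrad (fun Y => f Y - g Y) X κ = slotGrad f X κ - slotGrad g X κ := by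
  ext b a
  simp [slotGrad, fderiv_fun_sub hf hg]

theorem slotGrad_const_mul {f : PhaseSpace m ρ s → ℂ} {X : PhaseSpace m ρ s}
    (hf : DifferentiableAt ℂ f X) (c : ℂ) (κ : Slot ρ s) :
    slotGrad (fun Y => c * f Y) X κ = c • slotGrad f X κ := by
  ext b a
  simp [slotGrad, fderiv_const_mul hf]

theorem slotGrad_sum {ι : Type*} (S : Finset ι) {f : ι → PhaseSpace m ρ s → ℂ}
    {X : PhaseSpace m ρ s} (hf : ∀ i ∈ S, DifferentiableAt ℂ (f i) X) (κ : Slot ρ s) :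
    slotGrad (fun Y => ∑ i ∈ S, f i Y) X κ = ∑ i ∈ S, slotGrad (f i) X κ := by
  ext b a
  simp only [slotGrad, Matrix.of_apply, Matrix.sum_apply]
  rw [fderiv_fun_sum hf, sum_apply]

theorem hamField_sub {f g : PhaseSpace m ρ s → ℂ} {X : PhaseSpace m ρ s}
    (hf : DifferentiableAt ℂ f X) (hg : DifferentiableAt ℂ g X) (μ : Slot ρ s) :
    hamField (fun Y => f Y - g Y) X μ = hamField f X μ - hamField g X μ := by
  simp only [hamField, slotGrad_sub hf hg, Matrix.sub_lie, Finset.sum_sub_distrib]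

theorem hamField_const_mul {f : PhaseSpace m ρ s → ℂ} {X : PhaseSpace m ρ s}
    (hf : DifferentiableAt ℂ f X) (c : ℂ) (μ : Slot ρ s) :
    hamField (fun Y => c * f Y) X μ = c • hamField f X μ := by
  simp only [hamField, slotGrad_const_mul hf, Matrix.smul_lie, Finset.smul_sum]

theorem hamField_sum {ι : Type*} (S : Finset ι) {f : ι → PhaseSpace m ρ s → ℂ}
    {X : PhaseSpace m ρ s} (hf : ∀ i ∈ S, DifferentiableAt ℂ (f i) X) (μ : Slot ρ s) :
    hamField (fun Y => ∑ i ∈ S, f i Y) X μ = ∑ i ∈ S, hamField (f i) X μ := by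
  simp only [hamField, slotGrad_sum S hf, Matrix.sum_lie]
  exact Finset.sum_comm

theorem IsCasimir.sub {f g : PhaseSpace m ρ s → ℂ} (hf : IsCasimir f) (hg : IsCasimir g) :
    IsCasimir (fun X => f X - g X) := by
  rw [isCasimir_iff] at hf hg ⊢
  refine ⟨hf.1.sub hg.1, fun X μ => ?_⟩
  rw [hamField_sub (hf.1 X) (hg.1 X), hf.2, hg.2, sub_zero]

theorem IsCasimir.const_mul {f : PhaseSpace m ρ s → ℂ} (hf : IsCasimir f) (c : ℂ) :
    IsCasimir (fun X => c * f X) := by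
  rw [isCasimir_iff] at hf ⊢
  refine ⟨hf.1.const_mul c, fun X μ => ?_⟩
  rw [hamField_const_mul (hf.1 X), hf.2, smul_zero]

theorem IsCasimir.sum {ι : Type*} (S : Finset ι) {f : ι → PhaseSpace m ρ s → ℂ}
    (hf : ∀ i ∈ S, IsCasimir (f i)) : IsCasimir (fun X => ∑ i ∈ S, f i X) := by
  rw [isCasimir_iff]
  refine ⟨Differentiable.fun_sum fun i hi => (hf i hi).1, fun X μ => ?_⟩
  rw [hamField_sum S fun i hi => (hf i hi).1 X]
  exact Finset.sum_eq_zero fun i hi => ((isCasimir_iff _).1 (hf i hi)).2 X μ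

theorem isCasimir_zero : IsCasimir (fun _ : PhaseSpace m ρ s => (0 : ℂ)) := by
  simpa using IsCasimir.sum (∅ : Finset ℕ) (f := fun _ (_ : PhaseSpace m ρ s) => 0) (by simp)

theorem IsCasimir.add {f g : PhaseSpace m ρ s → ℂ} (hf : IsCasimir f) (hg : IsCasimir g) :
    IsCasimir (fun X => f X + g X) := by
  simpa using hf.sub (hg.const_mul (-1))

/-! ### Spectral invariants -/

theorem connection_differentiableAt (p : Times n) (X : PhaseSpace m ρ s) {z : ℂ}
    (hz : ∀ i, z ≠ p.pos i) (a b : Fin m) :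
    DifferentiableAt ℂ (fun w => connection p X w a b) z := by
  simp only [connection_apply]
  exact DifferentiableAt.fun_sum fun κ _ =>
    (differentiableAt_slotFun p κ fun i _ _ => hz i).mul_const _

theorem trace_sq_differentiableAt (p : Times n) (X : PhaseSpace m ρ s) {z : ℂ}
    (hz : ∀ i, z ≠ p.pos i) :
    DifferentiableAt ℂ (fun w => Matrix.trace (connection p X w * connection p X w)) z := by
  simp only [Matrix.trace, Matrix.diag_apply, Matrix.mul_apply]
  exact DifferentiableAt.fun_sum fun a _ => DifferentiableAt.fun_sum fun b _ =>
    (connection_differentiableAt p X hz a b).mul (connection_differentiableAt p X hz b a)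

theorem Times.IsolatedAt.ne_pos {p : Times n} {i : Fin n} {R : ℝ} (h : p.IsolatedAt i R) {z : ℂ}
    (hz : z ∈ Metric.closedBall (p.pos i) R) (hz' : z ≠ p.pos i) (j : Fin n) : z ≠ p.pos j := by
  rcases eq_or_ne j i with rfl | hj
  · exact hz'
  · exact fun h' => h.2 j hj (h' ▸ hz)

theorem spectralInvariant_eq_contourMean {p : Times n} {i : Fin n} {R : ℝ} (h : p.IsolatedAt i R)
    (k : ℕ) (X : PhaseSpace m ρ s) :
    spectralInvariant p i k X = (1 / 2) * contourMean (p.pos i) R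
      (fun z => (z - p.pos i) ^ k * Matrix.trace (connection p X z * connection p X z)) := by
  rw [spectralInvariant, residueAt_eq_contourMean h.1]
  intro z hz hne
  exact DifferentiableAt.mul (by fun_prop) (trace_sq_differentiableAt p X (h.ne_pos hz hne))

/-- The matrix of the quadratic form given by a spectral invariant. -/
noncomputable def slotForm (p : Times n) (i : Fin n) (R : ℝ) (k : ℕ) (κ μ : Slot ρ s) : ℂ :=
  contourMean (p.pos i) R (fun w => (w - p.pos i) ^ k * (slotFun p κ w * slotFun p μ w))

theorem Times.IsolatedAt.continuousOn_slotForm {p : Times n} {i : Fin n} {R : ℝ}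
    (h : p.IsolatedAt i R) (k : ℕ) (κ μ : Slot ρ s) :
    ContinuousOn (fun w => (w - p.pos i) ^ k * (slotFun p κ w * slotFun p μ w))
      (Metric.sphere (p.pos i) R) :=
  ContinuousOn.mul (by fun_prop) ((h.continuousOn_slotFun κ).mul (h.continuousOn_slotFun μ))

theorem spectralInvariant_eq_sum {p : Times n} {i : Fin n} {R : ℝ} (h : p.IsolatedAt i R)
    (k : ℕ) (X : PhaseSpace m ρ s) :
    spectralInvariant p i k X = (1 / 2) * ∑ x : Slot ρ s × Slot ρ s,
      Matrix.trace (slotMat X x.1 * slotMat X x.2) * slotForm p i R k x.1 x.2 := by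
  rw [spectralInvariant_eq_contourMean h]
  congr 1
  simp only [slotForm]
  rw [← contourMean_sum h.1.le _ _ fun x _ => h.continuousOn_slotForm k x.1 x.2]
  congr 1
  funext z
  rw [connection_eq, Finset.sum_mul_sum, Fintype.sum_prod_type, Matrix.trace_sum, Finset.mul_sum]
  refine Finset.sum_congr rfl fun κ _ => ?_
  rw [Matrix.trace_sum, Finset.mul_sum]
  refine Finset.sum_congr rfl fun μ _ => ?_
  rw [smul_mul_smul_comm, Matrix.trace_smul, smul_eq_mul]
  ring

theorem differentiable_slotMat_apply (κ : Slot ρ s) (a b : Fin m) :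
    Differentiable ℂ (fun X : PhaseSpace m ρ s => slotMat X κ a b) := by
  simp only [slotMat, Matrix.of_apply]
  fun_prop

theorem differentiable_spectralInvariant {p : Times n} (hp : Function.Injective p.pos) (i : Fin n)
    (k : ℕ) : Differentiable ℂ (spectralInvariant p i k : PhaseSpace m ρ s → ℂ) := by
  obtain ⟨R, -, hR⟩ := Times.exists_isolatedAt hp i one_pos
  have : (spectralInvariant p i k : PhaseSpace m ρ s → ℂ) = _ :=
    funext fun X => spectralInvariant_eq_sum hR k X
  rw [this]
  refine Differentiable.const_mul (Differentiable.fun_sum fun x _ => Differentiable.mul_const ?_ _) _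
  simp only [Matrix.trace, Matrix.diag_apply, Matrix.mul_apply]
  exact Differentiable.fun_sum fun a _ => Differentiable.fun_sum fun b _ =>
    (differentiable_slotMat_apply _ _ _).mul (differentiable_slotMat_apply _ _ _)

/-- The spectral invariant is a quadratic form; restricted to a line it is a quadratic polynomial.
The symmetry of the form and of the trace cancels the factor `1/2`. -/
theorem slotGrad_spectralInvariant {p : Times n} (hp : Function.Injective p.pos) {i : Fin n} {R : ℝ}
    (h : p.IsolatedAt i R) (k : ℕ) (X : PhaseSpace m ρ s) (κ : Slot ρ s) :
    slotGrad (spectralInvariant p i k) X κ = ∑ μ, slotForm p i R k κ μ • slotMat X μ := by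
  ext b a
  set v : PhaseSpace m ρ s := Pi.single (κ, a, b) 1 with hv
  have hS := (differentiable_spectralInvariant (m := m) (s := s) (ρ := ρ) hp i k X).hasFDerivAt
  have hline : HasDerivAt (fun x : ℂ => X + x • v) v 0 := by
    simpa using ((hasDerivAt_id' (0 : ℂ)).smul_const v).const_add X
  have h1 : HasDerivAt (fun x : ℂ => spectralInvariant p i k (X + x • v))
      (fderiv ℂ (spectralInvariant p i k) X v) 0 := by
    have hS' : HasFDerivAt (spectralInvariant p i k)
        (fderiv ℂ (spectralInvariant p i k : PhaseSpace m ρ s → ℂ) X) (X + (0 : ℂ) • v) := by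
      simpa using hS
    exact hS'.comp_hasDerivAt (0 : ℂ) hline
  have hvmat : ∀ μ, slotMat v μ = if μ = κ then Matrix.single a b 1 else 0 := by
    intro μ
    ext c d
    by_cases hμ : μ = κ
    · subst hμ
      simp [slotMat, hv, Pi.single_apply, Matrix.single_apply, eq_comm]
    · simp [slotMat, hv, hμ]
  have hmat : ∀ (x : ℂ) μ, slotMat (X + x • v) μ = slotMat X μ + x • slotMat v μ := by
    intro x μ; ext c d; simp [slotMat]
  set B : ℂ := (1 / 2) * ∑ x : Slot ρ s × Slot ρ s, (Matrix.trace (slotMat X x.1 * slotMat v x.2)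
      + Matrix.trace (slotMat v x.1 * slotMat X x.2)) * slotForm p i R k x.1 x.2 with hB
  have h2 : HasDerivAt (fun x : ℂ => spectralInvariant p i k (X + x • v)) B 0 := by
    have h3 : ∀ x : ℂ, spectralInvariant p i k (X + x • v)
        = spectralInvariant p i k X + x * B + x ^ 2 * spectralInvariant p i k v := by
      intro x
      simp only [spectralInvariant_eq_sum h, hB, Finset.mul_sum, ← Finset.sum_add_distrib]
      refine Finset.sum_congr rfl fun y _ => ?_
      simp only [hmat, add_mul, mul_add, Matrix.trace_add, smul_mul_assoc, mul_smul_comm,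
        Matrix.trace_smul, smul_eq_mul]
      ring
    simp only [h3]
    have h4 := (((hasDerivAt_id' (0 : ℂ)).mul_const B).const_add (spectralInvariant p i k X)).add
      ((hasDerivAt_pow 2 (0 : ℂ)).mul_const (spectralInvariant p i k v))
    exact h4.congr_deriv (by simp)
  rw [slotGrad, Matrix.of_apply, h1.unique h2, hB, Matrix.sum_apply]
  have hsymm : ∀ x y : Slot ρ s, slotForm p i R k x y = slotForm p i R k y x := by
    intro x y; simp only [slotForm, mul_comm (slotFun p x _)]
  have hT : ∀ M : Matrix (Fin m) (Fin m) ℂ, Matrix.trace (Matrix.single a b 1 * M) = M b a := by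
    intro M; simp [Matrix.trace_single_mul]
  simp only [add_mul, Finset.sum_add_distrib, Fintype.sum_prod_type]
  rw [Finset.sum_comm (f := fun x y => Matrix.trace (slotMat X x * slotMat v y)
    * slotForm p i R k x y)]
  have e1 : ∀ y, ∑ x, Matrix.trace (slotMat X x * slotMat v y) * slotForm p i R k x y
      = ∑ x, Matrix.trace (slotMat v y * slotMat X x) * slotForm p i R k y x := fun y =>
    Finset.sum_congr rfl fun x _ => by rw [Matrix.trace_mul_comm, hsymm]
  simp only [e1]
  rw [← two_mul, ← mul_assoc, one_div, inv_mul_cancel₀ (two_ne_zero), one_mul,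
    Finset.sum_eq_single κ]
  · refine Finset.sum_congr rfl fun μ _ => ?_
    rw [hvmat, if_pos rfl, hT, Matrix.smul_apply, smul_eq_mul, mul_comm]
  · intro y _ hy
    simp [hvmat, hy]
  · simp

/-- This is the bracket of `½ Tr A(w)²` with `A(z)`. The r-matrix relation produces `[A(w), A(w) -
A(z)] / (z - w)`, in which `A(w)` commutes with itself. -/
theorem lie_connection_eq (p : Times n) (X : PhaseSpace m ρ s) {w z : ℂ}
    (hw : ∀ i, w ≠ p.pos i) (hz : ∀ i, z ≠ p.pos i) (hwz : z ≠ w) :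
    ∑ κ : Slot ρ s, ∑ μ : Slot ρ s, (slotFun p κ w * slotFun p μ w) •
        ∑ ν : Slot ρ s, slotFun p ν z • ⁅slotMat X μ, slotAdd X κ ν⁆
      = (z - w)⁻¹ • ⁅connection p X z, connection p X w⁆ := by
  have h1 := sum_slotFun_mul_slotFun_smul p X hw hz
  have h2 : ∑ κ : Slot ρ s, ∑ μ : Slot ρ s, (slotFun p κ w * slotFun p μ z) • slotAdd X κ μ
      = (z - w)⁻¹ • (connection p X w - connection p X z) := by
    rw [eq_inv_smul_iff₀ (sub_ne_zero.2 hwz), h1, connection_eq, connection_eq,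
      ← Finset.sum_sub_distrib]
    simp only [sub_smul]
  calc _ = ⁅connection p X w,
        ∑ κ : Slot ρ s, ∑ μ : Slot ρ s, (slotFun p κ w * slotFun p μ z) • slotAdd X κ μ⁆ := by
        rw [connection_eq]
        simp only [Matrix.sum_lie, Matrix.lie_sum, Matrix.smul_lie, Matrix.lie_smul, Finset.smul_sum, smul_smul]
        refine Finset.sum_congr rfl fun κ _ => ?_
        rw [Finset.sum_comm]
        refine Finset.sum_congr rfl fun ν _ => Finset.sum_congr rfl fun μ _ => ?_
        congr 1; ring
    _ = _ := by
        rw [h2, Matrix.lie_smul, Ring.lie_def, Ring.lie_def, mul_sub, sub_mul, sub_sub_sub_cancel_left]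

/-- The Hamiltonian vector field of a spectral invariant, applied to the connection. -/
theorem sum_slotFun_smul_hamField_spectralInvariant {p : Times n} (hp : Function.Injective p.pos)
    (i : Fin n) (k : ℕ) (X : PhaseSpace m ρ s) {z : ℂ} (hz : ∀ j, z ≠ p.pos j) :
    ∑ ν, slotFun p ν z • hamField (spectralInvariant p i k) X ν
      = ⁅connection p X z,
        ∑ κ, slotPart p i ((timePoly (ρ i) (p.time i) : PowerSeries ℂ) ^ k) z κ • slotMat X κ⁆ := by
  -- The circle must separate `u_i` from `z` as well as from the other poles, for the kernel `(z -
  -- w)⁻¹` to be regular in the disc.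
  obtain ⟨R, hRz, hR⟩ := Times.exists_isolatedAt hp i (dist_pos.2 (hz i))
  have hzR : z ∉ Metric.closedBall (p.pos i) R := by
    rw [Metric.mem_closedBall, not_le]; exact hRz
  have hS : ∀ w ∈ Metric.sphere (p.pos i) R, (∀ j, w ≠ p.pos j) ∧ z ≠ w := fun w hw =>
    ⟨hR.ne_pos (Metric.sphere_subset_closedBall hw) (ne_center_of_mem_sphere hR.1 hw),
      fun h => hzR (h ▸ Metric.sphere_subset_closedBall hw)⟩
  ext c d
  have hL : (∑ ν, slotFun p ν z • hamField (spectralInvariant p i k) X ν) c d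
      = ∑ x : Slot ρ s × Slot ρ s,
        (∑ ν : Slot ρ s, slotFun p ν z • ⁅slotMat X x.2, slotAdd X x.1 ν⁆) c d
          * slotForm p i R k x.1 x.2 := by
    simp only [hamField, slotGrad_spectralInvariant hp hR, Matrix.sum_lie, Matrix.smul_lie,
      Finset.smul_sum, Matrix.sum_apply, Matrix.smul_apply, smul_eq_mul, Finset.sum_mul,
      Fintype.sum_prod_type]
    rw [Finset.sum_comm]
    refine Finset.sum_congr rfl fun κ _ => ?_
    rw [Finset.sum_comm]
    refine Finset.sum_congr rfl fun μ _ => Finset.sum_congr rfl fun ν _ => ?_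
    ring
  have hRt : (⁅connection p X z, ∑ κ, slotPart p i
        ((timePoly (ρ i) (p.time i) : PowerSeries ℂ) ^ k) z κ • slotMat X κ⁆) c d
      = ∑ κ, ⁅connection p X z, slotMat X κ⁆ c d * contourMean (p.pos i) R
        (fun w => (w - p.pos i) ^ k * slotFun p κ w * (z - w)⁻¹) := by
    simp only [contourMean_slotFun_mul_kernel hR hzR, Matrix.lie_sum, Matrix.lie_smul, Matrix.sum_apply,
      Matrix.smul_apply, smul_eq_mul]
    exact Finset.sum_congr rfl fun κ _ => mul_comm _ _
  rw [hL, hRt]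
  simp only [slotForm]
  -- Both sides are now single contour integrals, and the integrands agree pointwise by the bracket
  -- relation multiplied by `(w - u_i)^k`.
  rw [← contourMean_sum hR.1.le _ _ fun x _ => hR.continuousOn_slotForm k x.1 x.2,
    ← contourMean_sum hR.1.le]
  · refine contourMean_congr hR.1.le fun w hw => ?_
    have h1 := congrFun (congrFun (lie_connection_eq p X (hS w hw).1 hz (hS w hw).2) c) d
    rw [connection_eq p X w] at h1
    simp only [Matrix.lie_sum, Matrix.lie_smul, Matrix.sum_apply, Matrix.smul_apply, smul_eq_mul] at h1
    have h2 : ∀ a b : ℂ, a = b → (w - p.pos i) ^ k * a = (w - p.pos i) ^ k * b :=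
      fun a b h => by rw [h]
    have h3 := h2 _ _ h1
    rw [Fintype.sum_prod_type]
    simp only [Finset.mul_sum] at h3
    simp only [Matrix.sum_apply, Matrix.smul_apply, smul_eq_mul, Finset.sum_mul]
    convert h3 using 1
    · refine Finset.sum_congr rfl fun κ _ => Finset.sum_congr rfl fun μ _ =>
        Finset.sum_congr rfl fun ν _ => ?_
      ring
    · refine Finset.sum_congr rfl fun κ _ => ?_
      ring
  · intro κ _
    refine ContinuousOn.mul (ContinuousOn.mul (by fun_prop) (hR.continuousOn_slotFun κ))
      (ContinuousOn.inv₀ (by fun_prop) fun w hw => sub_ne_zero.2 (hS w hw).2)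

end Poisson

/-! ### Hamiltonian flows of the spectral Hamiltonians and the zero curvature equation -/

section Isomonodromy

variable {m n s : ℕ} {ρ : Fin n → ℕ}

/-- `P^k` vanishes modulo `x^(r+1)` when `k > r`, so the Hamiltonian vector field is zero. -/
theorem isCasimir_spectralInvariant {p : Times n} (hp : p.Admissible ρ s) {i : Fin n} {k : ℕ}
    (hk : ρ i < k) : IsCasimir (spectralInvariant p i k : PhaseSpace m ρ s → ℂ) := by
  refine isCasimir_of_poisson_connection hp (differentiable_spectralInvariant hp.1 i k)
    fun X z hz c d => ?_
  have h0 : ∀ κ : Slot ρ s,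
      slotPart p i ((timePoly (ρ i) (p.time i) : PowerSeries ℂ) ^ k) z κ = 0 := by
    rintro (⟨j, l⟩ | l)
    · simp only [slotPart]
      split_ifs with hj
      · subst hj
        rw [mul_comm]
        exact PowerSeries.coeff_mul_of_X_pow_dvd (X_pow_dvd_coe_timePoly_pow _ _ k)
          (by have := l.2; omega)
      · rfl
    · rfl
  rw [poisson_connection, sum_slotFun_smul_hamField_spectralInvariant hp.1 i k X hz]
  simp [h0, Ring.lie_def]

/-- Only the class of `P^q` modulo `x^(r+1)` matters, and its coefficients are row `q` of `𝓜` when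
`q ≤ r`. -/
theorem slotPart_timePoly_pow (p : Times n) (i : Fin n) {q : ℕ} (hq : 1 ≤ q) (z : ℂ)
    (κ : Slot ρ s) :
    slotPart p i ((timePoly (ρ i) (p.time i) : PowerSeries ℂ) ^ q) z κ
      = ∑ l : Fin (ρ i), (timePoly (ρ i) (p.time i) ^ q).coeff ((l : ℕ) + 1)
        * slotPart p i (PowerSeries.X ^ ((l : ℕ) + 1)) z κ := by
  rcases κ with ⟨j, b⟩ | b
  · by_cases hj : j = i
    · subst hj
      simp only [slotPart, if_true]
      set P := timePoly (ρ j) (p.time j)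
      set g := poleSeries (ρ j) (p.time j) (z - p.pos j)
      have hdvd : (PowerSeries.X : PowerSeries ℂ) ^ (ρ j + 1) ∣ (P : PowerSeries ℂ) ^ q
          - ∑ l ∈ Finset.range (ρ j + 1), PowerSeries.C ((P ^ q).coeff l) * PowerSeries.X ^ l := by
        refine PowerSeries.X_pow_dvd_iff.2 fun a ha => ?_
        rw [map_sub, map_sum, ← Polynomial.coe_pow, Polynomial.coeff_coe]
        simp only [PowerSeries.coeff_C_mul, PowerSeries.coeff_X_pow]
        rw [Finset.sum_eq_single a]
        · simp
        · intro c _ hc; simp [Ne.symm hc]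
        · intro h; exact absurd (Finset.mem_range.2 ha) h
      have h := PowerSeries.coeff_mul_of_X_pow_dvd (φ := g) hdvd b.2
      rw [mul_sub, map_sub, sub_eq_zero, mul_comm] at h
      rw [h, mul_comm, Finset.sum_mul, map_sum, Finset.sum_range_succ',
        coeff_timePoly_pow_of_lt _ _ (show 0 < q by omega), map_zero, zero_mul, zero_mul, map_zero,
        add_zero, Finset.sum_range]
      exact Finset.sum_congr rfl fun l _ => by rw [mul_assoc, PowerSeries.coeff_C_mul]
    · simp [slotPart, hj]
  · simp [slotPart]

theorem spectralHamiltonian_succ (p : Times n) (i : Fin n) {k : ℕ} (hk : k < ρ i) :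
    (spectralHamiltonian p i (k + 1) : PhaseSpace m ρ s → ℂ) = fun X => ∑ l : Fin (ρ i),
      (monomMatrix (ρ i) (p.time i))⁻¹ ⟨k, hk⟩ l * spectralInvariant p i ((l : ℕ) + 1) X := by
  funext X
  simp only [spectralHamiltonian, hk, dif_pos, Matrix.mulVec, dotProduct]

theorem differentiable_spectralHamiltonian {p : Times n} (hp : Function.Injective p.pos) (i : Fin n)
    {k : ℕ} (hk : k ≤ ρ i) : Differentiable ℂ (spectralHamiltonian p i k : PhaseSpace m ρ s → ℂ) := by
  cases k with
  | zero => exact differentiable_spectralInvariant hp i 0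
  | succ k =>
    rw [spectralHamiltonian_succ p i hk]
    exact Differentiable.fun_sum fun l _ => (differentiable_spectralInvariant hp i _).const_mul _

/-- The combination with `𝓜⁻¹` replaces `P^k` by `x^k` in the vector field; this is the reason for
the inverse matrix in the definition. -/
theorem sum_slotFun_smul_hamField_spectralHamiltonian {p : Times n} (hp : p.Admissible ρ s)
    (i : Fin n) {k : ℕ} (hk : k ≤ ρ i) (X : PhaseSpace m ρ s) {z : ℂ} (hz : ∀ j, z ≠ p.pos j) :
    ∑ ν, slotFun p ν z • hamField (spectralHamiltonian p i k) X ν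
      = ⁅connection p X z, ∑ κ, slotPart p i (PowerSeries.X ^ k) z κ • slotMat X κ⁆ := by
  cases k with
  | zero =>
    have h := sum_slotFun_smul_hamField_spectralInvariant hp.1 i 0 X hz
    simp only [pow_zero] at h ⊢
    exact h
  | succ k =>
    have hinv : (monomMatrix (ρ i) (p.time i))⁻¹ * monomMatrix (ρ i) (p.time i) = 1 :=
      Matrix.nonsing_inv_mul _ (isUnit_det_monomMatrix (hp.2.1 i))
    have hd : ∀ l : Fin (ρ i), DifferentiableAt ℂ
        (spectralInvariant p i ((l : ℕ) + 1) : PhaseSpace m ρ s → ℂ) X := fun l =>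
      differentiable_spectralInvariant hp.1 i _ X
    rw [spectralHamiltonian_succ p i hk]
    set c := (monomMatrix (ρ i) (p.time i))⁻¹ ⟨k, hk⟩ with hc
    have h1 : ∀ ν, hamField (fun X => ∑ l : Fin (ρ i),
        c l * spectralInvariant p i ((l : ℕ) + 1) X) X ν
        = ∑ l : Fin (ρ i), c l • hamField (spectralInvariant p i ((l : ℕ) + 1)) X ν := by
      intro ν
      rw [hamField_sum _ fun l _ => (hd l).const_mul _]
      exact Finset.sum_congr rfl fun l _ => hamField_const_mul (hd l) _ ν
    have h2 : ∀ κ : Slot ρ s, slotPart p i (PowerSeries.X ^ (k + 1)) z κ = ∑ l : Fin (ρ i), c l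
        * slotPart p i ((timePoly (ρ i) (p.time i) : PowerSeries ℂ) ^ ((l : ℕ) + 1)) z κ := by
      intro κ
      simp only [slotPart_timePoly_pow p i (Nat.le_add_left 1 _), Finset.mul_sum]
      rw [Finset.sum_comm]
      have h3 : ∀ q : Fin (ρ i), ∑ l, c l * (timePoly (ρ i) (p.time i) ^ ((l : ℕ) + 1)).coeff
          ((q : ℕ) + 1) = if (⟨k, hk⟩ : Fin (ρ i)) = q then 1 else 0 := by
        intro q
        have := congrFun (congrFun hinv ⟨k, hk⟩) q
        rw [Matrix.mul_apply, Matrix.one_apply] at this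
        rw [← this]
        refine Finset.sum_congr rfl fun l _ => ?_
        rw [show monomMatrix (ρ i) (p.time i) l q = (timePoly (ρ i) (p.time i) ^ ((l : ℕ) + 1)).coeff
          ((q : ℕ) + 1) from monom_eq_coeff _ _ _ _]
      simp only [← mul_assoc, ← Finset.sum_mul, h3]
      simp
    simp only [h1, h2, Finset.smul_sum, Finset.sum_smul]
    rw [Finset.sum_comm]
    conv_rhs => rw [Finset.sum_comm, Matrix.lie_sum]
    refine Finset.sum_congr rfl fun l _ => ?_
    have h4 := congrArg (fun M => c l • M)
      (sum_slotFun_smul_hamField_spectralInvariant hp.1 i ((l : ℕ) + 1) X hz)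
    simp only [Finset.smul_sum, ← Matrix.lie_smul, smul_smul] at h4 ⊢
    simp only [mul_comm (c l)] at h4 ⊢
    exact h4

/-- The derivative of the coefficient functions with respect to the parameter `(i, k)`. -/
noncomputable def slotDeriv (p : Times n) (i : Fin n) (k : ℕ) (z : ℂ) : Slot ρ s → ℂ
  | Sum.inl ⟨j, l⟩ => if j = i then PowerSeries.coeff (l : ℕ) (PowerSeries.X ^ k *
      (poleSeries (ρ j) (p.time j) (z - p.pos j) * poleSeries (ρ j) (p.time j) (z - p.pos j))) else 0
  | Sum.inr _ => 0

theorem hasDerivAt_slotFun_shift (p : Times n) (i : Fin n) {k : ℕ} (hk : k ≤ ρ i) {z : ℂ}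
    (hz : ∀ j, z ≠ p.pos j) (κ : Slot ρ s) :
    HasDerivAt (fun w => slotFun (p.shift i k w) κ z) (slotDeriv p i k z κ) 0 := by
  rcases κ with ⟨j, l⟩ | l
  · simp only [slotFun, slotDeriv, Times.shift]
    have hζ := sub_ne_zero.2 (hz j)
    by_cases hj : j = i
    · subst hj
      by_cases hk0 : k = 0
      · subst hk0
        simp only [if_true, Function.update_self, pow_zero, one_mul]
        have h1 : HasDerivAt (fun w : ℂ => z - (p.pos j + w)) (-1) 0 := by
          simpa using ((hasDerivAt_id' (0 : ℂ)).const_add (p.pos j)).const_sub z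
        have h2 := hasDerivAt_coeff_poleSeries (ρ j) (p.time j) hζ l
        have h3 : HasDerivAt (fun x => PowerSeries.coeff (l : ℕ) (poleSeries (ρ j) (p.time j) x))
            (-PowerSeries.coeff (l : ℕ) (poleSeries (ρ j) (p.time j) (z - p.pos j)
              * poleSeries (ρ j) (p.time j) (z - p.pos j))) (z - (p.pos j + 0)) := by
          rwa [add_zero]
        have h4 := h3.comp (0 : ℂ) h1
        exact h4.congr_deriv (by ring)
      · simp only [hk0, if_false, if_true, Function.update_self]
        exact hasDerivAt_coeff_poleSeries_time (ρ j) (p.time j) (by omega) hk hζ l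
    · have h1 : ∀ w, (if k = 0 then Function.update p.pos i (p.pos i + w) else p.pos) j = p.pos j := by
        intro w; split_ifs <;> simp [hj]
      have h2 : ∀ w, (if k = 0 then p.time else Function.update p.time i
          (Function.update (p.time i) k (p.time i k + w))) j = p.time j := by
        intro w; split_ifs <;> simp [hj]
      simp only [h1, h2, hj, if_false]
      exact hasDerivAt_const (0 : ℂ) _
  · exact hasDerivAt_const (0 : ℂ) (slotFun p (Sum.inr l : Slot ρ s) z)

theorem explicitDeriv_eq (p : Times n) (i : Fin n) {k : ℕ} (hk : k ≤ ρ i) (X : PhaseSpace m ρ s)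
    {z : ℂ} (hz : ∀ j, z ≠ p.pos j) (a b : Fin m) :
    explicitDeriv p i k X z a b = ∑ κ, slotDeriv p i k z κ * X (κ, a, b) := by
  rw [explicitDeriv]
  simp only [connection_apply]
  exact (HasDerivAt.fun_sum fun κ _ =>
    (hasDerivAt_slotFun_shift p i hk hz κ).mul_const (X (κ, a, b))).deriv

/-- Both `∂_z` of `x^k / (z - u - P)` and the parameter derivative of `1 / (z - u - P)` are `x^k /
(z - u - P)^2` up to sign. -/
theorem hasDerivAt_slotPart (p : Times n) (i : Fin n) (k : ℕ) {z : ℂ} (hz : ∀ j, z ≠ p.pos j)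
    (κ : Slot ρ s) :
    HasDerivAt (fun w => slotPart p i (PowerSeries.X ^ k) w κ) (-slotDeriv p i k z κ) z := by
  rcases κ with ⟨j, l⟩ | l
  · simp only [slotPart, slotDeriv]
    split_ifs with hj
    · have h := hasDerivAt_coeff_mul (φ := fun _ => (PowerSeries.X : PowerSeries ℂ) ^ k) (φ' := 0)
        (ψ := fun w => poleSeries (ρ j) (p.time j) (w - p.pos j))
        (ψ' := -(poleSeries (ρ j) (p.time j) (z - p.pos j)
          * poleSeries (ρ j) (p.time j) (z - p.pos j))) (w := z)
        (fun n => by rw [map_zero]; exact hasDerivAt_const _ _)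
        (fun n => by
          rw [map_neg]
          exact (hasDerivAt_coeff_poleSeries (ρ j) (p.time j)
            (sub_ne_zero.2 (hz j)) n).comp_sub_const z (p.pos j)) l
      simpa only [zero_mul, zero_add, mul_neg, map_neg] using h
    · simpa using hasDerivAt_const z (0 : ℂ)
  · simpa [slotPart, slotDeriv] using hasDerivAt_const z (0 : ℂ)

theorem tendsto_slotPart_cocompact (p : Times n) (i : Fin n) (k : ℕ) (κ : Slot ρ s) :
    Tendsto (fun z => slotPart p i (PowerSeries.X ^ k) z κ) (cocompact ℂ) (𝓝 0) := by
  rcases κ with ⟨j, l⟩ | l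
  · simp only [slotPart]
    split_ifs with hj
    · simp only [PowerSeries.coeff_X_pow_mul']
      split_ifs with hkl
      · simp only [coeff_poleSeries _ _ _ (Nat.lt_succ_self ((l : ℕ) - k))]
        rw [show (0 : ℂ) = ∑ a ∈ Finset.range ((l : ℕ) - k).succ,
          0 * (timePoly (ρ j) (p.time j) ^ a).coeff ((l : ℕ) - k) by simp]
        refine tendsto_finsetSum _ fun a _ => Tendsto.mul_const _ ?_
        have h1 : Tendsto (fun z : ℂ => z - p.pos j) (cocompact ℂ) (cocompact ℂ) :=
          (Homeomorph.subRight (p.pos j)).isClosedEmbedding.tendsto_cocompact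
        have h2 : Tendsto (fun z : ℂ => z⁻¹) (cocompact ℂ) (𝓝 0) := by
          rw [← Metric.cobounded_eq_cocompact]; exact tendsto_inv₀_cobounded
        have h3 := (h2.comp h1).pow (a + 1)
        simpa [Function.comp_def] using h3
      · exact tendsto_const_nhds
    · exact tendsto_const_nhds
  · exact tendsto_const_nhds

theorem isIsomonodromicHamiltonian_spectralHamiltonian {p : Times n} (hp : p.Admissible ρ s)
    (i : Fin n) {k : ℕ} (hk : k ≤ ρ i) :
    IsIsomonodromicHamiltonian p i k (spectralHamiltonian p i k : PhaseSpace m ρ s → ℂ) := by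
  refine ⟨differentiable_spectralHamiltonian hp.1 i hk,
    -- The sign makes `Ω` a primitive of the explicit derivative, and the bracket `[A, -Ω]` cancels
    -- `[A, Ω]`.
    fun X z => -∑ κ, slotPart p i (PowerSeries.X ^ k) z κ • slotMat X κ, ?_, ?_⟩
  · intro X a b
    simp only [Matrix.neg_apply, Matrix.sum_apply, Matrix.smul_apply, smul_eq_mul]
    rw [show (0 : ℂ) = -∑ κ : Slot ρ s, 0 * slotMat X κ a b by simp]
    exact (tendsto_finsetSum _ fun κ _ => (tendsto_slotPart_cocompact p i k κ).mul_const _).neg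
  · intro X z hz a b
    have hder : HasDerivAt
        (fun w => (-∑ κ, slotPart p i (PowerSeries.X ^ k) w κ • slotMat X κ) a b)
        (explicitDeriv p i k X z a b) z := by
      simp only [Matrix.neg_apply, Matrix.sum_apply, Matrix.smul_apply, smul_eq_mul]
      rw [explicitDeriv_eq p i hk X hz]
      have h1 := (HasDerivAt.fun_sum (u := Finset.univ) fun κ _ =>
        (hasDerivAt_slotPart (s := s) p i k hz κ).mul_const (slotMat X κ a b)).neg
      exact h1.congr_deriv (by simp [slotMat])
    refine ⟨hder, ?_⟩
    rw [hder.deriv, poisson_connection, sum_slotFun_smul_hamField_spectralHamiltonian hp i hk X hz,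
      mul_neg, neg_mul, Ring.lie_def]
    simp only [Matrix.sub_apply, Matrix.neg_apply]
    ring

/-- The complement of a finite set in the plane is connected, so `f` is constant there and equals
its limit at infinity. -/
theorem eq_zero_of_hasDerivAt_zero_of_tendsto {f : ℂ → ℂ} {S : Set ℂ} (hS : S.Finite)
    (hf : ∀ z ∉ S, HasDerivAt f 0 z) (h0 : Tendsto f (cocompact ℂ) (𝓝 0)) {z : ℂ} (hz : z ∉ S) :
    f z = 0 := by
  have hconn : IsPreconnected Sᶜ :=
    (hS.countable.isPathConnected_compl_of_one_lt_rank
      (by rw [Complex.rank_real_complex]; norm_num)).isConnected.isPreconnected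
  have hconst : ∀ w ∉ S, f w = f z := fun w hw =>
    hS.isClosed.isOpen_compl.is_const_of_deriv_eq_zero hconn
      (fun x hx => (hf x hx).differentiableAt.differentiableWithinAt)
      (fun x hx => (hf x hx).deriv) hw hz
  refine tendsto_nhds_unique (tendsto_const_nhds.congr' ?_) h0
  filter_upwards [hS.isCompact.compl_mem_cocompact] with w hw
  exact (hconst w hw).symm

/-- The normalisation at infinity makes `Ω` the same for both Hamiltonians; subtracting the zero
curvature equations leaves `{H - K, A(z)} = 0`. -/
theorem IsIsomonodromicHamiltonian.isCasimir_sub {p : Times n} (hp : p.Admissible ρ s) {i : Fin n}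
    {k : ℕ} {H K : PhaseSpace m ρ s → ℂ} (hH : IsIsomonodromicHamiltonian p i k H)
    (hK : IsIsomonodromicHamiltonian p i k K) : IsCasimir (fun X => H X - K X) := by
  obtain ⟨hHd, Ω, hΩ0, hΩ⟩ := hH
  obtain ⟨hKd, Ψ, hΨ0, hΨ⟩ := hK
  refine isCasimir_of_poisson_connection hp (hHd.sub hKd) fun X z hz c d => ?_
  have hz' : z ∉ Set.range p.pos := by rintro ⟨j, hj⟩; exact hz j hj.symm
  have hΩΨ : Ω X z = Ψ X z := by
    ext a b
    have := eq_zero_of_hasDerivAt_zero_of_tendsto (f := fun w => Ω X w a b - Ψ X w a b)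
      (Set.finite_range p.pos) (fun w hw => ?_) ?_ hz'
    · exact sub_eq_zero.1 this
    · have hw' : ∀ j, w ≠ p.pos j := fun j hj => hw ⟨j, hj.symm⟩
      exact ((hΩ X w hw' a b).1.sub (hΨ X w hw' a b).1).congr_deriv (sub_self _)
    · simpa using (hΩ0 X a b).sub (hΨ0 X a b)
  obtain ⟨h1, h2⟩ := hΩ X z hz c d
  obtain ⟨h3, h4⟩ := hΨ X z hz c d
  rw [h1.deriv] at h2
  rw [h3.deriv] at h4
  have h5 : poisson (fun X => H X - K X) (fun Y => connection p Y z c d) X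
      = poisson H (fun Y => connection p Y z c d) X
        - poisson K (fun Y => connection p Y z c d) X := by
    simp only [poisson_connection, hamField_sub (hHd X) (hKd X), smul_sub, Finset.sum_sub_distrib,
      Matrix.sub_apply]
  rw [h5]
  rw [hΩΨ] at h2
  linear_combination h2 - h4

end Isomonodromy

/-! ### Asymptotic expansions -/

/-- The asymptotic expansion `f(ε) ~ ∑_{j ≥ -d} c_j ε^j` of a scalar function as `ε → 0`. -/
def HasScalarExpansion (f : ℂ → ℂ) (d : ℕ) (c : ℤ → ℂ) : Prop :=
  ∀ N : ℕ, (fun ε : ℂ => f ε - ∑ j ∈ Finset.Ico (-(d : ℤ)) (N : ℤ), ε ^ j * c j)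
    =O[𝓝[≠] (0 : ℂ)] (fun ε : ℂ => ε ^ N)

theorem hasAsympExpansion_iff {m : ℕ} {f : ℂ → Matrix (Fin m) (Fin m) ℂ} {d : ℕ}
    {c : ℤ → Matrix (Fin m) (Fin m) ℂ} :
    HasAsympExpansion f d c ↔
      ∀ a b, HasScalarExpansion (fun ε => f ε a b) d (fun j => c j a b) :=
  ⟨fun h a b N => h N a b, fun h N a b => h a b N⟩

theorem isBigO_zpow_of_le {j : ℤ} {N : ℕ} (h : (N : ℤ) ≤ j) (c : ℂ) :
    (fun ε : ℂ => ε ^ j * c) =O[𝓝[≠] (0 : ℂ)] (fun ε : ℂ => ε ^ N) := by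
  obtain ⟨k, rfl⟩ := Int.le.dest h
  have h1 : (fun ε : ℂ => ε ^ N * (ε ^ k * c)) =O[𝓝[≠] (0 : ℂ)] (fun ε : ℂ => ε ^ N * 1) := by
    refine (isBigO_refl _ _).mul (Tendsto.isBigO_one ℂ (c := 0 ^ k * c) ?_)
    exact (Continuous.tendsto (by fun_prop) 0).mono_left nhdsWithin_le_nhds
  refine (h1.congr_right fun ε => mul_one _).congr_left fun ε => ?_
  rw [← mul_assoc, ← pow_add, ← zpow_natCast]
  push_cast
  rfl

/-- A higher order expansion implies a lower order one, since the additional terms are small. This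
gives freedom in the choice of the order when an expansion is multiplied by `ε^e`. -/
theorem hasScalarExpansion_of_frequently {f : ℂ → ℂ} {d : ℕ} {c : ℤ → ℂ}
    (h : ∀ N : ℕ, ∃ M : ℕ, N ≤ M ∧
      (fun ε : ℂ => f ε - ∑ j ∈ Finset.Ico (-(d : ℤ)) (M : ℤ), ε ^ j * c j)
        =O[𝓝[≠] (0 : ℂ)] (fun ε : ℂ => ε ^ M)) : HasScalarExpansion f d c := by
  intro N
  obtain ⟨M, hNM, hM⟩ := h N
  have hpow : (fun ε : ℂ => ε ^ M) =O[𝓝[≠] (0 : ℂ)] (fun ε : ℂ => ε ^ N) := by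
    have := isBigO_zpow_of_le (j := M) (N := N) (by exact_mod_cast hNM) 1
    simpa using this
  have hsum : (fun ε : ℂ => ∑ j ∈ Finset.Ico (N : ℤ) (M : ℤ), ε ^ j * c j)
      =O[𝓝[≠] (0 : ℂ)] (fun ε : ℂ => ε ^ N) :=
    IsBigO.fun_sum fun j hj => isBigO_zpow_of_le (Finset.mem_Ico.1 hj).1 _
  refine ((hM.trans hpow).add hsum).congr_left fun ε => ?_
  have hun : Finset.Ico (-(d : ℤ)) (M : ℤ)
      = Finset.Ico (-(d : ℤ)) (N : ℤ) ∪ Finset.Ico (N : ℤ) (M : ℤ) :=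
    (Finset.Ico_union_Ico_eq_Ico (by omega) (by exact_mod_cast hNM)).symm
  rw [hun, Finset.sum_union (Finset.Ico_disjoint_Ico_consecutive _ _ _)]
  ring

theorem HasScalarExpansion.add {f g : ℂ → ℂ} {d : ℕ} {c e : ℤ → ℂ} (hf : HasScalarExpansion f d c)
    (hg : HasScalarExpansion g d e) :
    HasScalarExpansion (fun ε => f ε + g ε) d (fun j => c j + e j) := by
  intro N
  refine ((hf N).add (hg N)).congr_left fun ε => ?_
  simp only [mul_add, Finset.sum_add_distrib]
  ring

theorem HasScalarExpansion.neg {f : ℂ → ℂ} {d : ℕ} {c : ℤ → ℂ} (hf : HasScalarExpansion f d c) :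
    HasScalarExpansion (fun ε => -f ε) d (fun j => -c j) := by
  intro N
  refine (hf N).neg_left.congr_left fun ε => ?_
  simp only [mul_neg, Finset.sum_neg_distrib]
  ring

theorem HasScalarExpansion.congr {f g : ℂ → ℂ} {d : ℕ} {c : ℤ → ℂ} (hf : HasScalarExpansion f d c)
    (h : ∀ ε, ε ≠ 0 → f ε = g ε) : HasScalarExpansion g d c := by
  intro N
  refine (hf N).congr' ?_ EventuallyEq.rfl
  filter_upwards [self_mem_nhdsWithin] with ε hε
  rw [h ε hε]

theorem HasScalarExpansion.zpow_mul {f : ℂ → ℂ} {d d' : ℕ} {c : ℤ → ℂ} (e : ℤ)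
    (hf : HasScalarExpansion f d c) (hd : (d' : ℤ) = d - e) :
    HasScalarExpansion (fun ε => ε ^ e * f ε) d' (fun j => c (j - e)) := by
  refine hasScalarExpansion_of_frequently fun N => ?_
  -- The target order is raised by `|e|` so that the order needed for `f` is nonnegative.
  obtain ⟨N', hN'⟩ : ∃ N' : ℕ, (N' : ℤ) = ((N + e.natAbs : ℕ) : ℤ) - e :=
    ⟨(((N + e.natAbs : ℕ) : ℤ) - e).toNat, Int.toNat_of_nonneg (by omega)⟩
  refine ⟨N + e.natAbs, Nat.le_add_right _ _, ?_⟩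
  have h1 := (isBigO_refl (fun ε : ℂ => ε ^ e) (𝓝[≠] (0 : ℂ))).mul (hf N')
  refine h1.congr' ?_ ?_
  · filter_upwards [self_mem_nhdsWithin] with ε hε
    have hε' : ε ≠ 0 := hε
    rw [mul_sub, Finset.mul_sum]
    congr 1
    refine Finset.sum_bij' (fun j _ => j + e) (fun j _ => j - e) ?_ ?_ ?_ ?_ ?_
    · intro j hj; rw [Finset.mem_Ico] at hj ⊢; omega
    · intro j hj; rw [Finset.mem_Ico] at hj ⊢; omega
    · intro j _; ring
    · intro j _; ring
    · intro j _
      rw [add_sub_cancel_right, zpow_add₀ hε']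
      ring
  · filter_upwards [self_mem_nhdsWithin] with ε hε
    have hε' : ε ≠ 0 := hε
    rw [← zpow_natCast, ← zpow_natCast, ← zpow_add₀ hε']
    congr 1
    omega

theorem HasScalarExpansion.of_coeff_eq_zero {f : ℂ → ℂ} {d d' : ℕ} {c : ℤ → ℂ}
    (hf : HasScalarExpansion f d c) (h : ∀ j < 0, (-(d : ℤ) ≤ j ∨ -(d' : ℤ) ≤ j) →
      ¬(-(d : ℤ) ≤ j ∧ -(d' : ℤ) ≤ j) → c j = 0) : HasScalarExpansion f d' c := by
  intro N
  refine (hf N).congr_left fun ε => ?_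
  congr 1
  rw [← Finset.sum_filter_add_sum_filter_not _ (fun j => -(d' : ℤ) ≤ j),
    Finset.sum_eq_zero (s := Finset.filter (fun j => ¬(-(d' : ℤ) ≤ j)) _), add_zero]
  · refine Finset.sum_subset (fun j hj => ?_) fun j hj hj' => ?_
    · simp only [Finset.mem_filter, Finset.mem_Ico] at hj ⊢; omega
    · simp only [Finset.mem_filter, Finset.mem_Ico] at hj hj'
      rw [h j (by omega) (by omega) (by omega), mul_zero]
  · intro j hj
    simp only [Finset.mem_filter, Finset.mem_Ico] at hj
    rw [h j (by omega) (by omega) (by omega), mul_zero]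

theorem HasScalarExpansion.tendsto {f : ℂ → ℂ} {c : ℤ → ℂ} (hf : HasScalarExpansion f 0 c) :
    Tendsto f (𝓝[≠] 0) (𝓝 (c 0)) := by
  have h1 := hf 1
  simp only [Nat.cast_zero, neg_zero, Nat.cast_one, pow_one] at h1
  rw [show Finset.Ico (0 : ℤ) 1 = {0} by decide] at h1
  simp only [Finset.sum_singleton, zpow_zero, one_mul] at h1
  have h2 : Tendsto (fun ε : ℂ => ε) (𝓝[≠] 0) (𝓝 0) := tendsto_id.mono_left nhdsWithin_le_nhds
  have h3 := (h1.trans_tendsto h2).add_const (c 0)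
  simpa using h3

theorem AnalyticAt.exists_hasScalarExpansion {f : ℂ → ℂ} (hf : AnalyticAt ℂ f 0) :
    ∃ c, HasScalarExpansion f 0 c ∧ ∀ j < 0, c j = 0 := by
  obtain ⟨q, hq⟩ := hf
  refine ⟨fun j => if j < 0 then 0 else q.coeff j.toNat, fun N => ?_, fun j hj => if_pos hj⟩
  have h1 := (hq.isBigO_sub_partialSum_pow N).mono (nhdsWithin_le_nhds (s := {0}ᶜ))
  refine (h1.congr_left fun ε => ?_).trans (IsBigO.of_norm_left ?_)
  · rw [zero_add, FormalMultilinearSeries.partialSum]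
    congr 1
    refine Finset.sum_bij' (fun k _ => (k : ℤ)) (fun j _ => j.toNat) ?_ ?_ ?_ ?_ ?_
    · intro k hk; rw [Finset.mem_range] at hk; rw [Finset.mem_Ico]; omega
    · intro j hj; rw [Finset.mem_Ico] at hj; rw [Finset.mem_range]; omega
    · intro k _; simp
    · intro j hj; rw [Finset.mem_Ico] at hj; omega
    · intro k _
      beta_reduce
      rw [if_neg (by omega), Int.toNat_natCast, zpow_natCast,
        FormalMultilinearSeries.apply_eq_pow_smul_coeff, smul_eq_mul]
  · refine (isBigO_refl (fun ε : ℂ => ε ^ N) _).norm_left.congr_left fun ε => ?_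
    simp

/-! ### The coordinates after a confluence -/

theorem Polynomial.exists_eval_eq_sum_add (f : Polynomial ℂ) (N : ℕ) :
    ∃ q : Polynomial ℂ, ∀ ε : ℂ,
      f.eval ε = ∑ k ∈ Finset.range N, ε ^ k * f.coeff k + ε ^ N * q.eval ε := by
  have hdvd : Polynomial.X ^ N ∣
      f - ∑ k ∈ Finset.range N, Polynomial.C (f.coeff k) * Polynomial.X ^ k := by
    refine Polynomial.X_pow_dvd_iff.2 fun a ha => ?_
    rw [Polynomial.coeff_sub, Polynomial.finsetSum_coeff]
    simp only [Polynomial.coeff_C_mul, Polynomial.coeff_X_pow]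
    rw [Finset.sum_eq_single a]
    · simp
    · intro c _ hc; simp [Ne.symm hc]
    · intro h; exact absurd (Finset.mem_range.2 ha) h
  obtain ⟨q, hq⟩ := hdvd
  refine ⟨q, fun ε => ?_⟩
  have h := congrArg (Polynomial.eval ε) hq
  rw [Polynomial.eval_sub, Polynomial.eval_finsetSum, sub_eq_iff_eq_add] at h
  rw [h]
  simp only [Polynomial.eval_mul, Polynomial.eval_C, Polynomial.eval_pow, Polynomial.eval_X]
  rw [add_comm]
  congr 1
  exact Finset.sum_congr rfl fun k _ => mul_comm _ _

/-- The error `1 / (ζ - P(ε)) - ∑_{k ≤ r} ε^k [x^k] (1 / (ζ - P(x)))`. -/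
noncomputable def confRem (r : ℕ) (t : ℕ → ℂ) (ε ζ : ℂ) : ℂ :=
  (ζ - confPoly r t ε)⁻¹
    - ∑ k ∈ Finset.range (r + 1), ε ^ k * PowerSeries.coeff k (poleSeries r t ζ)

theorem confPoly_continuous (r : ℕ) (t : ℕ → ℂ) : Continuous (confPoly r t) := by
  unfold confPoly; fun_prop

theorem confPoly_zero (r : ℕ) (t : ℕ → ℂ) : confPoly r t 0 = 0 := by
  rw [← eval_timePoly, ← Polynomial.coeff_zero_eq_eval_zero, coeff_timePoly]
  simp

theorem geom_sum_inv_sub {ζ P : ℂ} (hζ : ζ ≠ 0) (h : ζ - P ≠ 0) (N : ℕ) :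
    (ζ - P)⁻¹ = ∑ a ∈ Finset.range N, (ζ ^ (a + 1))⁻¹ * P ^ a
      + (ζ ^ N)⁻¹ * P ^ N * (ζ - P)⁻¹ := by
  induction N with
  | zero => simp
  | succ N ih =>
    rw [Finset.sum_range_succ]
    nth_rewrite 1 [ih]
    field_simp
    ring

/-- The error is `ε^(r+1)` times a function that is continuous in `(ε, ζ)` on a compact set, hence
bounded. -/
theorem exists_bound_confRem (r : ℕ) (t : ℕ → ℂ) {K : Set ℂ} (hK : IsCompact K) (h0 : 0 ∉ K) :
    ∃ M : ℝ, ∀ᶠ ε in 𝓝 (0 : ℂ), ∀ ζ ∈ K, ‖confRem r t ε ζ‖ ≤ M * ‖ε‖ ^ (r + 1) := by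
  choose q hq using fun a => Polynomial.exists_eval_eq_sum_add (timePoly r t ^ a) (r + 1)
  obtain ⟨δ, hδ, hδK⟩ : ∃ δ > 0, ∀ ζ ∈ K, δ ≤ ‖ζ‖ := by
    have := hK.isClosed.isOpen_compl.mem_nhds h0
    obtain ⟨δ, hδ, hb⟩ := Metric.mem_nhds_iff.1 this
    refine ⟨δ, hδ, fun ζ hζ => ?_⟩
    by_contra hlt
    exact hb (by simpa using hlt) hζ
  have hsmall : ∀ᶠ ε in 𝓝 (0 : ℂ), ‖confPoly r t ε‖ < δ := by
    have := (confPoly_continuous r t).norm.tendsto 0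
    rw [confPoly_zero, norm_zero] at this
    exact this.eventually_lt_const hδ
  obtain ⟨η, hη, hηs⟩ := Metric.eventually_nhds_iff.1 hsmall
  -- The first sum collects the Taylor remainders of the powers `P^a`, and the last term is the tail
  -- of the geometric series.
  set Θ : ℂ × ℂ → ℂ := fun x => ∑ a ∈ Finset.range (r + 1), (x.2 ^ (a + 1))⁻¹ * (q a).eval x.1
    + (x.2 ^ (r + 1))⁻¹ * (q (r + 1)).eval x.1 * (x.2 - confPoly r t x.1)⁻¹ with hΘ
  have hne : ∀ ε ∈ Metric.closedBall (0 : ℂ) (η / 2), ∀ ζ ∈ K,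
      ζ ≠ 0 ∧ ζ - confPoly r t ε ≠ 0 := by
    intro ε hε ζ hζ
    refine ⟨fun h => h0 (h ▸ hζ), fun h => ?_⟩
    have h1 := hηs (y := ε) (by rw [Metric.mem_closedBall] at hε; linarith)
    rw [← sub_eq_zero.1 h] at h1
    exact absurd (hδK ζ hζ) (not_le.2 h1)
  have hcont : ContinuousOn Θ (Metric.closedBall (0 : ℂ) (η / 2) ×ˢ K) := by
    have hc := confPoly_continuous r t
    refine ContinuousOn.add (continuousOn_finsetSum _ fun a _ => ContinuousOn.mul
      (ContinuousOn.inv₀ (by fun_prop) fun x hx => pow_ne_zero _ (hne x.1 hx.1 x.2 hx.2).1)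
      (by fun_prop)) (ContinuousOn.mul (ContinuousOn.mul
      (ContinuousOn.inv₀ (by fun_prop) fun x hx => pow_ne_zero _ (hne x.1 hx.1 x.2 hx.2).1)
      (by fun_prop)) (ContinuousOn.inv₀ (by fun_prop) fun x hx => (hne x.1 hx.1 x.2 hx.2).2))
  obtain ⟨M, hM⟩ := ((isCompact_closedBall (0 : ℂ) (η / 2)).prod hK).exists_bound_of_continuousOn
    hcont
  refine ⟨M, ?_⟩
  filter_upwards [Metric.closedBall_mem_nhds (0 : ℂ) (half_pos hη)] with ε hε ζ hζ
  obtain ⟨h1, h2⟩ := hne ε hε ζ hζ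
  have heq : confRem r t ε ζ = ε ^ (r + 1) * Θ (ε, ζ) := by
    have hP : ∀ a, confPoly r t ε ^ a = ∑ k ∈ Finset.range (r + 1),
        ε ^ k * (timePoly r t ^ a).coeff k + ε ^ (r + 1) * (q a).eval ε := by
      intro a
      rw [← hq a ε, Polynomial.eval_pow, eval_timePoly]
    have hP' : confPoly r t ε ^ (r + 1) = ε ^ (r + 1) * (q (r + 1)).eval ε := by
      rw [hP, Finset.sum_eq_zero, zero_add]
      intro k hk
      rw [coeff_timePoly_pow_of_lt _ _ (Finset.mem_range.1 hk), mul_zero]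
    have hc : ∑ k ∈ Finset.range (r + 1), ε ^ k * PowerSeries.coeff k (poleSeries r t ζ)
        = ∑ a ∈ Finset.range (r + 1), (ζ ^ (a + 1))⁻¹ * ∑ k ∈ Finset.range (r + 1),
          ε ^ k * (timePoly r t ^ a).coeff k := by
      rw [Finset.sum_congr rfl fun k hk => by
        rw [coeff_poleSeries r t ζ (Finset.mem_range.1 hk), Finset.mul_sum], Finset.sum_comm]
      refine Finset.sum_congr rfl fun a _ => ?_
      rw [Finset.mul_sum]
      exact Finset.sum_congr rfl fun k _ => by ring
    rw [confRem, hc, geom_sum_inv_sub h1 h2 (r + 1), hP', hΘ]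
    simp only [hP, mul_add, Finset.sum_add_distrib, Finset.mul_sum]
    rw [add_sub_right_comm, add_sub_cancel_left]
    congr 1
    · exact Finset.sum_congr rfl fun a _ => by ring
    · ring
  rw [heq, norm_mul, norm_pow, mul_comm]
  exact mul_le_mul_of_nonneg_right (hM (ε, ζ) ⟨hε, hζ⟩) (by positivity)

section Merge

variable {m n s : ℕ} {ρ : Fin n → ℕ}

theorem preRank_zero (ρ : Fin n → ℕ) (i : Fin n) : preRank ρ i 0 = 0 := rfl

theorem preRank_succ_self (ρ : Fin n → ℕ) (i : Fin n) : preRank ρ i i.succ = ρ i - 1 := by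
  simp [preRank]

theorem preRank_succ_of_ne (ρ : Fin n → ℕ) {i j : Fin n} (h : j ≠ i) :
    preRank ρ i j.succ = ρ j := by
  simp [preRank, h]

/-- The coordinates after a confluence, `A_k + ε^k C` at the pole at which the confluence takes
place. -/
def mergePoint (i : Fin n) (ε : ℂ) (Y : PhaseSpace m (preRank ρ i) s) : PhaseSpace m ρ s
  | (Sum.inl ⟨j, k⟩, a, b) =>
      coeffA Y j.succ k a b + if j = i then ε ^ (k : ℕ) * coeffA Y 0 0 a b else 0
  | (Sum.inr k, a, b) => coeffInf Y k a b

theorem connection_apply_range (p : Times n) (X : PhaseSpace m ρ s) (z : ℂ) (a b : Fin m) :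
    connection p X z a b
      = ∑ i, ∑ k ∈ Finset.range (ρ i + 1),
          PowerSeries.coeff k (poleSeries (ρ i) (p.time i) (z - p.pos i)) * coeffA X i k a b
        + ∑ k ∈ Finset.range s, PowerSeries.coeff (k + 1) (infSeries s p.timeInf z)
          * coeffInf X k a b := by
  rw [connection_apply, Fintype.sum_sum_type, Fintype.sum_sigma]
  simp only [Finset.sum_range, coeffA_fin, coeffInf_fin, slotFun, slotMat, Matrix.of_apply]

theorem coeff_poleSeries_pred {r : ℕ} (hr : 1 ≤ r) (t : ℕ → ℂ) (ζ : ℂ) {k : ℕ} (hk : k < r) :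
    PowerSeries.coeff k (poleSeries (r - 1) t ζ) = PowerSeries.coeff k (poleSeries r t ζ) := by
  rw [coeff_poleSeries _ _ _ hk, coeff_poleSeries _ _ _ hk]
  exact Finset.sum_congr rfl fun a _ => by rw [coeff_timePoly_pow_pred hr t a hk]

/-- Expanding `C / (z - u - P(ε))` up to order `ε^r` yields the slot functions of the rank `r` pole,
with coefficients `ε^k C`. Those of the rank `r - 1` pole are the same functions, with `A_r = 0`. -/
theorem connection_pre (p : Times n) {i : Fin n} (hi : 1 ≤ ρ i) (ε : ℂ)
    (Y : PhaseSpace m (preRank ρ i) s) (z : ℂ) (a b : Fin m) :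
    connection (p.pre ρ i ε) Y z a b = connection p (mergePoint i ε Y) z a b
      + confRem (ρ i) (p.time i) ε (z - p.pos i) * coeffA Y 0 0 a b := by
  have hfin : ∀ j : Fin n, ∑ k ∈ Finset.range (preRank ρ i j.succ + 1),
      PowerSeries.coeff k (poleSeries (preRank ρ i j.succ) (p.time j) (z - p.pos j))
        * coeffA Y j.succ k a b
      = ∑ k ∈ Finset.range (ρ j + 1), PowerSeries.coeff k (poleSeries (ρ j) (p.time j)
        (z - p.pos j)) * coeffA Y j.succ k a b := by
    intro j
    rcases eq_or_ne j i with rfl | hj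
    · have h0 : coeffA Y j.succ (ρ j) = 0 :=
        coeffA_of_lt Y (by rw [preRank_succ_self]; omega)
      rw [Finset.sum_range_succ _ (ρ j), h0, Matrix.zero_apply, mul_zero, add_zero,
        preRank_succ_self, show ρ j - 1 + 1 = ρ j by omega]
      refine Finset.sum_congr rfl fun k hk => ?_
      rw [coeff_poleSeries_pred hi _ _ (Finset.mem_range.1 hk)]
    · rw [preRank_succ_of_ne ρ hj]
  have hmerge : ∀ (j : Fin n) (k : ℕ), k < ρ j + 1 → coeffA (mergePoint i ε Y) j k a b
      = coeffA Y j.succ k a b + if j = i then ε ^ k * coeffA Y 0 0 a b else 0 := by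
    intro j k hk
    rw [coeffA, dif_pos hk]; rfl
  have hinf : ∀ k < s, coeffInf (mergePoint i ε Y) k a b = coeffInf Y k a b := by
    intro k hk
    rw [coeffInf, dif_pos hk]; rfl
  have hv : PowerSeries.coeff 0 (poleSeries 0 0 (z - (p.pos i + confPoly (ρ i) (p.time i) ε)))
      = (z - p.pos i - confPoly (ρ i) (p.time i) ε)⁻¹ := by
    rw [coeff_poleSeries _ _ _ Nat.zero_lt_one]
    simp [sub_sub]
  rw [connection_apply_range, connection_apply_range, Fin.sum_univ_succ]
  simp only [Times.pre, Fin.cons_succ, Fin.cons_zero, hfin, preRank_zero, zero_add,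
    Finset.sum_range_one, hv]
  have hA : ∑ j : Fin n, ∑ k ∈ Finset.range (ρ j + 1),
      PowerSeries.coeff k (poleSeries (ρ j) (p.time j) (z - p.pos j))
        * coeffA (mergePoint i ε Y) j k a b
      = ∑ j : Fin n, ∑ k ∈ Finset.range (ρ j + 1),
          PowerSeries.coeff k (poleSeries (ρ j) (p.time j) (z - p.pos j)) * coeffA Y j.succ k a b
        + ∑ j : Fin n, ∑ k ∈ Finset.range (ρ j + 1), (if j = i then
          PowerSeries.coeff k (poleSeries (ρ j) (p.time j) (z - p.pos j))
            * (ε ^ k * coeffA Y 0 0 a b) else 0) := by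
    simp only [← Finset.sum_add_distrib]
    refine Finset.sum_congr rfl fun j _ => Finset.sum_congr rfl fun k hk => ?_
    rw [hmerge j k (Finset.mem_range.1 hk), mul_add, mul_ite, mul_zero]
  have hB : ∑ k ∈ Finset.range s, PowerSeries.coeff (k + 1) (infSeries s p.timeInf z)
      * coeffInf (mergePoint i ε Y) k a b
      = ∑ k ∈ Finset.range s, PowerSeries.coeff (k + 1) (infSeries s p.timeInf z)
        * coeffInf Y k a b :=
    Finset.sum_congr rfl fun k hk => by rw [hinf k (Finset.mem_range.1 hk)]
  rw [hA, hB]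
  have hsum : ∑ j : Fin n, ∑ k ∈ Finset.range (ρ j + 1), (if j = i then
      PowerSeries.coeff k (poleSeries (ρ j) (p.time j) (z - p.pos j))
        * (ε ^ k * coeffA Y 0 0 a b) else 0)
      = (∑ k ∈ Finset.range (ρ i + 1), ε ^ k * PowerSeries.coeff k
        (poleSeries (ρ i) (p.time i) (z - p.pos i))) * coeffA Y 0 0 a b := by
    rw [Finset.sum_eq_single i]
    · simp only [if_true]
      rw [Finset.sum_mul]
      exact Finset.sum_congr rfl fun k _ => by ring
    · intro j _ hj; simp [hj]
    · simp
  rw [hsum, confRem]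
  ring

end Merge

section Confluence

variable {m n s : ℕ} {ρ : Fin n → ℕ}

/-! ### Convergence of the connection in a confluence -/

/-- The error of order `ε^(r+1)` exceeds the growth `ε^(-r)` of the residue by one power of `ε`. -/
theorem tendstoUniformlyOn_confRem_mul {r : ℕ} (t : ℕ → ℂ) {c : ℂ → ℂ} {L : ℂ}
    (hc : Tendsto (fun ε => ε ^ r * c ε) (𝓝[≠] 0) (𝓝 L)) {K : Set ℂ} (hK : IsCompact K) {u : ℂ}
    (hu : u ∉ K) :
    TendstoUniformlyOn (fun ε z => confRem r t ε (z - u) * c ε) (fun _ => 0) (𝓝[≠] 0) K := by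
  obtain ⟨M, hM⟩ := exists_bound_confRem r t (hK.image (f := fun z => z - u) (by fun_prop))
    (by rintro ⟨z, hz, h⟩; exact hu (sub_eq_zero.1 h ▸ hz))
  have h1 : Tendsto (fun ε : ℂ => M * (‖ε‖ * ‖ε ^ r * c ε‖)) (𝓝[≠] 0) (𝓝 0) := by
    have h2 : Tendsto (fun ε : ℂ => ‖ε‖) (𝓝[≠] 0) (𝓝 0) := by
      have := (continuous_norm (E := ℂ)).tendsto 0
      rw [norm_zero] at this
      exact this.mono_left nhdsWithin_le_nhds
    simpa using (h2.mul hc.norm).const_mul M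
  rw [Metric.tendstoUniformlyOn_iff]
  intro η hη
  filter_upwards [h1.eventually_lt_const hη, nhdsWithin_le_nhds hM] with ε h2 h3 z hz
  rw [dist_zero_left, norm_mul]
  refine lt_of_le_of_lt ?_ h2
  calc ‖confRem r t ε (z - u)‖ * ‖c ε‖ ≤ M * ‖ε‖ ^ (r + 1) * ‖c ε‖ :=
        mul_le_mul_of_nonneg_right (h3 _ ⟨z, hz, rfl⟩) (norm_nonneg _)
    _ = M * (‖ε‖ * ‖ε ^ r * c ε‖) := by rw [norm_mul, norm_pow]; ring

theorem tendstoUniformlyOn_connection_pre {p : Times n} {i : Fin n} (hi : 1 ≤ ρ i)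
    {γ : ℂ → PhaseSpace m (preRank ρ i) s} {X : PhaseSpace m ρ s} {a b : Fin m} {L : ℂ}
    (hC : Tendsto (fun ε => ε ^ ρ i * coeffA (γ ε) 0 0 a b) (𝓝[≠] 0) (𝓝 L))
    (hX : ∀ κ, Tendsto (fun ε => mergePoint i ε (γ ε) (κ, a, b)) (𝓝[≠] 0) (𝓝 (X (κ, a, b))))
    {K : Set ℂ} (hK : IsCompact K) (hpos : ∀ j, p.pos j ∉ K) :
    TendstoUniformlyOn (fun ε z => connection (p.pre ρ i ε) (γ ε) z a b)
      (fun z => connection p X z a b) (𝓝[≠] 0) K := by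
  have h1 := tendstoUniformlyOn_confRem_mul (p.time i) hC hK (hpos i)
  have h2 : ∀ S : Finset (Slot ρ s), TendstoLocallyUniformlyOn
      (fun ε z => ∑ κ ∈ S, slotFun p κ z * mergePoint i ε (γ ε) (κ, a, b))
      (fun z => ∑ κ ∈ S, slotFun p κ z * X (κ, a, b)) (𝓝[≠] 0) K := by
    intro S
    induction S using Finset.induction_on with
    | empty =>
      simp only [Finset.sum_empty]
      exact (tendsto_const_nhds.tendstoUniformlyOn_const K).tendstoLocallyUniformlyOn
    | insert κ S hκ ih =>
      simp only [Finset.sum_insert hκ]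
      refine TendstoLocallyUniformlyOn.add ?_ ih
      refine TendstoLocallyUniformlyOn.mul₀ ?_
        ((hX κ).tendstoUniformlyOn_const K).tendstoLocallyUniformlyOn ?_ continuousOn_const
      · intro V hV z _
        exact ⟨Set.univ, univ_mem, Eventually.of_forall fun _ _ _ => refl_mem_uniformity hV⟩
      · intro z hz
        exact (differentiableAt_slotFun p κ fun j _ _ h =>
          hpos j (h ▸ hz)).continuousAt.continuousWithinAt
  have h3 := ((tendstoLocallyUniformlyOn_iff_tendstoUniformlyOn_of_compact hK).1
    (h2 Finset.univ)).add h1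
  have e1 : (fun ε z => connection (p.pre ρ i ε) (γ ε) z a b)
      = (fun ε z => ∑ κ, slotFun p κ z * mergePoint i ε (γ ε) (κ, a, b))
        + fun ε z => confRem (ρ i) (p.time i) ε (z - p.pos i) * coeffA (γ ε) 0 0 a b := by
    funext ε z
    rw [connection_pre p hi, connection_apply]
    rfl
  have e2 : (fun z => connection p X z a b)
      = (fun z => ∑ κ, slotFun p κ z * X (κ, a, b)) + fun _ => 0 := by
    funext z
    rw [connection_apply]
    simp
  rw [e1, e2]
  exact h3

theorem IsConfluence.exists_tendsto_residue {p : Times n} {i : Fin n}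
    {γ : ℂ → PhaseSpace m (preRank ρ i) s} {X : PhaseSpace m ρ s} (h : IsConfluence p i γ X)
    (a b : Fin m) :
    ∃ L, Tendsto (fun ε => ε ^ ρ i * coeffA (γ ε) 0 0 a b) (𝓝[≠] 0) (𝓝 L) := by
  obtain ⟨⟨W, hW, -⟩, -⟩ := h
  have h1 := (hasAsympExpansion_iff.1 hW a b).zpow_mul (d' := 0) (ρ i) (by simp)
  simp only [zpow_natCast] at h1
  exact ⟨_, h1.tendsto⟩

/-- The prescribed singular part of `A_k` is the negative of that of `ε^k C`, so the sum has no
negative powers. For `k = r` the coordinate is `ε^r C`. -/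
theorem IsConfluence.exists_tendsto_mergePoint {p : Times n} {i : Fin n} (hi : 1 ≤ ρ i)
    {γ : ℂ → PhaseSpace m (preRank ρ i) s} {X : PhaseSpace m ρ s} (h : IsConfluence p i γ X)
    (x : CoordIdx m ρ s) :
    ∃ L, Tendsto (fun ε => mergePoint i ε (γ ε) x) (𝓝[≠] 0) (𝓝 L) := by
  obtain ⟨L, hL⟩ := h.exists_tendsto_residue x.2.1 x.2.2
  obtain ⟨⟨W, hW, hA⟩, hother, hinf, -⟩ := h
  obtain ⟨⟨j, k⟩ | k, a, b⟩ := x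
  · simp only [mergePoint]
    by_cases hj : j = i
    · subst hj
      simp only [if_true]
      rcases Nat.lt_or_ge k (ρ j) with hk | hk
      · obtain ⟨c, hc, hck⟩ := hA k hk
        have h1 := hasAsympExpansion_iff.1 hck a b
        have h2 := (hasAsympExpansion_iff.1 hW a b).zpow_mul (d' := ρ j - k) k
          (by rw [Nat.cast_sub hk.le])
        have h3 := (h1.add h2).of_coeff_eq_zero (d' := 0) fun l hl hl' _ => ?_
        · simp only [zpow_natCast] at h3
          exact ⟨_, h3.tendsto⟩
        · obtain ⟨l', rfl⟩ : ∃ l' : ℕ, l = -(l' : ℤ) := ⟨l.natAbs, by omega⟩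
          have h4 := hc l' (by omega) (by omega)
          simp only [h4, Matrix.neg_apply]
          rw [show -(l' : ℤ) - (k : ℕ) = -((k : ℕ) : ℤ) - l' by ring]
          ring
      · have hk' : (k : ℕ) = ρ j := by have := k.2; omega
        refine ⟨L, hL.congr fun ε => ?_⟩
        rw [coeffA_of_lt (γ ε) (i := j.succ) (k := k) (by rw [preRank_succ_self]; omega), hk']
        simp
    · simp only [hj, if_false, add_zero]
      obtain ⟨c, hc⟩ := hother j hj k (Nat.lt_succ_iff.1 k.2)
      exact ⟨_, (hasAsympExpansion_iff.1 hc a b).tendsto⟩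
  · obtain ⟨c, hc⟩ := hinf k k.2
    exact ⟨_, (hasAsympExpansion_iff.1 hc a b).tendsto⟩

/-- The limits exist, and the limit of the connections identifies them because the slot functions
are linearly independent. -/
theorem IsConfluence.tendsto_mergePoint {p : Times n} (hp : p.Admissible ρ s) {i : Fin n}
    (hi : 1 ≤ ρ i) {γ : ℂ → PhaseSpace m (preRank ρ i) s} {X : PhaseSpace m ρ s}
    (h : IsConfluence p i γ X) (x : CoordIdx m ρ s) :
    Tendsto (fun ε => mergePoint i ε (γ ε) x) (𝓝[≠] 0) (𝓝 (X x)) := by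
  choose X' hX' using h.exists_tendsto_mergePoint hi
  suffices X' = X by rw [← this]; exact hX' x
  have key : ∀ a b, (fun κ => X' (κ, a, b) - X (κ, a, b)) = 0 := by
    intro a b
    obtain ⟨L, hL⟩ := h.exists_tendsto_residue a b
    refine eq_zero_of_sum_slotFun_eq_zero hp _ fun z hz => ?_
    have h1 := tendstoUniformlyOn_connection_pre (p := p) hi hL (fun κ => hX' (κ, a, b))
      (isCompact_singleton (x := z)) fun j hj => hz j (Set.mem_singleton_iff.1 hj).symm
    have h2 := tendsto_nhds_unique (h1.tendsto_at (Set.mem_singleton z)) (h.2.2.2 z hz a b)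
    rw [connection_apply, connection_apply, ← sub_eq_zero, ← Finset.sum_sub_distrib] at h2
    rw [← h2]
    exact Finset.sum_congr rfl fun κ _ => by ring
  funext y
  obtain ⟨κ, a, b⟩ := y
  exact sub_eq_zero.1 (congrFun (key a b) κ)

theorem tendsto_confPoint (p : Times n) (i : Fin n) :
    Tendsto (fun ε => p.pos i + confPoly (ρ i) (p.time i) ε) (𝓝[≠] 0) (𝓝 (p.pos i)) := by
  have := ((confPoly_continuous (ρ i) (p.time i)).tendsto 0).const_add (p.pos i)
  rw [confPoly_zero, add_zero] at this
  exact this.mono_left nhdsWithin_le_nhds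

theorem Times.IsolatedAt.notMem_sphere {p : Times n} {j : Fin n} {R : ℝ} (h : p.IsolatedAt j R)
    (k : Fin n) : p.pos k ∉ Metric.sphere (p.pos j) R := by
  intro hk
  exact h.ne_pos (Metric.sphere_subset_closedBall hk) (ne_center_of_mem_sphere h.1 hk) k rfl

/-- The circle is kept fixed while the simple pole moves inside it or stays outside, so uniform
convergence on the circle is enough. -/
theorem IsConfluence.tendsto_contourMean {p : Times n} (hp : p.Admissible ρ s) {i : Fin n}
    (hi : 1 ≤ ρ i) {γ : ℂ → PhaseSpace m (preRank ρ i) s} {X : PhaseSpace m ρ s}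
    (h : IsConfluence p i γ X) {j : Fin n} {R : ℝ} (hR : p.IsolatedAt j R) (q : ℕ) :
    Tendsto (fun ε => (1 / 2) * contourMean (p.pos j) R (fun z => (z - p.pos j) ^ q *
      Matrix.trace (connection (p.pre ρ i ε) (γ ε) z * connection (p.pre ρ i ε) (γ ε) z)))
      (𝓝[≠] 0) (𝓝 (spectralInvariant p j q X)) := by
  rw [spectralInvariant_eq_contourMean hR]
  refine Tendsto.const_mul _ (Tendsto.const_mul _ ?_)
  have hK := isCompact_sphere (p.pos j) R
  have hentry : ∀ a b, TendstoLocallyUniformlyOn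
      (fun ε z => connection (p.pre ρ i ε) (γ ε) z a b) (fun z => connection p X z a b) (𝓝[≠] 0)
      (Metric.sphere (p.pos j) R) := fun a b => by
    obtain ⟨L, hL⟩ := h.exists_tendsto_residue a b
    exact (tendstoUniformlyOn_connection_pre hi hL (fun κ => h.tendsto_mergePoint hp hi (κ, a, b))
      hK hR.notMem_sphere).tendstoLocallyUniformlyOn
  have hcont : ∀ a b, ContinuousOn (fun z => connection p X z a b) (Metric.sphere (p.pos j) R) :=
    fun a b z hz => (connection_differentiableAt p X
      (fun k hk => hR.notMem_sphere k (hk ▸ hz)) a b).continuousAt.continuousWithinAt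
  have hprod : ∀ S : Finset (Fin m × Fin m), TendstoLocallyUniformlyOn
      (fun ε z => ∑ x ∈ S, connection (p.pre ρ i ε) (γ ε) z x.1 x.2
        * connection (p.pre ρ i ε) (γ ε) z x.2 x.1)
      (fun z => ∑ x ∈ S, connection p X z x.1 x.2 * connection p X z x.2 x.1) (𝓝[≠] 0)
      (Metric.sphere (p.pos j) R) := by
    intro S
    induction S using Finset.induction_on with
    | empty =>
      simp only [Finset.sum_empty]
      exact (tendsto_const_nhds.tendstoUniformlyOn_const _).tendstoLocallyUniformlyOn
    | insert x S hx ih =>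
      simp only [Finset.sum_insert hx]
      exact TendstoLocallyUniformlyOn.add (TendstoLocallyUniformlyOn.mul₀ (hentry _ _)
        (hentry _ _) (hcont _ _) (hcont _ _)) ih
  have htr : ∀ A : Matrix (Fin m) (Fin m) ℂ,
      Matrix.trace (A * A) = ∑ x : Fin m × Fin m, A x.1 x.2 * A x.2 x.1 := by
    intro A
    rw [Fintype.sum_prod_type]
    simp only [Matrix.trace, Matrix.diag_apply, Matrix.mul_apply]
  simp only [htr]
  refine TendstoUniformlyOn.tendsto_circleIntegral_of_continuousOn hR.1.le ?_ ?_
  · have hv : ∀ᶠ ε in 𝓝[≠] (0 : ℂ),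
        p.pos i + confPoly (ρ i) (p.time i) ε ∉ Metric.sphere (p.pos j) R :=
      (tendsto_confPoint p i).eventually
        (Metric.isClosed_sphere.isOpen_compl.mem_nhds (hR.notMem_sphere i))
    filter_upwards [hv] with ε hε
    refine ContinuousOn.mul (by fun_prop) (continuousOn_finsetSum _ fun x _ => ?_)
    have hc : ∀ a b, ContinuousOn (fun z => connection (p.pre ρ i ε) (γ ε) z a b)
        (Metric.sphere (p.pos j) R) := by
      intro a b z hz
      refine (connection_differentiableAt _ _ (fun k => ?_) a b).continuousAt.continuousWithinAt
      refine Fin.cases (fun h' => hε ?_) (fun k h' => hR.notMem_sphere k ?_) k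
      · rw [h'] at hz; exact hz
      · rw [h'] at hz; exact hz
    exact (hc _ _).mul (hc _ _)
  · refine (tendstoLocallyUniformlyOn_iff_tendstoUniformlyOn_of_compact hK).1 ?_
    refine TendstoLocallyUniformlyOn.mul₀ ?_ (hprod _) (by fun_prop)
      (continuousOn_finsetSum _ fun x _ => (hcont _ _).mul (hcont _ _))
    intro V hV z _
    exact ⟨Set.univ, univ_mem, Eventually.of_forall fun _ _ _ => refl_mem_uniformity hV⟩

/-! ### Residues at two poles -/

/-- A simple pole of `A` at `v` gives `Tr A²` a pole of order at most two there. Its residue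
contribution follows from the binomial expansion of `(z - u)^q` around `v`. -/
theorem contourMean_eq_spectralInvariant_add {N : ℕ} {ρ' : Fin N → ℕ} {p : Times N}
    (hp : Function.Injective p.pos) {i v : Fin N} (hv0 : ρ' v = 0) (hvi : v ≠ i) {R : ℝ}
    (hv : p.pos v ∈ Metric.ball (p.pos i) R)
    (hR : ∀ j, j ≠ i → j ≠ v → p.pos j ∉ Metric.closedBall (p.pos i) R) (q : ℕ)
    (X : PhaseSpace m ρ' s) :
    (1 / 2) * contourMean (p.pos i) R
        (fun z => (z - p.pos i) ^ q * Matrix.trace (connection p X z * connection p X z))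
      = spectralInvariant p i q X + ∑ a ∈ Finset.range (q + 1),
        (p.pos v - p.pos i) ^ (q - a) * (q.choose a : ℂ) * spectralInvariant p v a X := by
  set κ₀ : Slot ρ' s := Sum.inl ⟨v, 0⟩ with hκ₀
  set C := slotMat X κ₀ with hC
  set M : ℂ → Matrix (Fin m) (Fin m) ℂ := fun z =>
    ∑ κ ∈ Finset.univ.erase κ₀, slotFun p κ z • slotMat X κ with hM
  have hsplit : ∀ z, connection p X z = (z - p.pos v)⁻¹ • C + M z := by
    intro z
    have h1 : slotFun p κ₀ z = (z - p.pos v)⁻¹ := by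
      rw [hκ₀]
      simp only [slotFun, Fin.val_zero]
      rw [coeff_poleSeries _ _ _ Nat.zero_lt_one]
      simp
    rw [connection_eq, ← Finset.add_sum_erase _ _ (Finset.mem_univ κ₀), h1]
  have hMd : ∀ z ∈ Metric.closedBall (p.pos i) R, z ≠ p.pos i → ∀ a b,
      DifferentiableAt ℂ (fun w => M w a b) z := by
    intro z hz hzi a b
    simp only [hM, Matrix.sum_apply, Matrix.smul_apply, smul_eq_mul]
    refine DifferentiableAt.fun_sum fun κ hκ => DifferentiableAt.mul_const ?_ _
    refine differentiableAt_slotFun p κ fun j k hjk hzj => ?_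
    rcases eq_or_ne j i with rfl | hji
    · exact hzi hzj
    · rcases eq_or_ne j v with rfl | hjv
      · refine Finset.ne_of_mem_erase hκ ?_
        rw [hjk, hκ₀]
        have : k = 0 := Fin.ext (by have := k.2; simp only [Fin.val_zero]; omega)
        rw [this]
      · exact hR j hji hjv (hzj ▸ hz)
  set F : ℂ → ℂ := fun z =>
    (z - p.pos i) ^ q * Matrix.trace (connection p X z * connection p X z) with hF
  set G : ℂ → ℂ := fun z => (z - p.pos i) ^ q *
    Matrix.trace ((C + (z - p.pos v) • M z) * (C + (z - p.pos v) • M z)) with hG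
  have h2 := contourMean_eq_residueAt_add_residueAt (F := F) (G := G) hv
    (fun h => hvi (hp h)) (fun z hz hzi => ?_) (fun z hzi hzv => ?_)
  · rw [h2, mul_add]
    congr 1
    obtain ⟨r, -, hr⟩ := Times.exists_isolatedAt hp v one_pos
    have hexp : ∀ z, F z = ∑ a ∈ Finset.range (q + 1),
        ((p.pos v - p.pos i) ^ (q - a) * (q.choose a : ℂ)) * ((z - p.pos v) ^ a
          * Matrix.trace (connection p X z * connection p X z)) := by
      intro z
      rw [hF]
      beta_reduce
      rw [show z - p.pos i = (z - p.pos v) + (p.pos v - p.pos i) by ring, add_pow, Finset.sum_mul]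
      exact Finset.sum_congr rfl fun a _ => by ring
    have hTd : ∀ z ∈ Metric.closedBall (p.pos v) r, z ≠ p.pos v → DifferentiableAt ℂ
        (fun z => Matrix.trace (connection p X z * connection p X z)) z := fun z hz hz' =>
      trace_sq_differentiableAt p X (hr.ne_pos hz hz')
    rw [residueAt_eq_contourMean (f := F) hr.1 fun z hz hz' =>
      DifferentiableAt.mul (by fun_prop) (hTd z hz hz'),
      contourMean_congr hr.1.le fun z _ => hexp z, contourMean_sum hr.1.le, Finset.mul_sum]
    · refine Finset.sum_congr rfl fun a _ => ?_
      rw [spectralInvariant_eq_contourMean hr]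
      ring
    · intro a _ z hz
      exact (DifferentiableAt.mul (by fun_prop) (hTd z (Metric.sphere_subset_closedBall hz)
        (ne_center_of_mem_sphere hr.1 hz))).continuousAt.continuousWithinAt
  · refine DifferentiableAt.mul (by fun_prop) ?_
    simp only [Matrix.trace, Matrix.diag_apply, Matrix.mul_apply, Matrix.add_apply,
      Matrix.smul_apply, smul_eq_mul]
    have h3 : ∀ a b, DifferentiableAt ℂ (fun w => C a b + (w - p.pos v) * M w a b) z :=
      fun a b => (DifferentiableAt.mul (by fun_prop) (hMd z hz hzi a b)).const_add _
    exact DifferentiableAt.fun_sum fun a _ => DifferentiableAt.fun_sum fun b _ =>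
      (h3 a b).mul (h3 b a)
  · have h4 : z - p.pos v ≠ 0 := sub_ne_zero.2 hzv
    have h5 : connection p X z = (z - p.pos v)⁻¹ • (C + (z - p.pos v) • M z) := by
      rw [hsplit, smul_add, smul_smul, inv_mul_cancel₀ h4, one_smul]
    rw [hF, hG]
    beta_reduce
    rw [h5, smul_mul_smul_comm, Matrix.trace_smul, smul_eq_mul]
    field_simp

end Confluence

section RegularizedLimit

variable {m n s : ℕ} {ρ : Fin n → ℕ}

/-! ### Regularised limits along confluences -/

/-- The functions `h ε`, after the addition of Casimirs that depend on `ε` only, tend to `L` along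
all confluences; `U` is the set of parameters for which the added functions are Casimirs. -/
def HasRegularizedLimit (p : Times n) (i : Fin n) (U : Set ℂ)
    (h : ℂ → PhaseSpace m (preRank ρ i) s → ℂ) (L : PhaseSpace m ρ s → ℂ) : Prop :=
  ∃ c : ℂ → PhaseSpace m (preRank ρ i) s → ℂ, (∀ ε ∈ U, IsCasimir (c ε)) ∧
    ∀ γ X, IsConfluence p i γ X →
      Tendsto (fun ε => h ε (γ ε) + c ε (γ ε)) (𝓝[≠] 0) (𝓝 (L X))

variable {p : Times n} {i : Fin n} {U : Set ℂ}

theorem HasRegularizedLimit.add {h h' : ℂ → PhaseSpace m (preRank ρ i) s → ℂ}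
    {L L' : PhaseSpace m ρ s → ℂ} (H : HasRegularizedLimit p i U h L)
    (H' : HasRegularizedLimit p i U h' L') :
    HasRegularizedLimit p i U (fun ε Y => h ε Y + h' ε Y) (fun X => L X + L' X) := by
  obtain ⟨c, hc, hl⟩ := H
  obtain ⟨c', hc', hl'⟩ := H'
  refine ⟨fun ε Y => c ε Y + c' ε Y, fun ε hε => (hc ε hε).add (hc' ε hε), fun γ X hγ => ?_⟩
  exact ((hl γ X hγ).add (hl' γ X hγ)).congr fun ε => by ring

theorem HasRegularizedLimit.mul {h : ℂ → PhaseSpace m (preRank ρ i) s → ℂ}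
    {L : PhaseSpace m ρ s → ℂ} (H : HasRegularizedLimit p i U h L) {α : ℂ → ℂ} {a : ℂ}
    (hα : Tendsto α (𝓝[≠] 0) (𝓝 a)) :
    HasRegularizedLimit p i U (fun ε Y => α ε * h ε Y) (fun X => a * L X) := by
  obtain ⟨c, hc, hl⟩ := H
  refine ⟨fun ε Y => α ε * c ε Y, fun ε hε => (hc ε hε).const_mul _, fun γ X hγ => ?_⟩
  exact (hα.mul (hl γ X hγ)).congr fun ε => by ring

theorem HasRegularizedLimit.congr_add_casimir (hU : U ∈ 𝓝[≠] (0 : ℂ))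
    {h h' d : ℂ → PhaseSpace m (preRank ρ i) s → ℂ}
    {L : PhaseSpace m ρ s → ℂ} (H : HasRegularizedLimit p i U h L)
    (hd : ∀ ε ∈ U, IsCasimir (d ε)) (heq : ∀ ε ∈ U, ∀ Y, h ε Y = h' ε Y + d ε Y) :
    HasRegularizedLimit p i U h' L := by
  obtain ⟨c, hc, hl⟩ := H
  refine ⟨fun ε Y => c ε Y + d ε Y, fun ε hε => (hc ε hε).add (hd ε hε), fun γ X hγ => ?_⟩
  refine (hl γ X hγ).congr' ?_
  filter_upwards [hU] with ε hε
  rw [heq ε hε]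
  ring

theorem HasRegularizedLimit.congr (hU : U ∈ 𝓝[≠] (0 : ℂ))
    {h h' : ℂ → PhaseSpace m (preRank ρ i) s → ℂ}
    {L : PhaseSpace m ρ s → ℂ} (H : HasRegularizedLimit p i U h L)
    (heq : ∀ ε ∈ U, ∀ Y, h ε Y = h' ε Y) : HasRegularizedLimit p i U h' L :=
  H.congr_add_casimir hU (d := fun _ _ => 0) (fun _ _ => isCasimir_zero)
    fun ε hε Y => by rw [heq ε hε Y, add_zero]

theorem HasRegularizedLimit.sum {ι : Type*} (S : Finset ι) (b : ι → ℂ)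
    {h : ι → ℂ → PhaseSpace m (preRank ρ i) s → ℂ} {L : ι → PhaseSpace m ρ s → ℂ}
    (H : ∀ q ∈ S, HasRegularizedLimit p i U (h q) (L q)) :
    HasRegularizedLimit p i U (fun ε Y => ∑ q ∈ S, b q * h q ε Y)
      (fun X => ∑ q ∈ S, b q * L q X) := by
  classical
  induction S using Finset.induction_on with
  | empty =>
    refine ⟨fun _ _ => 0, fun _ _ => isCasimir_zero, fun γ X _ => ?_⟩
    simp
  | insert q S hq ih =>
    simp only [Finset.sum_insert hq]
    exact ((H q (Finset.mem_insert_self q S)).mul tendsto_const_nhds).add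
      (ih fun j hj => H j (Finset.mem_insert_of_mem hj))

/-! ### The parameters before a confluence -/

/-- The parameters `ε` for which the parameters before the confluence are admissible, the new pole
lies in the disc of radius `R i` around the `i`-th pole, and outside the closed discs of radius
`R j` around the other poles. -/
def confDomain (p : Times n) (ρ : Fin n → ℕ) (s : ℕ) (i : Fin n) (R : Fin n → ℝ) : Set ℂ :=
  {ε | confPoly (ρ i) (p.time i) ε ≠ 0 ∧ (p.pre ρ i ε).Admissible (preRank ρ i) s ∧
    p.pos i + confPoly (ρ i) (p.time i) ε ∈ Metric.ball (p.pos i) (R i) ∧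
    ∀ j, j ≠ i → p.pos i + confPoly (ρ i) (p.time i) ε ∉ Metric.closedBall (p.pos j) (R j)}

theorem exists_confPoly_eq_mul {r : ℕ} (hr : 1 ≤ r) (t : ℕ → ℂ) :
    ∃ q : Polynomial ℂ, q.eval 0 = t 1 ∧ ∀ ε, confPoly r t ε = ε * q.eval ε := by
  obtain ⟨q, hq⟩ := X_dvd_timePoly r t
  refine ⟨q, ?_, fun ε => by rw [← eval_timePoly, hq, Polynomial.eval_mul, Polynomial.eval_X]⟩
  have := coeff_timePoly r t 1
  rw [hq, Polynomial.coeff_X_mul, Polynomial.coeff_zero_eq_eval_zero] at this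
  simpa [hr] using this

/-- Here `t_1 ≠ 0` is used: `P(ε) = ε (t_1 + O(ε))` does not vanish for small nonzero `ε`, so the
colliding poles are distinct. -/
theorem confDomain_mem_nhds (hp : p.Admissible ρ s) (hi : 1 ≤ ρ i) {R : Fin n → ℝ}
    (hR : ∀ j, p.IsolatedAt j (R j)) : confDomain p ρ s i R ∈ 𝓝[≠] (0 : ℂ) := by
  have hne : ∀ᶠ ε in 𝓝[≠] (0 : ℂ), confPoly (ρ i) (p.time i) ε ≠ 0 := by
    obtain ⟨q, hq0, hq⟩ := exists_confPoly_eq_mul hi (p.time i)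
    have h1 : ∀ᶠ ε in 𝓝[≠] (0 : ℂ), q.eval ε ≠ 0 :=
      (q.continuous.tendsto 0).mono_left nhdsWithin_le_nhds |>.eventually_ne
        (by rw [hq0]; exact hp.2.1 i hi)
    filter_upwards [h1, self_mem_nhdsWithin] with ε h2 h3
    rw [hq]
    exact mul_ne_zero h3 h2
  have hball : ∀ᶠ ε in 𝓝[≠] (0 : ℂ),
      p.pos i + confPoly (ρ i) (p.time i) ε ∈ Metric.ball (p.pos i) (R i) :=
    (tendsto_confPoint p i).eventually (Metric.ball_mem_nhds _ (hR i).1)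
  have hout : ∀ᶠ ε in 𝓝[≠] (0 : ℂ), ∀ j, j ≠ i →
      p.pos i + confPoly (ρ i) (p.time i) ε ∉ Metric.closedBall (p.pos j) (R j) := by
    rw [eventually_all]
    intro j
    by_cases hj : j = i
    · simp [hj]
    · have := (tendsto_confPoint (ρ := ρ) p i).eventually
        (Metric.isClosed_closedBall.isOpen_compl.mem_nhds ((hR j).2 i (Ne.symm hj)))
      filter_upwards [this] with ε hε _ using hε
  filter_upwards [hne, hball, hout] with ε h1 h2 h3
  refine ⟨h1, ⟨?_, ?_, hp.2.2⟩, h2, h3⟩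
  · refine Fin.cons_injective_iff.2 ⟨?_, hp.1⟩
    rintro ⟨j, hj⟩
    rcases eq_or_ne j i with rfl | hji
    · exact h1 (by simpa using hj.symm)
    · exact h3 j hji (hj ▸ Metric.mem_closedBall_self (hR j).1.le)
  · intro j
    refine Fin.cases (fun h => ?_) (fun j h => ?_) j
    · rw [preRank_zero] at h; omega
    · refine hp.2.1 j ?_
      rcases eq_or_ne j i with rfl | hji
      · exact hi
      · rwa [preRank_succ_of_ne ρ hji] at h

theorem spectralHamiltonian_eq_of_rank_eq {p : Times n} {i : Fin n} {r : ℕ} (hr : ρ i = r) (k : ℕ)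
    (X : PhaseSpace m ρ s) :
    spectralHamiltonian p i (k + 1) X = if h : k < r then ((monomMatrix r (p.time i))⁻¹).mulVec
      (fun l : Fin r => spectralInvariant p i ((l : ℕ) + 1) X) ⟨k, h⟩ else 0 := by
  subst hr
  rfl

/-- `𝓜^{(r-1)}` is the leading block of `𝓜^{(r)}`, and the last row of the latter vanishes off the
diagonal. On vectors with last entry zero, `𝓜^{(r)}` thus undoes the inverse of the smaller matrix.
-/
theorem sum_monomMatrix_mul_pred {r : ℕ} (hr : 1 ≤ r) {t : ℕ → ℂ} (ht : t 1 ≠ 0) (S : ℕ → ℂ)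
    (q : Fin r) :
    ∑ k : Fin r, monomMatrix r t q k * (if h : (k : ℕ) < r - 1 then
        ((monomMatrix (r - 1) t)⁻¹).mulVec (fun l : Fin (r - 1) => S ((l : ℕ) + 1)) ⟨k, h⟩ else 0)
      = if (q : ℕ) + 1 < r then S ((q : ℕ) + 1) else 0 := by
  obtain ⟨r, rfl⟩ : ∃ r', r = r' + 1 := ⟨r - 1, by omega⟩
  simp only [Nat.add_sub_cancel]
  rw [Fin.sum_univ_castSucc]
  simp only [Fin.val_last, lt_self_iff_false, dif_neg, not_false_eq_true, mul_zero, add_zero,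
    Fin.val_castSucc, Fin.is_lt, dif_pos, Fin.eta]
  refine Fin.lastCases ?_ (fun q => ?_) q
  · rw [Fin.val_last, if_neg (lt_irrefl _)]
    refine Finset.sum_eq_zero fun k _ => ?_
    rw [monomMatrix, Matrix.of_apply, monom_eq_coeff, coeff_timePoly_pow_of_lt, zero_mul]
    simp
  · rw [Fin.val_castSucc, if_pos (by omega)]
    have h1 : ∀ k : Fin r, monomMatrix (r + 1) t q.castSucc k.castSucc = monomMatrix r t q k := by
      intro k
      simp only [monomMatrix, Matrix.of_apply, monom_eq_coeff, Fin.val_castSucc]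
      have := coeff_timePoly_pow_pred hr t ((q : ℕ) + 1) (j := (k : ℕ) + 1) (by omega)
      rw [Nat.add_sub_cancel] at this
      exact this.symm
    simp only [h1]
    have h2 := congrFun (Matrix.mulVec_mulVec (fun l : Fin r => S ((l : ℕ) + 1))
      (monomMatrix r t) (monomMatrix r t)⁻¹) q
    rw [Matrix.mul_nonsing_inv _ (isUnit_det_monomMatrix fun _ => ht), Matrix.one_mulVec] at h2
    exact h2

/-! ### The confluence of the spectral invariants -/

variable {R : Fin n → ℝ}

theorem hasRegularizedLimit_spectralInvariant_of_ne (hp : p.Admissible ρ s) (hi : 1 ≤ ρ i)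
    (hR : ∀ j, p.IsolatedAt j (R j)) {j : Fin n} (hj : j ≠ i) (q : ℕ) :
    HasRegularizedLimit (m := m) (s := s) (ρ := ρ) p i (confDomain p ρ s i R)
      (fun ε Y => spectralInvariant (p.pre ρ i ε) j.succ q Y) (spectralInvariant p j q) := by
  refine ⟨fun _ _ => 0, fun _ _ => isCasimir_zero, fun γ X hγ => ?_⟩
  refine (hγ.tendsto_contourMean hp hi (hR j) q).congr' ?_
  filter_upwards [confDomain_mem_nhds hp hi hR] with ε hε
  have hiso : (p.pre ρ i ε).IsolatedAt j.succ (R j) := by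
    refine ⟨(hR j).1, fun k => ?_⟩
    refine Fin.cases (fun _ => hε.2.2.2 j hj) (fun k hk => ?_) k
    exact (hR j).2 k fun h => hk (by rw [h])
  rw [spectralInvariant_eq_contourMean hiso, add_zero]
  rfl

theorem hasRegularizedLimit_spectralInvariant_add (hp : p.Admissible ρ s) (hi : 1 ≤ ρ i)
    (hR : ∀ j, p.IsolatedAt j (R j)) (q : ℕ) :
    HasRegularizedLimit (m := m) (s := s) (ρ := ρ) p i (confDomain p ρ s i R)
      (fun ε Y => spectralInvariant (p.pre ρ i ε) i.succ q Y
        + confPoly (ρ i) (p.time i) ε ^ q * spectralInvariant (p.pre ρ i ε) 0 0 Y)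
      (spectralInvariant p i q) := by
  -- The binomial terms with positive index are Casimirs, because the pole `v` has rank zero.
  refine ⟨fun ε Y => ∑ a ∈ Finset.range q, confPoly (ρ i) (p.time i) ε ^ (q - (a + 1))
    * (q.choose (a + 1) : ℂ) * spectralInvariant (p.pre ρ i ε) 0 (a + 1) Y, fun ε hε => ?_,
    fun γ X hγ => ?_⟩
  · refine IsCasimir.sum _ fun a _ => IsCasimir.const_mul ?_ _
    exact isCasimir_spectralInvariant hε.2.1 (by rw [preRank_zero]; omega)
  · refine (hγ.tendsto_contourMean hp hi (hR i) q).congr' ?_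
    filter_upwards [confDomain_mem_nhds hp hi hR] with ε hε
    have h1 := contourMean_eq_spectralInvariant_add (p := p.pre ρ i ε) hε.2.1.1 (i := i.succ)
      (v := 0) (preRank_zero ρ i) (Fin.succ_ne_zero i).symm (R := R i) hε.2.2.1
      (fun j => Fin.cases (fun _ h => absurd rfl h)
        (fun j hj _ => (hR i).2 j fun h => hj (by rw [h])) j) q (γ ε)
    have h2 : (p.pre ρ i ε).pos 0 - (p.pre ρ i ε).pos i.succ = confPoly (ρ i) (p.time i) ε :=
      add_sub_cancel_left _ _
    rw [h2, Finset.sum_range_succ'] at h1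
    refine Eq.trans h1 ?_
    simp only [Nat.sub_zero, Nat.choose_zero_right, Nat.cast_one, mul_one]
    ring

/-- Before the confluence the pole `u_i` has rank `r - 1`, so its invariant of index `r` is a
Casimir and can be dropped. -/
theorem hasRegularizedLimit_pow_mul_spectralInvariant (hp : p.Admissible ρ s) (hi : 1 ≤ ρ i)
    (hR : ∀ j, p.IsolatedAt j (R j)) :
    HasRegularizedLimit (m := m) (s := s) (ρ := ρ) p i (confDomain p ρ s i R)
      (fun ε Y => confPoly (ρ i) (p.time i) ε ^ ρ i * spectralInvariant (p.pre ρ i ε) 0 0 Y)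
      (spectralInvariant p i (ρ i)) :=
  (hasRegularizedLimit_spectralInvariant_add hp hi hR (ρ i)).congr_add_casimir
    (confDomain_mem_nhds hp hi hR) (d := fun ε => spectralInvariant (p.pre ρ i ε) i.succ (ρ i))
    (fun ε hε => isCasimir_spectralInvariant hε.2.1 (by rw [preRank_succ_self]; omega))
    fun ε _ Y => add_comm _ _

/-- Powers of `ε` above `r` in `P(ε)^(q+1)` may be discarded: they are `o(1)` times `P(ε)^r`, and
`P(ε)^r H_v` has a regularised limit. -/
theorem hasRegularizedLimit_monom_mul_merged (hp : p.Admissible ρ s) (hi : 1 ≤ ρ i)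
    (hR : ∀ j, p.IsolatedAt j (R j)) (q : Fin (ρ i)) :
    HasRegularizedLimit (m := m) (s := s) (ρ := ρ) p i (confDomain p ρ s i R)
      (fun ε Y => (if (q : ℕ) + 1 < ρ i then
          spectralInvariant (p.pre ρ i ε) i.succ ((q : ℕ) + 1) Y else 0)
        + (∑ k : Fin (ρ i), monomMatrix (ρ i) (p.time i) q k * ε ^ ((k : ℕ) + 1))
          * spectralInvariant (p.pre ρ i ε) 0 0 Y)
      (spectralInvariant p i ((q : ℕ) + 1)) := by
  have hU := confDomain_mem_nhds hp hi hR
  obtain ⟨g, hg⟩ := Polynomial.exists_eval_eq_sum_add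
    (timePoly (ρ i) (p.time i) ^ ((q : ℕ) + 1)) (ρ i + 1)
  obtain ⟨f, hf0, hf⟩ := exists_confPoly_eq_mul hi (p.time i)
  have hsum : ∀ ε : ℂ, confPoly (ρ i) (p.time i) ε ^ ((q : ℕ) + 1)
      = ∑ k : Fin (ρ i), monomMatrix (ρ i) (p.time i) q k * ε ^ ((k : ℕ) + 1)
        + ε ^ (ρ i + 1) * g.eval ε := by
    intro ε
    rw [← eval_timePoly, ← Polynomial.eval_pow, hg ε, Finset.sum_range_succ',
      coeff_timePoly_pow_of_lt _ _ (Nat.succ_pos _), mul_zero, add_zero, Finset.sum_range]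
    congr 1
    refine Finset.sum_congr rfl fun k _ => ?_
    rw [monomMatrix, Matrix.of_apply, monom_eq_coeff, mul_comm]
  -- With `P(ε) = ε f(ε)`, this is minus the quotient of the tail `ε^(r+1) g(ε)` by `P(ε)^r`.
  have hα : Tendsto (fun ε : ℂ => -(ε * g.eval ε / f.eval ε ^ ρ i)) (𝓝[≠] 0) (𝓝 0) := by
    have hc : ContinuousAt (fun ε : ℂ => -(ε * g.eval ε / f.eval ε ^ ρ i)) 0 := by
      refine ContinuousAt.neg (ContinuousAt.div (by fun_prop) (by fun_prop) ?_)
      rw [hf0]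
      exact pow_ne_zero _ (hp.2.1 i hi)
    have := hc.tendsto
    simp only [zero_mul, zero_div, neg_zero] at this
    exact this.mono_left nhdsWithin_le_nhds
  have h1 := (hasRegularizedLimit_spectralInvariant_add (m := m) (s := s) (ρ := ρ) hp hi hR
    ((q : ℕ) + 1)).add ((hasRegularizedLimit_pow_mul_spectralInvariant hp hi hR).mul hα)
  simp only [zero_mul, add_zero] at h1
  refine h1.congr_add_casimir hU (d := fun ε Y => if (q : ℕ) + 1 < ρ i then 0 else
    spectralInvariant (p.pre ρ i ε) i.succ ((q : ℕ) + 1) Y) (fun ε hε => ?_) fun ε hε Y => ?_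
  · split_ifs with hq
    · exact isCasimir_zero
    · exact isCasimir_spectralInvariant hε.2.1 (by rw [preRank_succ_self]; omega)
  · have hne := hε.1
    rw [hf] at hne
    have hf' : f.eval ε ≠ 0 := right_ne_zero_of_mul hne
    have h2 : -(ε * g.eval ε / f.eval ε ^ ρ i)
        * (confPoly (ρ i) (p.time i) ε ^ ρ i * spectralInvariant (p.pre ρ i ε) 0 0 Y)
        = -(ε ^ (ρ i + 1) * g.eval ε) * spectralInvariant (p.pre ρ i ε) 0 0 Y := by
      rw [hf, mul_pow]
      field_simp
      ring
    rw [h2, hsum ε]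
    split_ifs <;> ring

/-- The spectral Hamiltonians before a confluence, regularised by Casimirs, tend to the spectral
Hamiltonians after it. -/
theorem hasRegularizedLimit_mergedHamiltonian (hp : p.Admissible ρ s) (hi : 1 ≤ ρ i)
    (hR : ∀ j, p.IsolatedAt j (R j)) (j : Fin n) {k : ℕ} (hk : k ≤ ρ j) :
    HasRegularizedLimit (m := m) (s := s) (ρ := ρ) p i (confDomain p ρ s i R)
      (fun ε => mergedHamiltonian (fun j k => spectralHamiltonian (p.pre ρ i ε) j k) ε j k)
      (spectralHamiltonian p j k) := by
  have hU := confDomain_mem_nhds hp hi hR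
  by_cases hj : j = i
  · subst hj
    cases k with
    | zero =>
      refine (hasRegularizedLimit_spectralInvariant_add hp hi hR 0).congr hU fun ε _ Y => ?_
      rw [mergedHamiltonian, if_pos rfl, if_pos (by omega)]
      simp only [pow_zero]
      rfl
    | succ k =>
      rw [spectralHamiltonian_succ p j hk]
      have h1 := HasRegularizedLimit.sum Finset.univ
        (fun q => (monomMatrix (ρ j) (p.time j))⁻¹ ⟨k, hk⟩ q)
        fun q _ => hasRegularizedLimit_monom_mul_merged (m := m) (s := s) (ρ := ρ) hp hi hR q
      refine h1.congr hU fun ε _ Y => ?_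
      set S : ℕ → ℂ := fun l => spectralInvariant (p.pre ρ j ε) j.succ l Y with hS
      set v : Fin (ρ j) → ℂ := fun l => (if h : (l : ℕ) < ρ j - 1 then
        ((monomMatrix (ρ j - 1) (p.time j))⁻¹).mulVec
          (fun l : Fin (ρ j - 1) => S ((l : ℕ) + 1)) ⟨l, h⟩ else 0)
        + ε ^ ((l : ℕ) + 1) * spectralInvariant (p.pre ρ j ε) 0 0 Y with hv
      have h2 : mergedHamiltonian
            (fun j' k' => spectralHamiltonian (p.pre ρ j ε) j' k') ε j (k + 1) Y
          = v ⟨k, hk⟩ := by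
        rw [mergedHamiltonian, if_pos rfl, hv]
        congr 1
        rw [spectralHamiltonian_eq_of_rank_eq (preRank_succ_self ρ j) k Y]
        by_cases hk' : k + 1 < ρ j
        · rw [if_pos hk']; rfl
        · rw [if_neg hk', dif_neg (by simp only; omega)]
      -- The functions with known limits are `𝓜` applied to the vector `v` of merged Hamiltonians;
      -- multiplying by `𝓜⁻¹` recovers `v`.
      have h3 : ∀ q : Fin (ρ j), (if (q : ℕ) + 1 < ρ j then
            spectralInvariant (p.pre ρ j ε) j.succ ((q : ℕ) + 1) Y else 0)
          + (∑ k : Fin (ρ j), monomMatrix (ρ j) (p.time j) q k * ε ^ ((k : ℕ) + 1))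
            * spectralInvariant (p.pre ρ j ε) 0 0 Y
          = (monomMatrix (ρ j) (p.time j)).mulVec v q := by
        intro q
        rw [← sum_monomMatrix_mul_pred hi (hp.2.1 j hi) S q, Matrix.mulVec, dotProduct, hv,
          Finset.sum_mul, ← Finset.sum_add_distrib]
        exact Finset.sum_congr rfl fun l _ => by ring
      simp only [h3]
      rw [h2]
      have h4 := congrFun (Matrix.mulVec_mulVec v (monomMatrix (ρ j) (p.time j))⁻¹
        (monomMatrix (ρ j) (p.time j))) ⟨k, hk⟩
      rw [Matrix.nonsing_inv_mul _ (isUnit_det_monomMatrix (hp.2.1 j)), Matrix.one_mulVec] at h4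
      exact h4
  · cases k with
    | zero =>
      refine (hasRegularizedLimit_spectralInvariant_of_ne hp hi hR hj 0).congr hU fun ε _ Y => ?_
      rw [mergedHamiltonian, if_neg hj]
      rfl
    | succ k =>
      rw [spectralHamiltonian_succ p j hk]
      have h1 := HasRegularizedLimit.sum Finset.univ
        (fun q => (monomMatrix (ρ j) (p.time j))⁻¹ ⟨k, hk⟩ q)
        fun q _ => hasRegularizedLimit_spectralInvariant_of_ne (m := m) (s := s) (ρ := ρ)
          hp hi hR hj ((q : ℕ) + 1)
      refine h1.congr hU fun ε _ Y => ?_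
      rw [mergedHamiltonian, if_neg hj,
        spectralHamiltonian_eq_of_rank_eq (preRank_succ_of_ne ρ hj) k Y,
        dif_pos (show k < ρ j by omega)]
      rfl

theorem Times.exists_radii (hp : Function.Injective p.pos) :
    ∃ R : Fin n → ℝ, ∀ j, p.IsolatedAt j (R j) := by
  choose R hR using fun j => Times.exists_isolatedAt hp j one_pos
  exact ⟨R, fun j => (hR j).2⟩

theorem sum_preRank (hi : 1 ≤ ρ i) : ∑ j, preRank ρ i j + 1 = ∑ j, ρ j := by
  rw [Fin.sum_univ_succ, preRank_zero, zero_add, ← Finset.add_sum_erase _ _ (Finset.mem_univ i),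
    ← Finset.add_sum_erase _ ρ (Finset.mem_univ i), preRank_succ_self]
  rw [Finset.sum_congr rfl fun j hj => preRank_succ_of_ne ρ (Finset.ne_of_mem_erase hj)]
  omega

end RegularizedLimit

/-! ### Existence of the confluence cascade -/

/-- Undoing a confluence adds a pole but lowers the total rank by one, so the induction is on the
total rank, over all numbers of poles at once. -/
theorem isConfluentHamiltonian_spectralHamiltonian {m s : ℕ} (N : ℕ) :
    ∀ {n : ℕ} (ρ : Fin n → ℕ) (p : Times n), ∑ j, ρ j = N → p.Admissible ρ s →
      IsConfluentHamiltonian ρ p (fun i k => (spectralHamiltonian p i k : PhaseSpace m ρ s → ℂ)) := by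
  induction N with
  | zero =>
    intro n ρ p hN hp
    refine IsConfluentHamiltonian.schlesinger ρ p _ (fun i => ?_) fun i X => rfl
    exact Finset.sum_eq_zero_iff.1 hN i (Finset.mem_univ i)
  | succ N ih =>
    intro n ρ p hN hp
    obtain ⟨i, hi⟩ : ∃ i, 1 ≤ ρ i := by
      by_contra h
      have : ∑ j, ρ j = 0 := Finset.sum_eq_zero fun j _ => by
        by_contra hj; exact h ⟨j, by omega⟩
      omega
    obtain ⟨R, hR⟩ := Times.exists_radii hp.1
    choose c hc hl using fun (j : Fin n) (k : Fin (ρ j + 1)) =>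
      hasRegularizedLimit_mergedHamiltonian (m := m) hp hi hR j (Nat.lt_succ_iff.1 k.2)
    refine IsConfluentHamiltonian.confluence ρ p _ i hi
      (fun ε j k => spectralHamiltonian (p.pre ρ i ε) j k) (confDomain p ρ s i R)
      (confDomain_mem_nhds hp hi hR)
      (fun ε hε => ih _ _ (by have := sum_preRank hi; omega) hε.2.1)
      (fun ε j k => if h : k < ρ j + 1 then c j ⟨k, h⟩ ε else 0) (fun ε hε j k hk => ?_)
      (fun j k hk => differentiable_spectralHamiltonian hp.1 j hk) (fun γ X hγ j k hk => ?_)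
    · simp only [Nat.lt_succ_iff.2 hk, dif_pos]
      exact hc j ⟨k, _⟩ ε hε
    · simp only [Nat.lt_succ_iff.2 hk, dif_pos]
      exact hl j ⟨k, _⟩ γ X hγ

section Flow

variable {m n s : ℕ} {ρ : Fin n → ℕ}

/-! ### Flows that preserve Casimirs -/

/-- The point of the phase space with given coordinate matrices. -/
def ofSlots (S : Slot ρ s → Matrix (Fin m) (Fin m) ℂ) : PhaseSpace m ρ s :=
  fun x => S x.1 x.2.1 x.2.2

@[simp]
theorem slotMat_ofSlots (S : Slot ρ s → Matrix (Fin m) (Fin m) ℂ) (κ : Slot ρ s) :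
    slotMat (ofSlots S) κ = S κ := rfl

/-- Linear recombination of coordinate matrices. -/
def recombine (τ : Slot ρ s → Slot ρ s → ℂ) (S : Slot ρ s → Matrix (Fin m) (Fin m) ℂ)
    (κ : Slot ρ s) : Matrix (Fin m) (Fin m) ℂ :=
  ∑ μ, τ κ μ • S μ

/-- For `E * E = 0`, the flow of the vector field `S κ ↦ ⁅E, recombine τ S κ⁆`. -/
def nilFlow (τ : Slot ρ s → Slot ρ s → ℂ) (E : Matrix (Fin m) (Fin m) ℂ) (X : PhaseSpace m ρ s)
    (w : ℂ) : PhaseSpace m ρ s :=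
  ofSlots fun κ => slotMat X κ + w • ⁅E, recombine τ (slotMat X) κ⁆
    - w ^ 2 • (E * recombine τ (recombine τ (slotMat X)) κ * E)

theorem nilFlow_zero (τ : Slot ρ s → Slot ρ s → ℂ) (E : Matrix (Fin m) (Fin m) ℂ)
    (X : PhaseSpace m ρ s) : nilFlow τ E X 0 = X := by
  funext x
  simp [nilFlow, ofSlots, slotMat]

theorem recombine_nilFlow (τ : Slot ρ s → Slot ρ s → ℂ) (E : Matrix (Fin m) (Fin m) ℂ)
    (X : PhaseSpace m ρ s) (w : ℂ) (κ : Slot ρ s) :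
    recombine τ (slotMat (nilFlow τ E X w)) κ
      = recombine τ (slotMat X) κ + w • ⁅E, recombine τ (recombine τ (slotMat X)) κ⁆
        - w ^ 2 • (E * recombine τ (recombine τ (recombine τ (slotMat X))) κ * E) := by
  rw [recombine.eq_def τ (slotMat (nilFlow τ E X w)), nilFlow]
  simp only [slotMat_ofSlots, smul_add, smul_sub, Finset.sum_add_distrib, Finset.sum_sub_distrib]
  congr 1
  · congr 1
    rw [recombine.eq_def τ (recombine τ (slotMat X)), Matrix.lie_sum, Finset.smul_sum]
    exact Finset.sum_congr rfl fun μ _ => by rw [Matrix.lie_smul, smul_comm]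
  · rw [recombine.eq_def τ (recombine τ (recombine τ (slotMat X))), Finset.mul_sum, Finset.sum_mul,
      Finset.smul_sum]
    exact Finset.sum_congr rfl fun μ _ => by rw [mul_smul_comm, smul_mul_assoc, smul_comm]

/-- For `E² = 0` one has `[E, [E, Y]] = -2 E Y E`, which commutes with `E`. The exponential series
of the linear field therefore stops after the quadratic term. -/
theorem hasDerivAt_nilFlow (τ : Slot ρ s → Slot ρ s → ℂ) {E : Matrix (Fin m) (Fin m) ℂ}
    (hE : E * E = 0) (X : PhaseSpace m ρ s) (w : ℂ) :
    HasDerivAt (nilFlow τ E X)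
      (ofSlots fun κ => ⁅E, recombine τ (slotMat (nilFlow τ E X w)) κ⁆) w := by
  rw [hasDerivAt_pi]
  rintro ⟨κ, a, b⟩
  have hEE : ∀ Y, E * (E * Y) = 0 := fun Y => by rw [← mul_assoc, hE, zero_mul]
  have h1 : ⁅E, recombine τ (slotMat (nilFlow τ E X w)) κ⁆
      = ⁅E, recombine τ (slotMat X) κ⁆
        - (2 * w) • (E * recombine τ (recombine τ (slotMat X)) κ * E) := by
    rw [recombine_nilFlow]
    simp only [Ring.lie_def, mul_add, mul_sub, add_mul, sub_mul, mul_smul_comm, smul_mul_assoc,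
      mul_assoc, hE, hEE, mul_zero, smul_zero, smul_sub, two_mul, add_smul]
    abel
  have h2 : (ofSlots (fun κ => ⁅E, recombine τ (slotMat (nilFlow τ E X w)) κ⁆) :
      PhaseSpace m ρ s) (κ, a, b)
      = 1 * ⁅E, recombine τ (slotMat X) κ⁆ a b
        - (2 * w) * (E * recombine τ (recombine τ (slotMat X)) κ * E) a b := by
    rw [ofSlots]
    simp only [h1, Matrix.sub_apply, Matrix.smul_apply, smul_eq_mul, one_mul]
  rw [h2]
  have h3 := (((hasDerivAt_id w).mul_const (⁅E, recombine τ (slotMat X) κ⁆ a b)).const_add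
    (slotMat X κ a b)).sub
    ((hasDerivAt_pow 2 w).mul_const ((E * recombine τ (recombine τ (slotMat X)) κ * E) a b))
  refine h3.congr_deriv ?_
  simp

theorem eq_of_fderiv_nilFlow_eq_zero {f : PhaseSpace m ρ s → ℂ} (hf : Differentiable ℂ f)
    (τ : Slot ρ s → Slot ρ s → ℂ) {E : Matrix (Fin m) (Fin m) ℂ} (hE : E * E = 0)
    (h : ∀ X, fderiv ℂ f X (ofSlots fun κ => ⁅E, recombine τ (slotMat X) κ⁆) = 0)
    (X : PhaseSpace m ρ s) (w : ℂ) : f (nilFlow τ E X w) = f X := by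
  have h1 : ∀ w, HasDerivAt (fun w => f (nilFlow τ E X w)) 0 w := fun w => by
    have := (hf (nilFlow τ E X w)).hasFDerivAt.comp_hasDerivAt w (hasDerivAt_nilFlow τ hE X w)
    rwa [h] at this
  have h2 := is_const_of_deriv_eq_zero (fun w => (h1 w).differentiableAt) (fun w => (h1 w).deriv)
    w 0
  simpa only [nilFlow_zero] using h2

theorem trace_hamField (f : PhaseSpace m ρ s → ℂ) (X : PhaseSpace m ρ s) (μ : Slot ρ s) :
    (hamField f X μ).trace = 0 := by
  rw [hamField, Matrix.trace_sum]
  refine Finset.sum_eq_zero fun κ _ => ?_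
  rw [Ring.lie_def, Matrix.trace_sub, Matrix.trace_mul_comm, sub_self]

theorem fderiv_ofSlots (f : PhaseSpace m ρ s → ℂ) (X : PhaseSpace m ρ s)
    (S : Slot ρ s → Matrix (Fin m) (Fin m) ℂ) :
    fderiv ℂ f X (ofSlots S) = ∑ κ, (slotGrad f X κ * S κ).trace := by
  have h1 : (ofSlots S : PhaseSpace m ρ s)
      = ∑ x : CoordIdx m ρ s, ofSlots S x • (Pi.single x 1 : PhaseSpace m ρ s) := by
    funext y
    simp [Finset.sum_apply, Pi.single_apply]
  rw [h1, map_sum, Fintype.sum_prod_type]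
  refine Finset.sum_congr rfl fun κ _ => ?_
  rw [Fintype.sum_prod_type, Finset.sum_comm]
  simp only [Matrix.trace, Matrix.diag, Matrix.mul_apply, map_smul, smul_eq_mul]
  refine Finset.sum_congr rfl fun b _ => Finset.sum_congr rfl fun a _ => ?_
  rw [mul_comm]
  rfl

/-- Cyclicity of the trace: differentiating `f` along the field generated by `E` tests the
Hamiltonian vector field of `f` against `E`. -/
theorem fderiv_lie_slotAdd (f : PhaseSpace m ρ s → ℂ) (X : PhaseSpace m ρ s)
    (E : Matrix (Fin m) (Fin m) ℂ) (μ : Slot ρ s) :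
    fderiv ℂ f X (ofSlots fun κ => ⁅E, slotAdd X κ μ⁆) = -(E * hamField f X μ).trace := by
  rw [fderiv_ofSlots, hamField, Finset.mul_sum, Matrix.trace_sum, ← Finset.sum_neg_distrib]
  refine Finset.sum_congr rfl fun κ _ => ?_
  simp only [Ring.lie_def, mul_sub, Matrix.trace_sub, ← mul_assoc]
  rw [Matrix.trace_mul_cycle (slotGrad f X κ) (slotAdd X κ μ) E,
    Matrix.trace_mul_cycle E (slotAdd X κ μ) (slotGrad f X κ)]
  ring

theorem Matrix.eq_zero_of_trace_mul_eq_zero {M : Matrix (Fin m) (Fin m) ℂ} (hM : M.trace = 0)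
    (h : ∀ E : Matrix (Fin m) (Fin m) ℂ, E * E = 0 → (E * M).trace = 0) : M = 0 := by
  have hoff : ∀ a b, a ≠ b → M a b = 0 := fun a b hab => by
    have := h (Matrix.single b a 1) (by simp [Matrix.single_mul_single_of_ne, hab])
    simpa [Matrix.trace_single_mul] using this
  have hdiag : ∀ a b, M a a = M b b := fun a b => by
    rcases eq_or_ne a b with rfl | hab
    · rfl
    -- `(e_a + e_b)(e_a - e_b)ᵀ` squares to zero, and its pairing with `M` is `M a a - M b b` once
    -- the off-diagonal entries are gone.
    have := h (Matrix.vecMulVec (Pi.single a 1 + Pi.single b 1) (Pi.single a 1 - Pi.single b 1)) (by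
      rw [Matrix.vecMulVec_mul_vecMulVec]
      simp [hab, hab.symm, dotProduct_add])
    rw [Matrix.trace_mul_comm, Matrix.mul_vecMulVec, Matrix.trace_vecMulVec] at this
    simp [Matrix.mulVec_add, hoff a b hab, hoff b a hab.symm, sub_eq_zero] at this
    exact this
  ext a b
  rcases eq_or_ne a b with rfl | hab
  · have : (m : ℂ) * M a a = 0 := by
      rw [← hM, Matrix.trace]
      simp [hdiag _ a]
    have hm : (m : ℂ) ≠ 0 := by
      have := a.pos
      exact_mod_cast this.ne'
    simpa [hm] using this
  · simpa using hoff a b hab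

end Flow

section Split

variable {m n s : ℕ} {ρ : Fin n → ℕ}

/-! ### Splitting a pole -/

theorem coeffA_apply_of_lt (X : PhaseSpace m ρ s) {j : Fin n} {k : ℕ} (hk : k < ρ j + 1)
    (a b : Fin m) : coeffA X j k a b = X (Sum.inl ⟨j, ⟨k, hk⟩⟩, a, b) := by
  rw [coeffA, dif_pos hk]; rfl

theorem coeffInf_apply_of_lt (X : PhaseSpace m ρ s) {k : ℕ} (hk : k < s)
    (a b : Fin m) : coeffInf X k a b = X (Sum.inr ⟨k, hk⟩, a, b) := by
  rw [coeffInf, dif_pos hk]; rfl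

/-- The inverse of `mergePoint i ε` for `ε ≠ 0`. -/
noncomputable def splitPoint (i : Fin n) (ε : ℂ) (X : PhaseSpace m ρ s) :
    PhaseSpace m (preRank ρ i) s :=
  ofSlots fun κ => match κ with
    | Sum.inl ⟨j, k⟩ => Fin.cases ((ε ^ ρ i)⁻¹ • coeffA X i (ρ i))
        (fun j => coeffA X j k - if j = i then (ε ^ (k : ℕ) * (ε ^ ρ i)⁻¹) • coeffA X i (ρ i) else 0) j
    | Sum.inr k => coeffInf X k

theorem coeffA_splitPoint_zero (i : Fin n) (ε : ℂ) (X : PhaseSpace m ρ s) :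
    coeffA (splitPoint i ε X) 0 0 = (ε ^ ρ i)⁻¹ • coeffA X i (ρ i) := by
  ext a b
  rw [coeffA_apply_of_lt _ (Nat.succ_pos _)]
  rfl

theorem coeffA_splitPoint_self {i : Fin n} (hi : 1 ≤ ρ i) (ε : ℂ) (X : PhaseSpace m ρ s) {k : ℕ}
    (hk : k < ρ i) : coeffA (splitPoint i ε X) i.succ k
      = coeffA X i k - (ε ^ k * (ε ^ ρ i)⁻¹) • coeffA X i (ρ i) := by
  ext a b
  rw [coeffA_apply_of_lt _ (by rw [preRank_succ_self]; omega)]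
  simp [splitPoint, ofSlots]

theorem coeffA_splitPoint_of_ne {i j : Fin n} (hj : j ≠ i) (ε : ℂ) (X : PhaseSpace m ρ s) (k : ℕ) :
    coeffA (splitPoint i ε X) j.succ k = coeffA X j k := by
  by_cases hk : k < ρ j + 1
  · ext a b
    rw [coeffA_apply_of_lt _ (by rw [preRank_succ_of_ne ρ hj]; omega)]
    simp [splitPoint, ofSlots, hj]
  · rw [coeffA_of_lt X (by omega), coeffA_of_lt _ (by rw [preRank_succ_of_ne ρ hj]; omega)]

theorem coeffInf_splitPoint (i : Fin n) (ε : ℂ) (X : PhaseSpace m ρ s) (k : ℕ) :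
    coeffInf (splitPoint i ε X) k = coeffInf X k := by
  by_cases hk : k < s
  · ext a b
    rw [coeffInf_apply_of_lt _ hk]
    rfl
  · rw [coeffInf_of_le X (by omega), coeffInf_of_le _ (by omega)]

theorem mergePoint_splitPoint {i : Fin n} (hi : 1 ≤ ρ i) {ε : ℂ} (hε : ε ≠ 0)
    (X : PhaseSpace m ρ s) : mergePoint i ε (splitPoint i ε X) = X := by
  funext ⟨κ, a, b⟩
  rcases κ with ⟨j, k⟩ | k
  · have hX : X (Sum.inl ⟨j, k⟩, a, b) = coeffA X j k a b := by rw [coeffA_apply_of_lt X k.2]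
    rw [mergePoint, hX]
    by_cases hj : j = i
    · subst hj
      rw [if_pos rfl, coeffA_splitPoint_zero]
      by_cases hk : (k : ℕ) < ρ j
      · rw [coeffA_splitPoint_self hi ε X hk]
        simp only [Matrix.sub_apply, Matrix.smul_apply, smul_eq_mul]
        ring
      · have hk' : (k : ℕ) = ρ j := by omega
        rw [coeffA_of_lt _ (by rw [preRank_succ_self]; omega), hk']
        simp [hε]
    · rw [if_neg hj, coeffA_splitPoint_of_ne hj, add_zero]
  · rw [mergePoint, coeffInf_splitPoint, coeffInf_apply_of_lt X k.2]

theorem coeffA_add (X Y : PhaseSpace m ρ s) (j : Fin n) (k : ℕ) :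
    coeffA (X + Y) j k = coeffA X j k + coeffA Y j k := by
  unfold coeffA
  split_ifs
  · rfl
  · rw [add_zero]

theorem coeffA_smul (c : ℂ) (X : PhaseSpace m ρ s) (j : Fin n) (k : ℕ) :
    coeffA (c • X) j k = c • coeffA X j k := by
  unfold coeffA
  split_ifs
  · rfl
  · rw [smul_zero]

/-- `splitPoint` as a continuous linear map. -/
noncomputable def splitCLM (i : Fin n) (ε : ℂ) :
    PhaseSpace m ρ s →L[ℂ] PhaseSpace m (preRank ρ i) s :=
  LinearMap.toContinuousLinearMap
    { toFun := splitPoint i ε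
      map_add' := fun X Y => by
        funext ⟨κ, a, b⟩
        rcases κ with ⟨j, k⟩ | k
        · refine Fin.cases ?_ (fun j k => ?_) j k
          · intro k
            simp only [splitPoint, ofSlots, Fin.cases_zero, coeffA_add, Pi.add_apply, smul_add,
              Matrix.add_apply]
          · simp only [splitPoint, ofSlots, Fin.cases_succ, coeffA_add, Pi.add_apply]
            split_ifs <;> simp only [Matrix.add_apply, Matrix.sub_apply, Matrix.smul_apply,
              smul_eq_mul, Matrix.zero_apply] <;> ring
        · simp only [splitPoint, ofSlots, coeffInf_fin]
          rfl
      map_smul' := fun c X => by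
        funext ⟨κ, a, b⟩
        rcases κ with ⟨j, k⟩ | k
        · refine Fin.cases ?_ (fun j k => ?_) j k
          · intro k
            simp only [splitPoint, ofSlots, Fin.cases_zero, coeffA_smul, Pi.smul_apply,
              Matrix.smul_apply, smul_eq_mul, RingHom.id_apply]
            ring
          · simp only [splitPoint, ofSlots, Fin.cases_succ, coeffA_smul, Pi.smul_apply,
              RingHom.id_apply]
            split_ifs <;> simp only [Matrix.sub_apply, Matrix.smul_apply,
              smul_eq_mul, Matrix.zero_apply] <;> ring
        · simp only [splitPoint, ofSlots, coeffInf_fin]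
          rfl }

theorem splitCLM_apply (i : Fin n) (ε : ℂ) (X : PhaseSpace m ρ s) :
    splitCLM i ε X = splitPoint i ε X := rfl

/-! ### Confluences through given points -/

/-- This supplies enough confluences for the uniqueness: any curve in the limit phase space analytic
at `0` lifts to one, with `C = ε^(-r) A_r` and the matching poles subtracted from the other `A_k`.
-/
theorem isConfluence_splitPoint (p : Times n) {i : Fin n} (hi : 1 ≤ ρ i)
    {x : ℂ → PhaseSpace m ρ s} (hx : ∀ y, AnalyticAt ℂ (fun ε => x ε y) 0) :
    IsConfluence p i (fun ε => splitPoint i ε (x ε)) (x 0) := by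
  have hA : ∀ j k a b, AnalyticAt ℂ (fun ε => coeffA (x ε) j k a b) 0 := fun j k a b => by
    by_cases hk : k < ρ j + 1
    · simp only [coeffA_apply_of_lt _ hk]; exact hx _
    · simp only [coeffA_of_lt _ (show ρ j < k by omega), Matrix.zero_apply]; exact analyticAt_const
  have hI : ∀ k a b, AnalyticAt ℂ (fun ε => coeffInf (x ε) k a b) 0 := fun k a b => by
    by_cases hk : k < s
    · simp only [coeffInf_apply_of_lt _ hk]; exact hx _
    · simp only [coeffInf_of_le _ (show s ≤ k by omega), Matrix.zero_apply]; exact analyticAt_const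
  choose f hf hf0 using fun k a b => (hA i k a b).exists_hasScalarExpansion
  refine ⟨⟨fun j => Matrix.of fun a b => f (ρ i) a b (j + ρ i), ?_, fun k hk => ?_⟩,
    fun j hj k _ => ?_, fun k hk => ?_, fun z hz a b => ?_⟩
  · refine hasAsympExpansion_iff.2 fun a b => ?_
    have h := ((hf (ρ i) a b).zpow_mul (d' := ρ i) (-(ρ i : ℤ)) (by simp)).congr
      (g := fun ε => coeffA (splitPoint i ε (x ε)) 0 0 a b) fun ε hε => by
        rw [coeffA_splitPoint_zero, Matrix.smul_apply, smul_eq_mul, zpow_neg, zpow_natCast]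
    simpa only [sub_neg_eq_add, Matrix.of_apply] using h
  · refine ⟨fun j => Matrix.of fun a b => f k a b j - f (ρ i) a b (j + ρ i - k), fun l hl hl' => ?_,
      hasAsympExpansion_iff.2 fun a b => ?_⟩
    · ext a b
      simp only [Matrix.of_apply, Matrix.neg_apply]
      rw [hf0 k a b _ (by omega), zero_sub]
      congr 2
      ring
    · have h1 := (hf k a b).of_coeff_eq_zero (d' := ρ i - k) fun j hj _ _ => hf0 k a b j hj
      have h2 := ((hf (ρ i) a b).zpow_mul (d' := ρ i - k) ((k : ℤ) - ρ i)
        (by push_cast [hk.le]; ring)).neg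
      have h3 := (h1.add h2).congr (g := fun ε => coeffA (splitPoint i ε (x ε)) i.succ k a b)
        fun ε hε => by
          rw [coeffA_splitPoint_self hi _ _ hk, Matrix.sub_apply, Matrix.smul_apply, smul_eq_mul,
            zpow_sub₀ hε, zpow_natCast, zpow_natCast, div_eq_mul_inv]
          ring
      have e : ∀ j : ℤ, j + ρ i - k = j - (k - ρ i) := fun j => by ring
      simpa only [Matrix.of_apply, e, sub_eq_add_neg (f k a b _)] using h3
  · choose g hg _ using fun a b => (hA j k a b).exists_hasScalarExpansion
    refine ⟨fun q => Matrix.of fun a b => g a b q, hasAsympExpansion_iff.2 fun a b => ?_⟩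
    simpa only [coeffA_splitPoint_of_ne hj, Matrix.of_apply] using hg a b
  · choose g hg _ using fun a b => (hI k a b).exists_hasScalarExpansion
    refine ⟨fun q => Matrix.of fun a b => g a b q, hasAsympExpansion_iff.2 fun a b => ?_⟩
    simpa only [coeffInf_splitPoint, Matrix.of_apply] using hg a b
  · have hne : ∀ᶠ ε : ℂ in 𝓝[≠] 0, ε ≠ 0 := self_mem_nhdsWithin
    refine ((tendstoUniformlyOn_connection_pre hi (L := coeffA (x 0) i (ρ i) a b) ?_ (fun κ => ?_)
      (K := {z}) isCompact_singleton fun j h => hz j h.symm).tendsto_at rfl)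
    · refine ((hA i (ρ i) a b).continuousAt.tendsto.mono_left nhdsWithin_le_nhds).congr' ?_
      filter_upwards [hne] with ε hε
      rw [coeffA_splitPoint_zero, Matrix.smul_apply, smul_eq_mul,
        mul_inv_cancel_left₀ (pow_ne_zero _ hε)]
    · refine ((hx (κ, a, b)).continuousAt.tendsto.mono_left nhdsWithin_le_nhds).congr' ?_
      filter_upwards [hne] with ε hε
      rw [mergePoint_splitPoint hi hε]

end Split

section Deformation

variable {m n s : ℕ} {ρ : Fin n → ℕ}

/-! ### The Poisson structure before a confluence in the coordinates after it -/

/-- The matrix `coeffA X j (k + l)` at the slot `(j, k)`, and `0` at the other poles. -/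
def poleAdd (X : PhaseSpace m ρ s) (j : Fin n) (l : ℕ) : Slot ρ s → Matrix (Fin m) (Fin m) ℂ
  | Sum.inl ⟨j', k⟩ => if j' = j then coeffA X j (k + l) else 0
  | Sum.inr _ => 0

theorem IsCasimir.fderiv_lie_slotAdd {f : PhaseSpace m ρ s → ℂ} (hf : IsCasimir f)
    (X : PhaseSpace m ρ s) (E : Matrix (Fin m) (Fin m) ℂ) (μ : Slot ρ s) :
    fderiv ℂ f X (ofSlots fun κ => ⁅E, slotAdd X κ μ⁆) = 0 := by
  rw [_root_.fderiv_lie_slotAdd, ((isCasimir_iff f).1 hf).2 X μ, mul_zero, Matrix.trace_zero,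
    neg_zero]

theorem IsCasimir.fderiv_lie_poleAdd {f : PhaseSpace m ρ s → ℂ} (hf : IsCasimir f)
    (X : PhaseSpace m ρ s) (E : Matrix (Fin m) (Fin m) ℂ) (j : Fin n) (l : ℕ) :
    fderiv ℂ f X (ofSlots fun κ => ⁅E, poleAdd X j l κ⁆) = 0 := by
  by_cases hl : l < ρ j + 1
  · rw [← hf.fderiv_lie_slotAdd X E (Sum.inl ⟨j, ⟨l, hl⟩⟩)]
    congr 2
    funext κ
    rcases κ with ⟨j', k⟩ | k
    · simp only [poleAdd, slotAdd]
      by_cases h : j' = j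
      · subst h; simp
      · simp [h]
    · rfl
  · have : (ofSlots fun κ => ⁅E, poleAdd X j l κ⁆ : PhaseSpace m ρ s) = 0 := by
      have h0 : ∀ κ, poleAdd X j l κ = 0 := by
        rintro (⟨j', k⟩ | k)
        · rw [poleAdd, coeffA_of_lt X (by omega), ite_self]
        · rfl
      funext x
      simp [ofSlots, h0, Ring.lie_def]
    rw [this, map_zero]

/-- The deformation of `slotAdd` in which the product of slots at the `i`-th pole is that of
`ℂ[x]/(x^r (x - ε))`, `r = ρ i`, in place of `ℂ[x]/(x^(r+1))`. -/
def defAdd (i : Fin n) (ε : ℂ) (X : PhaseSpace m ρ s) :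
    Slot ρ s → Slot ρ s → Matrix (Fin m) (Fin m) ℂ
  | Sum.inl ⟨j, k⟩, Sum.inl ⟨j', l⟩ => if j = j' then coeffA X j ((k : ℕ) + l)
      + (if j = i ∧ ρ i < (k : ℕ) + l then ε ^ ((k : ℕ) + l - ρ i) • coeffA X i (ρ i) else 0) else 0
  | Sum.inr k, Sum.inr l => coeffInf X ((k : ℕ) + l + 1)
  | Sum.inl _, Sum.inr _ => 0
  | Sum.inr _, Sum.inl _ => 0

theorem defAdd_zero (i : Fin n) (X : PhaseSpace m ρ s) (κ μ : Slot ρ s) :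
    defAdd i 0 X κ μ = slotAdd X κ μ := by
  rcases κ with ⟨j, k⟩ | k <;> rcases μ with ⟨j', l⟩ | l <;> simp only [defAdd, slotAdd]
  split_ifs with h1 h2
  · rw [zero_pow (by omega), zero_smul, add_zero]
  · rw [add_zero]
  · rfl

theorem exists_coeffA_eq_sum (j : Fin n) (k : ℕ) : ∃ σ : Slot ρ s → ℂ,
    ∀ X : PhaseSpace m ρ s, coeffA X j k = ∑ μ, σ μ • slotMat X μ := by
  by_cases hk : k < ρ j + 1
  · refine ⟨Pi.single (Sum.inl ⟨j, ⟨k, hk⟩⟩) 1, fun X => ?_⟩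
    simp only [Pi.single_apply, ite_smul, one_smul, zero_smul, Finset.sum_ite_eq', Finset.mem_univ,
      if_true]
    rw [← coeffA_fin]
  · exact ⟨0, fun X => by simp [coeffA_of_lt X (show ρ j < k by omega)]⟩

theorem exists_coeffInf_eq_sum (k : ℕ) : ∃ σ : Slot ρ s → ℂ,
    ∀ X : PhaseSpace m ρ s, coeffInf X k = ∑ μ, σ μ • slotMat X μ := by
  by_cases hk : k < s
  · refine ⟨Pi.single (Sum.inr ⟨k, hk⟩) 1, fun X => ?_⟩
    simp only [Pi.single_apply, ite_smul, one_smul, zero_smul, Finset.sum_ite_eq', Finset.mem_univ,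
      if_true]
    rw [← coeffInf_fin]
  · exact ⟨0, fun X => by simp [coeffInf_of_le X (show s ≤ k by omega)]⟩

/-- The deformed product is linear in the point and polynomial in `ε`, so its fields have the
polynomial flows above, analytic in `ε` up to `ε = 0`. -/
theorem exists_defAdd_eq_recombine (i : Fin n) (μ : Slot ρ s) :
    ∃ τ : ℂ → Slot ρ s → Slot ρ s → ℂ, (∀ κ ν, AnalyticAt ℂ (fun ε => τ ε κ ν) 0) ∧
      ∀ ε (X : PhaseSpace m ρ s) κ, defAdd i ε X κ μ = recombine (τ ε) (slotMat X) κ := by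
  suffices h : ∀ κ, ∃ τ : ℂ → Slot ρ s → ℂ, (∀ ν, AnalyticAt ℂ (fun ε => τ ε ν) 0) ∧
      ∀ ε (X : PhaseSpace m ρ s), defAdd i ε X κ μ = ∑ ν, τ ε ν • slotMat X ν by
    choose τ h1 h2 using h
    exact ⟨fun ε κ => τ κ ε, h1, fun ε X κ => h2 κ ε X⟩
  intro κ
  have hzero : ∃ τ : ℂ → Slot ρ s → ℂ, (∀ ν, AnalyticAt ℂ (fun ε => τ ε ν) 0) ∧
      ∀ ε (X : PhaseSpace m ρ s), 0 = ∑ ν, τ ε ν • slotMat X ν :=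
    ⟨0, fun _ => analyticAt_const, fun _ _ => by simp⟩
  rcases κ with ⟨j, k⟩ | k <;> rcases μ with ⟨j', l⟩ | l <;> simp only [defAdd]
  · by_cases h1 : j = j'
    · obtain ⟨σ, hσ⟩ := exists_coeffA_eq_sum (m := m) (ρ := ρ) (s := s) j ((k : ℕ) + l)
      by_cases h2 : j = i ∧ ρ i < (k : ℕ) + l
      · obtain ⟨σ', hσ'⟩ := exists_coeffA_eq_sum (m := m) (ρ := ρ) (s := s) i (ρ i)
        refine ⟨fun ε ν => σ ν + ε ^ ((k : ℕ) + l - ρ i) * σ' ν, fun ν => by fun_prop,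
          fun ε X => ?_⟩
        rw [if_pos h1, if_pos h2, hσ, hσ', Finset.smul_sum, ← Finset.sum_add_distrib]
        exact Finset.sum_congr rfl fun ν _ => by rw [add_smul, mul_smul]
      · refine ⟨fun _ => σ, fun _ => analyticAt_const, fun ε X => ?_⟩
        rw [if_pos h1, if_neg h2, add_zero, hσ]
    · simpa only [if_neg h1] using hzero
  · exact hzero
  · exact hzero
  · obtain ⟨σ, hσ⟩ := exists_coeffInf_eq_sum (m := m) (ρ := ρ) (s := s) ((k : ℕ) + l + 1)
    exact ⟨fun _ => σ, fun _ => analyticAt_const, fun ε X => hσ X⟩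

theorem coeffA_ofSlots (S : Slot ρ s → Matrix (Fin m) (Fin m) ℂ) {j : Fin n} {k : ℕ}
    (hk : k < ρ j + 1) : coeffA (ofSlots S) j k = S (Sum.inl ⟨j, ⟨k, hk⟩⟩) := by
  ext a b
  rw [coeffA_apply_of_lt _ hk]
  rfl

theorem coeffInf_ofSlots (S : Slot ρ s → Matrix (Fin m) (Fin m) ℂ) {k : ℕ}
    (hk : k < s) : coeffInf (ofSlots S) k = S (Sum.inr ⟨k, hk⟩) := by
  ext a b
  rw [coeffInf_apply_of_lt _ hk]
  rfl

theorem Matrix.lie_zero (E : Matrix (Fin m) (Fin m) ℂ) :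
    ⁅E, (0 : Matrix (Fin m) (Fin m) ℂ)⁆ = 0 := by
  simp [Ring.lie_def]

theorem Matrix.lie_sub (E A B : Matrix (Fin m) (Fin m) ℂ) : ⁅E, A - B⁆ = ⁅E, A⁆ - ⁅E, B⁆ := by
  simp only [Ring.lie_def, mul_sub, sub_mul]; abel

/-- A point is determined by its coefficient matrices. -/
theorem phaseSpace_ext {X Y : PhaseSpace m ρ s} (hA : ∀ j, ∀ k ≤ ρ j, coeffA X j k = coeffA Y j k)
    (hI : ∀ k < s, coeffInf X k = coeffInf Y k) : X = Y := by
  funext ⟨κ, a, b⟩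
  rcases κ with ⟨j, k⟩ | k
  · have := congrFun₂ (hA j k (by omega)) a b
    rwa [coeffA_apply_of_lt X k.2, coeffA_apply_of_lt Y k.2] at this
  · have := congrFun₂ (hI k k.2) a b
    rwa [coeffInf_apply_of_lt X k.2, coeffInf_apply_of_lt Y k.2] at this

/-- For `ε ≠ 0`, `ℂ[x]/(x^r (x - ε))` is the product of `ℂ[x]/(x^r)` and `ℂ`, and `x^l` has
components `x^l` and `ε^l`. Dually, the deformed field splits into fields at the two poles before
the confluence. -/
theorem splitPoint_lie_defAdd_self {i : Fin n} (hi : 1 ≤ ρ i) {ε : ℂ} (hε : ε ≠ 0)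
    (X : PhaseSpace m ρ s) (E : Matrix (Fin m) (Fin m) ℂ) (l : Fin (ρ i + 1)) :
    splitPoint i ε (ofSlots fun κ => ⁅E, defAdd i ε X κ (Sum.inl ⟨i, l⟩)⁆)
      = ofSlots (fun κ => ⁅E, poleAdd (splitPoint i ε X) i.succ l κ⁆)
        + ε ^ (l : ℕ) • ofSlots (fun κ => ⁅E, poleAdd (splitPoint i ε X) 0 0 κ⁆) := by
  -- This is the relation `x^(r+l) = ε^l x^r` in the deformed ring.
  have hr : coeffA X i (ρ i + l) + (if ρ i < ρ i + (l : ℕ) then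
      ε ^ (ρ i + (l : ℕ) - ρ i) • coeffA X i (ρ i) else 0) = ε ^ (l : ℕ) • coeffA X i (ρ i) := by
    rcases Nat.eq_zero_or_pos (l : ℕ) with h | h
    · simp [h]
    · rw [coeffA_of_lt X (by omega), if_pos (by omega), Nat.add_sub_cancel_left, zero_add]
  refine phaseSpace_ext (fun j k hk => ?_) fun k hk => ?_
  · rw [coeffA_add, coeffA_smul, coeffA_ofSlots _ (by omega), coeffA_ofSlots _ (by omega)]
    revert hk
    refine Fin.cases (fun hk => ?_) (fun j hk => ?_) j
    · obtain rfl : k = 0 := by simpa [preRank_zero] using hk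
      rw [coeffA_splitPoint_zero, coeffA_ofSlots _ (by omega)]
      simp only [poleAdd, defAdd, if_true, true_and, hr, (Fin.succ_ne_zero i).symm, if_false, add_zero,
        coeffA_splitPoint_zero, Matrix.lie_smul, Matrix.lie_zero, zero_add]
      rw [smul_comm]
    · by_cases hj : j = i
      · subst hj
        rw [preRank_succ_self] at hk
        rw [coeffA_splitPoint_self hi _ _ (by omega), coeffA_ofSlots _ (by omega),
          coeffA_ofSlots _ (by omega)]
        simp only [poleAdd, defAdd, if_true, true_and, hr, Fin.succ_ne_zero j, if_false,
          Matrix.lie_zero, smul_zero, add_zero]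
        rw [← Matrix.lie_smul, ← Matrix.lie_sub]
        congr 1
        by_cases hkl : k + (l : ℕ) < ρ j
        · rw [coeffA_splitPoint_self hi _ _ hkl, if_neg (by omega), add_zero, smul_smul, pow_add]
          congr 2
          ring
        · rw [coeffA_of_lt (splitPoint j ε X) (by rw [preRank_succ_self]; omega), smul_smul]
          have hpow : ε ^ k * (ε ^ ρ j)⁻¹ * ε ^ (l : ℕ) = ε ^ (k + l - ρ j) := by
            rw [pow_sub₀ _ hε (by omega), pow_add]; ring
          rw [hpow]
          rcases eq_or_lt_of_le (not_lt.1 hkl) with h | h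
          · rw [← h]; simp
          · rw [if_pos h, coeffA_of_lt X h, zero_add, sub_self]
      · rw [preRank_succ_of_ne ρ hj] at hk
        rw [coeffA_splitPoint_of_ne hj, coeffA_ofSlots _ (by omega)]
        simp [poleAdd, defAdd, hj, Fin.succ_ne_zero j, Matrix.lie_zero]
  · rw [coeffInf_splitPoint, coeffInf_ofSlots _ hk, coeffInf]
    simp [hk, defAdd, ofSlots, poleAdd, Matrix.lie_zero]
    rfl

theorem splitPoint_lie_defAdd_of_ne {i j : Fin n} (hi : 1 ≤ ρ i) (hj : j ≠ i) (ε : ℂ)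
    (X : PhaseSpace m ρ s) (E : Matrix (Fin m) (Fin m) ℂ) (l : Fin (ρ j + 1)) :
    splitPoint i ε (ofSlots fun κ => ⁅E, defAdd i ε X κ (Sum.inl ⟨j, l⟩)⁆)
      = ofSlots (fun κ => ⁅E, poleAdd (splitPoint i ε X) j.succ l κ⁆) := by
  refine phaseSpace_ext (fun j' k hk => ?_) fun k hk => ?_
  · rw [coeffA_ofSlots _ (by omega)]
    revert hk
    refine Fin.cases (fun hk => ?_) (fun j' hk => ?_) j'
    · obtain rfl : k = 0 := by simpa [preRank_zero] using hk
      rw [coeffA_splitPoint_zero, coeffA_ofSlots _ (by omega)]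
      simp [poleAdd, defAdd, hj.symm, (Fin.succ_ne_zero j).symm, Matrix.lie_zero]
    · by_cases hj' : j' = i
      · subst hj'
        rw [preRank_succ_self] at hk
        rw [coeffA_splitPoint_self hi _ _ (by omega), coeffA_ofSlots _ (by omega),
          coeffA_ofSlots _ (by omega)]
        simp [poleAdd, defAdd, hj.symm, Matrix.lie_zero]
      · rw [preRank_succ_of_ne ρ hj'] at hk
        rw [coeffA_splitPoint_of_ne hj', coeffA_ofSlots _ (by omega)]
        simp only [poleAdd, defAdd, hj', false_and, if_false, add_zero, Fin.succ_inj]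
        split_ifs with h
        · rw [h, coeffA_splitPoint_of_ne hj]
        · rfl
  · rw [coeffInf_splitPoint, coeffInf_ofSlots _ hk, coeffInf_ofSlots _ hk]
    rfl

theorem splitPoint_lie_defAdd_inr {i : Fin n} (hi : 1 ≤ ρ i) (ε : ℂ)
    (X : PhaseSpace m ρ s) (E : Matrix (Fin m) (Fin m) ℂ) (l : Fin s) :
    splitPoint i ε (ofSlots fun κ => ⁅E, defAdd i ε X κ (Sum.inr l)⁆)
      = ofSlots (fun κ => ⁅E, slotAdd (splitPoint i ε X) κ (Sum.inr l)⁆) := by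
  refine phaseSpace_ext (fun j' k hk => ?_) fun k hk => ?_
  · rw [coeffA_ofSlots _ (by omega)]
    revert hk
    refine Fin.cases (fun hk => ?_) (fun j' hk => ?_) j'
    · obtain rfl : k = 0 := by simpa [preRank_zero] using hk
      rw [coeffA_splitPoint_zero, coeffA_ofSlots _ (by omega)]
      simp [slotAdd, defAdd, Matrix.lie_zero]
    · by_cases hj' : j' = i
      · subst hj'
        rw [preRank_succ_self] at hk
        rw [coeffA_splitPoint_self hi _ _ (by omega), coeffA_ofSlots _ (by omega),
          coeffA_ofSlots _ (by omega)]
        simp [slotAdd, defAdd, Matrix.lie_zero]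
      · rw [preRank_succ_of_ne ρ hj'] at hk
        rw [coeffA_splitPoint_of_ne hj', coeffA_ofSlots _ (by omega)]
        rfl
  · rw [coeffInf_splitPoint, coeffInf_ofSlots _ hk, coeffInf_ofSlots _ hk]
    simp only [defAdd, slotAdd, coeffInf_splitPoint]

/-- In the merged coordinates, a Casimir before the confluence is annihilated by the fields of the
deformed structure. -/
theorem IsCasimir.fderiv_comp_splitPoint {i : Fin n} (hi : 1 ≤ ρ i) {ε : ℂ} (hε : ε ≠ 0)
    {f : PhaseSpace m (preRank ρ i) s → ℂ} (hf : IsCasimir f) (X : PhaseSpace m ρ s)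
    (E : Matrix (Fin m) (Fin m) ℂ) (μ : Slot ρ s) :
    fderiv ℂ (fun X => f (splitPoint i ε X)) X (ofSlots fun κ => ⁅E, defAdd i ε X κ μ⁆) = 0 := by
  have h1 : HasFDerivAt (fun X => f (splitPoint i ε X))
      ((fderiv ℂ f (splitPoint i ε X)).comp (splitCLM i ε)) X :=
    (hf.1 (splitPoint i ε X)).hasFDerivAt.comp X (splitCLM i ε).hasFDerivAt
  rw [h1.fderiv, ContinuousLinearMap.comp_apply, splitCLM_apply]
  rcases μ with ⟨j, l⟩ | l
  · by_cases hj : j = i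
    · subst hj
      rw [splitPoint_lie_defAdd_self hi hε, map_add, map_smul, hf.fderiv_lie_poleAdd,
        hf.fderiv_lie_poleAdd, smul_zero, add_zero]
    · rw [splitPoint_lie_defAdd_of_ne hi hj, hf.fderiv_lie_poleAdd]
  · rw [splitPoint_lie_defAdd_inr hi, hf.fderiv_lie_slotAdd]

end Deformation

section Uniqueness

variable {m n s : ℕ} {ρ : Fin n → ℕ}

/-! ### Limits of Casimirs -/

theorem analyticAt_nilFlow {τ : ℂ → Slot ρ s → Slot ρ s → ℂ}
    (hτ : ∀ κ ν, AnalyticAt ℂ (fun ε => τ ε κ ν) 0) (E : Matrix (Fin m) (Fin m) ℂ)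
    (X : PhaseSpace m ρ s) (w : ℂ) (x : CoordIdx m ρ s) :
    AnalyticAt ℂ (fun ε => nilFlow (τ ε) E X w x) 0 := by
  have hrec : ∀ S : ℂ → Slot ρ s → Matrix (Fin m) (Fin m) ℂ,
      (∀ κ a b, AnalyticAt ℂ (fun ε => S ε κ a b) 0) →
      ∀ κ a b, AnalyticAt ℂ (fun ε => recombine (τ ε) (S ε) κ a b) 0 := by
    intro S hS κ a b
    simp only [recombine, Matrix.sum_apply, Matrix.smul_apply, smul_eq_mul]
    exact Finset.analyticAt_fun_sum _ fun ν _ => (hτ κ ν).mul (hS ν a b)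
  have h1 := hrec (fun _ => slotMat X) fun _ _ _ => analyticAt_const
  have h2 := hrec _ h1
  simp only [nilFlow, ofSlots, Matrix.sub_apply, Matrix.add_apply, Matrix.smul_apply, smul_eq_mul,
    Ring.lie_def, Matrix.mul_apply]
  refine (analyticAt_const.add (analyticAt_const.mul ?_)).sub (analyticAt_const.mul ?_)
  · exact (Finset.analyticAt_fun_sum _ fun c _ => analyticAt_const.mul (h1 _ _ _)).sub
      (Finset.analyticAt_fun_sum _ fun c _ => (h1 _ _ _).mul analyticAt_const)
  · exact Finset.analyticAt_fun_sum _ fun c _ =>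
      (Finset.analyticAt_fun_sum _ fun c _ => analyticAt_const.mul (h2 _ _ _)).mul analyticAt_const

/-- A holomorphic function that is the limit of Casimirs along all confluences is a Casimir. -/
theorem isCasimir_of_tendsto {p : Times n} {i : Fin n} (hi : 1 ≤ ρ i) {U : Set ℂ}
    (hU : U ∈ 𝓝[≠] (0 : ℂ)) {d : ℂ → PhaseSpace m (preRank ρ i) s → ℂ}
    (hd : ∀ ε ∈ U, IsCasimir (d ε)) {D : PhaseSpace m ρ s → ℂ} (hD : Differentiable ℂ D)
    (hlim : ∀ γ X, IsConfluence p i γ X → Tendsto (fun ε => d ε (γ ε)) (𝓝[≠] 0) (𝓝 (D X))) :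
    IsCasimir D := by
  refine (isCasimir_iff D).2 ⟨hD, fun X μ => ?_⟩
  refine Matrix.eq_zero_of_trace_mul_eq_zero (trace_hamField D X μ) fun E hE => ?_
  obtain ⟨τ, hτ, hdef⟩ := exists_defAdd_eq_recombine (m := m) i μ
  -- The endpoint of the deformed flow, as a function of `ε`, lifts to a confluence, and so does the
  -- constant curve `X`. The Casimirs agree along the two lifts, hence the limits agree.
  have hinv : ∀ w, D (nilFlow (τ 0) E X w) = D X := fun w => by
    have h1 := hlim _ _ (isConfluence_splitPoint p hi (analyticAt_nilFlow hτ E X w))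
    have h2 := hlim _ _ (isConfluence_splitPoint p hi (x := fun _ => X) fun _ => analyticAt_const)
    refine tendsto_nhds_unique (h1.congr' ?_) h2
    filter_upwards [hU, self_mem_nhdsWithin] with ε hε hε0
    refine eq_of_fderiv_nilFlow_eq_zero (f := fun X => d ε (splitPoint i ε X))
      ((hd ε hε).1.comp (splitCLM i ε).differentiable) (τ ε) hE (fun Y => ?_) X w
    simp only [← hdef]
    exact (hd ε hε).fderiv_comp_splitPoint hi hε0 Y E μ
  have h3 := (hD (nilFlow (τ 0) E X 0)).hasFDerivAt.comp_hasDerivAt 0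
    (hasDerivAt_nilFlow (τ 0) hE X 0)
  -- Differentiating at time zero gives the trace pairing of `E` with the Hamiltonian vector field
  -- of `D`, as the structure at `ε = 0` is the undeformed one.
  have h4 : D ∘ nilFlow (τ 0) E X = fun _ => D X := funext hinv
  rw [h4] at h3
  have h5 := h3.unique (hasDerivAt_const (0 : ℂ) (D X))
  simp only [nilFlow_zero, ← hdef, defAdd_zero] at h5
  rw [fderiv_lie_slotAdd, neg_eq_zero] at h5
  exact h5

theorem isCasimir_mergedHamiltonian_sub {i : Fin n} (hi : 1 ≤ ρ i)
    {H K : Fin (n + 1) → ℕ → PhaseSpace m (preRank ρ i) s → ℂ}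
    (h : ∀ j, ∀ k ≤ preRank ρ i j, IsCasimir fun X => H j k X - K j k X) (ε : ℂ) (j : Fin n)
    {k : ℕ} (hk : k ≤ ρ j) :
    IsCasimir fun X => mergedHamiltonian H ε j k X - mergedHamiltonian K ε j k X := by
  unfold mergedHamiltonian
  split_ifs with hj hk'
  · subst hj
    have := (h j.succ k (by rw [preRank_succ_self]; omega)).add
      ((h 0 0 (Nat.zero_le _)).const_mul (ε ^ k))
    convert this using 2
    ring
  · have := (h 0 0 (Nat.zero_le _)).const_mul (ε ^ k)
    convert this using 2
    ring
  · exact h j.succ k (by rw [preRank_succ_of_ne ρ hj]; exact hk)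

end Uniqueness

/-! ### Uniqueness up to Casimirs and the main theorem -/

/-- Induction along the cascade. The given and the spectral Hamiltonians differ by Casimirs before
each confluence, and their regularisations differ by Casimirs too, so the difference of the limits
is a limit of Casimirs. -/
theorem IsConfluentHamiltonian.isCasimir_sub {m n s : ℕ} {ρ : Fin n → ℕ} {p : Times n}
    {H : Fin n → ℕ → PhaseSpace m ρ s → ℂ} (hH : IsConfluentHamiltonian ρ p H) :
    p.Admissible ρ s → ∀ i, ∀ k ≤ ρ i,
      IsCasimir fun X => H i k X - spectralHamiltonian p i k X := by
  induction hH with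
  | schlesinger ρ p H hρ hH =>
    intro _ i k hk
    obtain rfl : k = 0 := by rw [hρ i] at hk; omega
    simp only [hH, spectralHamiltonian, sub_self]
    exact isCasimir_zero
  | confluence ρ p H i hi H' U hU hH' c hc hd hlim ih =>
    intro hp j k hk
    obtain ⟨R, hR⟩ := Times.exists_radii hp.1
    obtain ⟨c', hc', hlim'⟩ := hasRegularizedLimit_mergedHamiltonian (m := m) hp hi hR j hk
    refine isCasimir_of_tendsto (p := p) hi
      (inter_mem hU (confDomain_mem_nhds hp hi hR))
      (d := fun ε Y => (mergedHamiltonian (H' ε) ε j k Y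
        - mergedHamiltonian (fun j k => spectralHamiltonian (p.pre ρ i ε) j k) ε j k Y)
        + (c ε j k Y - c' ε Y)) (fun ε hε => ?_)
      ((hd j k hk).sub (differentiable_spectralHamiltonian hp.1 j hk)) fun γ X hγ => ?_
    · exact (isCasimir_mergedHamiltonian_sub hi (ih ε hε.1 hε.2.2.1) ε j hk).add
        ((hc ε hε.1 j k hk).sub (hc' ε hε.2))
    · exact ((hlim γ X hγ j k hk).sub (hlim' γ X hγ)).congr fun ε => by ring

theorem mainTheorem3 {m n s : ℕ} (ρ : Fin n → ℕ) (p : Times n) (hp : p.Admissible ρ s) :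
    (∀ i, IsUnit (monomMatrix (ρ i) (p.time i)).det) ∧
    IsConfluentHamiltonian ρ p
      (fun i k => (spectralHamiltonian p i k : PhaseSpace m ρ s → ℂ)) ∧
    (∀ H : Fin n → ℕ → PhaseSpace m ρ s → ℂ, IsConfluentHamiltonian ρ p H →
      ∀ i, ∀ k ≤ ρ i, IsCasimir (fun X => H i k X - spectralHamiltonian p i k X)) ∧
    (∀ i, ∀ k ≤ ρ i,
      IsIsomonodromicHamiltonian p i k (spectralHamiltonian p i k : PhaseSpace m ρ s → ℂ)) ∧
    (∀ i, ∀ k ≤ ρ i, ∀ H : PhaseSpace m ρ s → ℂ, IsIsomonodromicHamiltonian p i k H →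
      IsCasimir (fun X => H X - spectralHamiltonian p i k X)) := by
  exact ⟨fun i => isUnit_det_monomMatrix (hp.2.1 i),
    isConfluentHamiltonian_spectralHamiltonian _ ρ p rfl hp,
    fun H hH => hH.isCasimir_sub hp,
    fun i k hk => isIsomonodromicHamiltonian_spectralHamiltonian hp i hk,
    fun i k hk H hH => hH.isCasimir_sub hp (isIsomonodromicHamiltonian_spectralHamiltonian hp i hk)⟩
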